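/- Conventions. Let $n\ge2$; $\mathcal D'$ denotes distributions, $C_0^\infty(W)$ smooth functions with compact support in $W$, $\hat f(\alpha,p)=\int_{\alpha\cdot x=p}f$ the Radon transform, $\alpha\in S^{n-1}$, $p\in\mathbb R$. For $u,u_0\in\mathcal D'(\mathbb R^n)$ and $a\in\mathbb R$ we write $u(x_0+\varepsilon\check x)\sim\varepsilon^a u_0(\check x)$ (expansion in smoothness; $u_0$ is the leading singularity of $u$ at $x_0$) if there is $m_0\ge 0$ such that for all integers $m\ge m_0$, all homogeneous polynomials $P_m$ of degree $m$ and all $w\in C_0^\infty(\mathbb R^n)$ $$\lim_{\varepsilon\to0^+}\varepsilon^{m-a}\,(u,P_m(\partial_x)w_\varepsilon)=(u_0,P_m(\partial_x)w),\qquad w_\varepsilon(x)=\varepsilon^{-n}w((x-x_0)/\varepsilon).$$ The function $f$. Let $\xi_0\ne0$, $\Theta_0=\xi_0/|\xi_0|$, let $\Omega\subset S^{n-1}$ be an open neighborhood of $\Theta_0$, and let $H\in C^\infty(\mathbb R^n\setminus0)$ be real-valued, homogeneous of degree one, odd on $\Omega\cup(-\Omega)$, with $H'(\xi_0)=x_0$.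 Let $\check H''(\alpha)$ denote the Hessian of $H$ at $\alpha\in S^{n-1}$ restricted to the hyperplane orthogonal to $\alpha$; assume that it is negative definite for $\alpha\in\Omega$, and that $\Omega$ is so small that $\alpha\in\Omega$, $H'(\alpha)=x_0$ imply $\alpha=\Theta_0$. Let $f\in L^1(\mathbb R^n)$ be given by the oscillatory integral $$f(x)=\frac1{(2\pi)^n}\int_{\mathbb R^n}\tilde v(\xi)e^{i(H(\xi)-\xi\cdot x)}\,d\xi,\qquad \tilde v\in C^\infty(\mathbb R^n),$$ where $$\tilde v(\lambda\alpha)\sim\omega(\alpha)\sum_{j\ge0}\lambda^{-s_j}\tilde v_j(\alpha),\ \lambda\to+\infty,\qquad \omega(\alpha)=\frac{|\det\check H''(\alpha)|^{1/2}e^{-\frac{i\pi}4\mathrm{sgn}\,\check H''(\alpha)}}{(2\pi)^{(n-1)/2}},$$ $\frac{n+1}2\le s_0<s_1<\dots$, $s_j\to\infty$, $\tilde v_j\in C_0^\infty(\Omega\cup(-\Omega))$ (here $\mathrm{sgn}$ is the signature). The expansion can be differentiated in $\alpha$ and $\lambda$ any number of times: for all $J,l,\nu$ there is $a_{Jl\nu}\in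 C_0^\infty(\Omega\cup(-\Omega))$ with $$\Big|\partial_\lambda^l\partial_\alpha^\nu\Big(\tilde v(\lambda\alpha)-\omega(\alpha)\sum_{j<J}\lambda^{-s_j}\tilde v_j(\alpha)\Big)\Big|\le a_{Jl\nu}(\alpha)\lambda^{-(s_J+l)},\qquad \lambda\ge1,\ \alpha\in S^{n-1}.$$ The operator $\mathcal B$. Let $$(\mathcal B\hat f)(x)=\int_{S^{n-1}}\int_{\mathbb R}B(\alpha,\alpha\cdot x-p)\hat f(\alpha,p)\,dp\,d\alpha,\qquad B(\alpha,p)=\frac1{2\pi}\int\tilde B(\alpha,\lambda)e^{-i\lambda p}\,d\lambda$$ (as an oscillatory integral), where $\tilde B\in C^\infty(S^{n-1}\times\mathbb R)$, $\tilde B(-\alpha,-\lambda)=\tilde B(\alpha,\lambda)$, and $\tilde B(\alpha,\lambda)\sim\sum_{j\ge0}\lambda^{\beta_j}\tilde B_j(\alpha)$ as $\lambda\to+\infty$, with $\beta_0>\beta_1>\dots$, $\beta_j\to-\infty$, $\tilde B_j\in C^\infty(S^{n-1})$; this expansion can be differentiated in $\alpha$ and $\lambda$ any number of times, uniformly in $\alpha\in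 S^{n-1}$. Assume $$\kappa_2:=\beta_0-s_0-\frac{n-3}2\ge0,$$ and, if $\kappa_2=0$, assume also $\tilde v_0(-\alpha)\tilde B_0(-\alpha)=-\tilde v_0(\alpha)\tilde B_0(\alpha)$ for $\alpha\in\Omega\cup(-\Omega)$. Claim. $\mathcal B\hat f\in\mathcal D'(\mathbb R^n)$, and its leading singularity at $x_0$ is given by $$(\mathcal B\hat f)(x_0+\varepsilon\check x)\sim\varepsilon^{-\kappa_2}\mu(\check x\cdot\Theta_0)=\mu(\varepsilon\check x\cdot\Theta_0),$$ where $\mu\in\mathcal D'(\mathbb R)$ is, with $\mu_\pm:=2\tilde B_0(\pm\Theta_0)\tilde v_0(\pm\Theta_0)$ and $q_2:=e^{-i\kappa_2\pi/2}$, $$\mu(t)=\frac{\Gamma(\kappa_2)}{2\pi}\Big[q_2\,\mu_+\,(t-i0)^{-\kappa_2}+\frac{\mu_-}{q_2}\,(t+i0)^{-\kappa_2}\Big]\ \text{ if }\kappa_2>0,\qquad \mu(t)=-\frac i2\,\mu_+\,\mathrm{sgn}(t)\ \text{ if }\kappa_2=0.$$ -/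

import Mathlib

open MeasureTheory Set Filter TopologicalSpace
open scoped Convolution Topology ContDiff Distributions LineDeriv RealInnerProductSpace

noncomputable section

/-! ### Euclidean space, functions on the unit sphere

`Euc n` is `ℝⁿ` with the Euclidean norm. A function on the unit sphere `S^{n-1}` is represented by
a function on `Euc n` of which only the values at unit vectors are ever used: smoothness on the
sphere, and derivatives along the sphere, are those of the extension that is homogeneous of
degree zero. -/

abbrev Euc (n : ℕ) : Type := EuclideanSpace ℝ (Fin n)

/-- Radial projection to the unit sphere (for `ξ ≠ 0`). -/
def unitDir {n : ℕ} (ξ : Euc n) : Euc n := ‖ξ‖⁻¹ • ξ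

lemma norm_eq_one_of_eq_unitDir {n : ℕ} {ξ Θ : Euc n} (hξ : ξ ≠ 0) (hΘ : Θ = unitDir ξ) :
    ‖Θ‖ = 1 := by
  rw [hΘ, unitDir, norm_smul, norm_inv, norm_norm, inv_mul_cancel₀ (norm_ne_zero_iff.mpr hξ)]

/-- `Ω` is an open subset of the unit sphere. -/
def IsOpenInSphere {n : ℕ} (Ω : Set (Euc n)) : Prop :=
  ∃ U : Set (Euc n), IsOpen U ∧ Ω = U ∩ Metric.sphere 0 1

/-- `g ∈ C^∞(S^{n-1})`. -/
def SmoothOnSphere {n : ℕ} {F : Type*} [NormedAddCommGroup F] [NormedSpace ℝ F]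
    (g : Euc n → F) : Prop :=
  ContDiffOn ℝ ∞ (fun ξ => g (unitDir ξ)) {0}ᶜ

/-- `g ∈ C_0^∞(W)` for an open subset `W` of the sphere (extended by zero to the sphere). -/
def IsTestOnSphere {n : ℕ} {F : Type*} [NormedAddCommGroup F] [NormedSpace ℝ F]
    (W : Set (Euc n)) (g : Euc n → F) : Prop :=
  SmoothOnSphere g ∧
    ∃ K : Set (Euc n), IsCompact K ∧ K ⊆ W ∧ ∀ α : Euc n, ‖α‖ = 1 → α ∉ K → g α = 0

/-- The size at `(α, r)`, `|α| = 1`, of the derivatives of total order `k` along the sphere and of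
order `l` in the radial variable, of a function `D` on `S^{n-1} × ℝ`. -/
def mixedDerivNorm {n : ℕ} (D : Euc n → ℝ → ℂ) (k l : ℕ) (α : Euc n) (r : ℝ) : ℝ :=
  ‖iteratedFDeriv ℝ k (fun ξ => iteratedDeriv l (fun t => D (unitDir ξ) t) r) α‖

/-! ### Integration over hyperplanes and the Radon transform -/

/-- Lebesgue measure on the hyperplane through the origin orthogonal to `α`. -/
def hyperplaneMeasure {n : ℕ} (α : Euc n) : Measure ((ℝ ∙ α)ᗮ : Submodule ℝ (Euc n)) :=
  (stdOrthonormalBasis ℝ ((ℝ ∙ α)ᗮ : Submodule ℝ (Euc n))).toBasis.addHaar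

instance {n : ℕ} (α : Euc n) : (hyperplaneMeasure α).IsAddHaarMeasure :=
  isAddHaarMeasure_basis_addHaar _

/-- Radon transform `f̂(α, p) = ∫_{α·x = p} f`, for a unit vector `α`. -/
def radon {n : ℕ} {F : Type*} [NormedAddCommGroup F] [NormedSpace ℝ F]
    (f : Euc n → F) (α : Euc n) (p : ℝ) : F :=
  ∫ y : ((ℝ ∙ α)ᗮ : Submodule ℝ (Euc n)), f (p • α + (y : Euc n)) ∂(hyperplaneMeasure α)

lemma norm_smul_add_orth {n : ℕ} {α : Euc n} (hα : ‖α‖ = 1) (p : ℝ)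
    (y : ((ℝ ∙ α)ᗮ : Submodule ℝ (Euc n))) :
    |p| ≤ ‖p • α + (y : Euc n)‖ ∧ ‖y‖ ≤ ‖p • α + (y : Euc n)‖ := by
  have horth : ⟪p • α, (y : Euc n)⟫ = 0 := by
    rw [real_inner_smul_left, Submodule.mem_orthogonal_singleton_iff_inner_right.mp y.2, mul_zero]
  have h := norm_add_sq_eq_norm_sq_add_norm_sq_real horth
  have hp : ‖p • α‖ = |p| := by rw [norm_smul, hα, mul_one, Real.norm_eq_abs]
  rw [hp] at h
  have hy : ‖y‖ = ‖(y : Euc n)‖ := rfl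
  rw [hy]
  constructor
  · apply le_of_sq_le_sq _ (norm_nonneg _)
    nlinarith [mul_self_nonneg ‖(y : Euc n)‖]
  · apply le_of_sq_le_sq _ (norm_nonneg _)
    nlinarith [mul_self_nonneg |p|]

lemma contDiff_radon {n : ℕ} {φ : Euc n → ℝ} (hφ : ContDiff ℝ ∞ φ) (hc : HasCompactSupport φ)
    {α : Euc n} (hα : ‖α‖ = 1) : ContDiff ℝ ∞ (radon φ α) := by
  obtain ⟨R, hR⟩ := hc.isCompact.isBounded.exists_norm_le
  have hc' : ContDiffOn ℝ ∞
      (fun p : ℝ => ((fun _ : ((ℝ ∙ α)ᗮ : Submodule ℝ (Euc n)) => (1 : ℝ))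
        ⋆[ContinuousLinearMap.lsmul ℝ ℝ, hyperplaneMeasure α]
          (fun y : ((ℝ ∙ α)ᗮ : Submodule ℝ (Euc n)) => φ (p • α - (y : Euc n)))) 0) univ := by
    refine contDiffOn_convolution_right_with_param_comp (n := (⊤ : ℕ∞)) (s := univ)
      (ContinuousLinearMap.lsmul ℝ ℝ) (v := fun _ => 0) contDiffOn_const
      (g := fun (p : ℝ) (y : ((ℝ ∙ α)ᗮ : Submodule ℝ (Euc n))) => φ (p • α - (y : Euc n)))
      (k := Metric.closedBall 0 R) isOpen_univ (isCompact_closedBall _ _) ?_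
      (locallyIntegrable_const _) ?_
    · intro p y _ hy
      by_contra hne
      have h1 := hR _ (subset_tsupport φ hne)
      have h2 := (norm_smul_add_orth hα p (-y)).2
      rw [norm_neg, Submodule.coe_neg, ← sub_eq_add_neg] at h2
      exact hy (mem_closedBall_zero_iff.mpr (h2.trans h1))
    · apply ContDiff.contDiffOn
      refine hφ.comp ?_
      exact (contDiff_fst.smul contDiff_const).sub
        (((ℝ ∙ α)ᗮ : Submodule ℝ (Euc n)).subtypeL.contDiff.comp
          (contDiff_snd (𝕜 := ℝ) (E := ℝ) (F := ((ℝ ∙ α)ᗮ : Submodule ℝ (Euc n)))))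
  rw [← contDiffOn_univ]
  refine hc'.congr fun p _ => ?_
  simp [radon, convolution]

lemma hasCompactSupport_radon {n : ℕ} {φ : Euc n → ℝ} (hc : HasCompactSupport φ)
    {α : Euc n} (hα : ‖α‖ = 1) : HasCompactSupport (radon φ α) := by
  obtain ⟨R, hR⟩ := hc.isCompact.isBounded.exists_norm_le
  refine HasCompactSupport.of_support_subset_isCompact (isCompact_Icc (a := -R) (b := R)) ?_
  intro p hp
  by_contra hpR
  apply hp
  have : ∀ y : ((ℝ ∙ α)ᗮ : Submodule ℝ (Euc n)), φ (p • α + (y : Euc n)) = 0 := by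
    intro y
    by_contra hne
    have h1 := hR _ (subset_tsupport φ hne)
    have h2 := (norm_smul_add_orth hα p y).1
    exact hpR (abs_le.mp (h2.trans h1))
  simp [radon, this]

/-- The Radon transform of a test function in a fixed direction, as a test function on `ℝ`. -/
def radonTest {n : ℕ} {α : Euc n} (hα : ‖α‖ = 1) (φ : 𝓓((⊤ : Opens (Euc n)), ℝ)) :
    𝓓((⊤ : Opens ℝ), ℝ) where
  toFun := radon φ α
  contDiff' := contDiff_radon φ.contDiff φ.hasCompactSupport hα
  hasCompactSupport' := hasCompactSupport_radon φ.hasCompactSupport hα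
  tsupport_subset' := fun _ _ => trivial

/-! ### Expansion in smoothness -/

/-- `w_ε(x) = ε^{-d} w((x - x₀)/ε)`, where `d` is the dimension (for `ε > 0`). -/
def rescale {E : Type*} [NormedAddCommGroup E] [NormedSpace ℝ E] (x₀ : E) (ε : ℝ)
    (w : 𝓓((⊤ : Opens E), ℝ)) : 𝓓((⊤ : Opens E), ℝ) :=
  if h : 0 < ε then
    { toFun := fun x => (ε ^ Module.finrank ℝ E)⁻¹ * w (ε⁻¹ • (x - x₀))
      contDiff' := by
        have := w.contDiff
        fun_prop
      hasCompactSupport' := by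
        have hw : HasCompactSupport (fun x => w (ε⁻¹ • (x - x₀))) :=
          w.hasCompactSupport.comp_homeomorph
            ((Homeomorph.subRight x₀).trans (Homeomorph.smulOfNeZero ε⁻¹ (inv_ne_zero h.ne')))
        exact hw.mul_left
      tsupport_subset' := fun _ _ => trivial }
  else 0

/-- `∂^ν w` for a multiindex `ν`. -/
def multiDeriv {n : ℕ} (ν : Fin n →₀ ℕ) (w : 𝓓((⊤ : Opens (Euc n)), ℝ)) :
    𝓓((⊤ : Opens (Euc n)), ℝ) :=
  (List.finRange n).foldr
    (fun i φ => (fun χ : 𝓓((⊤ : Opens (Euc n)), ℝ) => ∂_{EuclideanSpace.single i (1 : ℝ)} χ)^[ν i] φ)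
    w

/-- `P(∂_x) w` for a polynomial `P`. -/
def polyDeriv {n : ℕ} (P : MvPolynomial (Fin n) ℝ) (w : 𝓓((⊤ : Opens (Euc n)), ℝ)) :
    𝓓((⊤ : Opens (Euc n)), ℝ) :=
  ∑ ν ∈ P.support, P.coeff ν • multiDeriv ν w

/-- `u(x₀ + ε x̌) ∼ ε^a u₀(x̌)`: the distribution `u₀` is the leading order singularity of the
distribution `u` at `x₀`, of order `a`. -/
def IsLeadingSingularity {n : ℕ} (u : 𝓓'((⊤ : Opens (Euc n)), ℂ)) (x₀ : Euc n) (a : ℝ)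
    (u₀ : 𝓓'((⊤ : Opens (Euc n)), ℂ)) : Prop :=
  ∃ m₀ : ℕ, ∀ m : ℕ, m₀ ≤ m → ∀ P : MvPolynomial (Fin n) ℝ, P.IsHomogeneous m →
    ∀ w : 𝓓((⊤ : Opens (Euc n)), ℝ),
      Tendsto (fun ε : ℝ => ((ε ^ ((m : ℝ) - a) : ℝ) : ℂ) * u (polyDeriv P (rescale x₀ ε w)))
        (𝓝[>] 0) (𝓝 (u₀ (polyDeriv P w)))

/-! ### The conormal function `f` -/

/-- Matrix, in an orthonormal basis of the hyperplane orthogonal to `α`, of the second derivative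
of `H` at `α` restricted to that hyperplane. -/
def tangentHessian {n : ℕ} (H : Euc n → ℝ) (α : Euc n) :
    Matrix (Fin (Module.finrank ℝ ((ℝ ∙ α)ᗮ : Submodule ℝ (Euc n))))
      (Fin (Module.finrank ℝ ((ℝ ∙ α)ᗮ : Submodule ℝ (Euc n)))) ℝ :=
  Matrix.of fun i j =>
    iteratedFDeriv ℝ 2 H α
      ![(stdOrthonormalBasis ℝ ((ℝ ∙ α)ᗮ : Submodule ℝ (Euc n)) i : Euc n),
        (stdOrthonormalBasis ℝ ((ℝ ∙ α)ᗮ : Submodule ℝ (Euc n)) j : Euc n)]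

open Classical in
/-- Number of positive minus number of negative eigenvalues (with multiplicities) of a symmetric
matrix. -/
def matrixSgn {d : ℕ} (A : Matrix (Fin d) (Fin d) ℝ) : ℤ :=
  ((A.charpoly.roots.filter (fun t => 0 < t)).card : ℤ)
    - ((A.charpoly.roots.filter (fun t => t < 0)).card : ℤ)

/-- `ω(α) = |det Ȟ''(α)|^{1/2} e^{-iπ sgn Ȟ''(α)/4} / (2π)^{(n-1)/2}`. -/
def omegaFactor {n : ℕ} (H : Euc n → ℝ) (α : Euc n) : ℂ :=
  (Real.sqrt |(tangentHessian H α).det| : ℂ)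
    * Complex.exp (-(Complex.I * Real.pi / 4) * (matrixSgn (tangentHessian H α) : ℂ))
    / (((2 * Real.pi) ^ (((n : ℝ) - 1) / 2) : ℝ) : ℂ)

/-- The phase function: `H` is real, smooth away from the origin, homogeneous of degree one, odd
over `Ω`, and its Hessian along the tangent planes of the sphere is negative definite on `Ω`. -/
structure IsPhase {n : ℕ} (Ω : Set (Euc n)) (H : Euc n → ℝ) : Prop where
  smooth : ContDiffOn ℝ ∞ H {0}ᶜ
  homogeneous : ∀ r : ℝ, 0 < r → ∀ ξ : Euc n, ξ ≠ 0 → H (r • ξ) = r * H ξ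
  odd : ∀ α ∈ Ω, H (-α) = -H α
  hessian_neg : ∀ α ∈ Ω, ∀ v : Euc n, ⟪α, v⟫ = 0 → v ≠ 0 → iteratedFDeriv ℝ 2 H α ![v, v] < 0

/-- The amplitude: `ṽ ∈ C^∞(ℝⁿ)`, `ṽ(λα) ∼ ω(α) ∑_j λ^{-s_j} ṽ_j(α)` as `λ → +∞`, with
`ṽ_j ∈ C_0^∞(Ω ∪ (-Ω))`; the expansion can be differentiated any number of times, with remainders
bounded by elements of `C_0^∞(Ω ∪ (-Ω))`. -/
structure IsAmplitude {n : ℕ} (Ω : Set (Euc n)) (H : Euc n → ℝ) (v : Euc n → ℂ)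
    (s : ℕ → ℝ) (vj : ℕ → Euc n → ℂ) : Prop where
  smooth : ContDiff ℝ ∞ v
  exponents_mono : StrictMono s
  exponents_tendsto : Tendsto s atTop atTop
  exponents_ge : ((n : ℝ) + 1) / 2 ≤ s 0
  coeff_test : ∀ j, IsTestOnSphere (Ω ∪ -Ω) (vj j)
  expansion : ∀ J l k : ℕ, ∃ a : Euc n → ℝ, IsTestOnSphere (Ω ∪ -Ω) a ∧
    ∀ α : Euc n, ‖α‖ = 1 → ∀ r : ℝ, 1 ≤ r →
      mixedDerivNorm
        (fun α t => v (t • α)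
          - omegaFactor H α * ∑ j ∈ Finset.range J, ((t ^ (-s j) : ℝ) : ℂ) * vj j α)
        k l α r ≤ a α * r ^ (-(s J + l))

/-- `f(x) = (2π)^{-n} ∫ ṽ(ξ) e^{i(H(ξ) - ξ·x)} dξ`, an oscillatory integral, i.e. an identity of
distributions. -/
def IsOscillatoryIntegral {n : ℕ} (f : Euc n → ℂ) (v : Euc n → ℂ) (H : Euc n → ℝ) : Prop :=
  ∀ φ : 𝓓((⊤ : Opens (Euc n)), ℝ),
    ∫ x, f x * (φ x : ℂ) =
      (1 / (2 * Real.pi : ℂ) ^ n) *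
        ∫ ξ, v ξ * Complex.exp (Complex.I * (H ξ : ℂ)) *
          ∫ x, Complex.exp (-(Complex.I * (⟪ξ, x⟫ : ℝ))) * (φ x : ℂ)

/-! ### The operator `𝓑` -/

/-- The symbol of `𝓑`: `B̃ ∈ C^∞(S^{n-1} × ℝ)` is even, `B̃(α, λ) ∼ ∑_j λ^{β_j} B̃_j(α)` as
`λ → +∞`, and the expansion can be differentiated any number of times, uniformly in `α`. -/
structure IsFilterSymbol {n : ℕ} (B : Euc n → ℝ → ℂ) (β : ℕ → ℝ) (Bj : ℕ → Euc n → ℂ) : Prop where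
  smooth : ContDiffOn ℝ ∞ (fun q : Euc n × ℝ => B (unitDir q.1) q.2) ({0}ᶜ ×ˢ univ)
  even : ∀ α : Euc n, ‖α‖ = 1 → ∀ r : ℝ, B (-α) (-r) = B α r
  exponents_anti : StrictAnti β
  exponents_tendsto : Tendsto β atTop atBot
  coeff_smooth : ∀ j, SmoothOnSphere (Bj j)
  expansion : ∀ J l k : ℕ, ∃ C : ℝ, ∀ α : Euc n, ‖α‖ = 1 → ∀ r : ℝ, 1 ≤ r →
      mixedDerivNorm
        (fun α t => B α t - ∑ j ∈ Finset.range J, ((t ^ (β j) : ℝ) : ℂ) * Bj j α)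
        k l α r ≤ C * r ^ (β J - l)

/-- The pairing of `(𝓑g)(x) = ∫_{S^{n-1}} ∫_ℝ B(α, α·x - p) g(α, p) dp dα`, where
`B(α, p) = (2π)^{-1} ∫ B̃(α, λ) e^{-iλp} dλ`, with a test function. As usual for oscillatory
integrals, the integration over `λ` is carried out after those over `x` and `p`. -/
def filteredBackprojection {n : ℕ} (B : Euc n → ℝ → ℂ) (g : Euc n → ℝ → ℂ)
    (φ : 𝓓((⊤ : Opens (Euc n)), ℝ)) : ℂ :=
  ∫ α : Metric.sphere (0 : Euc n) 1,
    ((1 / (2 * Real.pi : ℂ)) * ∫ r : ℝ, B α r *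
      ∫ x : Euc n, ∫ p : ℝ,
        Complex.exp (-(Complex.I * r * ((⟪(α : Euc n), x⟫ - p : ℝ) : ℂ))) * g α p * (φ x : ℂ))
    ∂(volume : Measure (Euc n)).toSphere

/-! ### Distributions on the line -/

/-- `T = (t + i0)^a` for `σ = 1`, `T = (t - i0)^a` for `σ = -1`: the limit in the sense of
distributions of `(t + iσδ)^a` as `δ → 0⁺`. -/
def IsPowI0 (σ a : ℝ) (T : 𝓓'((⊤ : Opens ℝ), ℂ)) : Prop :=
  ∀ φ : 𝓓((⊤ : Opens ℝ), ℝ),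
    Tendsto (fun δ : ℝ => ∫ t : ℝ, ((t : ℂ) + Complex.I * σ * δ) ^ (a : ℂ) * (φ t : ℂ))
      (𝓝[>] 0) (𝓝 (T φ))

/-- The distribution `μ` on the line, with coefficients `μ_±` and exponent `κ ≥ 0`:
`μ(t) = Γ(κ)/(2π) [q μ₊ (t - i0)^{-κ} + q⁻¹ μ₋ (t + i0)^{-κ}]`, `q = e^{-iκπ/2}`, if `κ > 0`, and
`μ(t) = -(i/2) μ₊ sgn t` if `κ = 0`. -/
def IsTransitionProfile (κ : ℝ) (μp μm : ℂ) (μ : 𝓓'((⊤ : Opens ℝ), ℂ)) : Prop :=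
  (0 < κ → ∃ Tm Tp : 𝓓'((⊤ : Opens ℝ), ℂ), IsPowI0 (-1) (-κ) Tm ∧ IsPowI0 1 (-κ) Tp ∧
    ∀ φ, μ φ = ((Real.Gamma κ : ℂ) / (2 * Real.pi)) *
      (Complex.exp (-(Complex.I * κ * (Real.pi / 2))) * μp * Tm φ
        + μm / Complex.exp (-(Complex.I * κ * (Real.pi / 2))) * Tp φ)) ∧
  (κ = 0 → ∀ φ, μ φ = ∫ t : ℝ, μp * (-Complex.I / 2) * (Real.sign t : ℂ) * (φ t : ℂ))

end

/-! The argument takes place on the Fourier side. The weak identity defining `f` determines its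
Fourier transform pointwise: `∫ e^{iξ·x} f(x) dx = v(ξ) e^{iH(ξ)}` for `ξ ≠ 0`
(`IsOscillatoryIntegral.fourier_eq`). The Fourier slice theorem and polar coordinates then show that
`𝓑 f̂` acts on a test function `φ` as `∫ M(ξ) φ̂(ξ) dξ`, where `M(ξ) = π⁻¹ |ξ|^{1-n} B(ξ/|ξ|, |ξ|)
v(ξ) e^{iH(ξ)}` (`IsFilterSymbol.filteredBackprojection_eq`). The singularity of `M` at the origin
is integrable and its growth polynomial, so this is a distribution.

Testing with `P(∂) w_ε` inserts `i^m P(ξ) e^{-i x₀·ξ} ŵ(εξ)`. The phase becomes `h(ξ) = H(ξ) -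
x₀·ξ`, homogeneous of degree one and critical at `Θ₀`. The amplitude is a finite sum of terms of
degrees `m + 1 - n + β_j - s_k` plus a remainder `O((1+|ξ|)^{m-n-1})` (`norm_decomposition_le`). The
factor `ε^{m+κ₂}` sends the remainder to zero by dominated convergence
(`tendsto_rpow_mul_integral_remainder`). In a homogeneous term the substitution `ξ → ξ/ε` turns
`1/ε` into the large parameter of an oscillatory integral. Taking `m` large raises all degrees above
`n`, and then the singularity of phase and amplitude at the origin causes no harm.

The stationary phase formula needed is `tendsto_integral_homog_osc`. Within the support of the
amplitude the critical points of `h` are the two rays through `±Θ₀`. Away from them one integrates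
by parts (`nonstationary_phase`). Near a ray, in coordinates `ξ = t(Θ₀ + y)` with `y ⊥ Θ₀`, the
phase is `t h(Θ₀ + y)`. The integral over `t` is a rapidly decaying function of `h(Θ₀ + y)/ε`, and
the rescaling `y = ε^{1/2} z` leaves the quadratic part of `h` in the limit
(`tendsto_integral_cone`). A Fresnel integral in `z` gives the constant
(`integral_rayFourier_halfQuadForm`), and `ω` is precisely its inverse
(`IsPhase.stationaryFactor_mul_omegaFactor`). A term of degree `d` has size `ε^{-(d + (n+1)/2)}`.
For `j = k = 0` the exponent is `m + κ₂`, for all other pairs it is smaller, so one term survives.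

What remains is a pair of integrals of `r^{m+κ₂-1} ŵ(±rΘ₀)` over the half-line. For `κ₂ > 0` these
are the pairing of `P(∂) w` with `μ(x·Θ₀)`, because the Gamma integral identifies `(t ∓ i0)^{-κ₂}`
as the Fourier integral of `ρ^{κ₂-1}` over a half-line (`isPowI0_of_eq`). For `κ₂ = 0` the density
`1/ρ` is not integrable, but the antisymmetry of the coefficients makes the pair of integrals the
pairing with a sign function, through `sgn' = 2δ` (`signPlaneWave_polyDeriv`). -/

noncomputable section

set_option linter.unusedSectionVars false

open SchwartzMap FourierTransform ProbabilityTheory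

/-! ### Test functions as Schwartz functions -/

section TestFunctionToSchwartz

variable {E : Type*} [NormedAddCommGroup E] [NormedSpace ℝ E]

/-- A real test function as a complex Schwartz function. -/
def TestFunction.toSchwartz (φ : 𝓓((⊤ : Opens E), ℝ)) : 𝓢(E, ℂ) :=
  HasCompactSupport.toSchwartzMap (f := fun x => (φ x : ℂ))
    (φ.hasCompactSupport.comp_left (g := ((↑) : ℝ → ℂ)) Complex.ofReal_zero)
    (Complex.ofRealCLM.contDiff.comp φ.contDiff)

lemma TestFunction.toSchwartz_apply (φ : 𝓓((⊤ : Opens E), ℝ)) (x : E) :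
    φ.toSchwartz x = (φ x : ℂ) := rfl

lemma norm_iteratedFDeriv_ofReal_comp {f : E → ℝ} (k : ℕ) (hf : ContDiff ℝ ∞ f) (x : E) :
    ‖iteratedFDeriv ℝ k (fun x => (f x : ℂ)) x‖ = ‖iteratedFDeriv ℝ k f x‖ :=
  Complex.ofRealLI.norm_iteratedFDeriv_comp_left (f := f) (hf.contDiffAt) (mod_cast le_top)

variable (E) in
/-- The continuous inclusion of test functions into Schwartz functions. -/
def testToSchwartzCLM : 𝓓((⊤ : Opens E), ℝ) →L[ℝ] 𝓢(E, ℂ) :=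
  TestFunction.mkCLM ℝ TestFunction.toSchwartz
    (fun f g => by ext x; simp [TestFunction.toSchwartz_apply])
    (fun c f => by ext x; simp [TestFunction.toSchwartz_apply])
    (fun K hK => by
      let T : 𝓓^{⊤}_{K}(E, ℝ) →ₗ[ℝ] 𝓢(E, ℂ) :=
        { toFun := TestFunction.toSchwartz ∘ TestFunction.ofSupportedIn hK
          map_add' := fun f g => by ext x; simp [TestFunction.toSchwartz_apply]
          map_smul' := fun c f => by ext x; simp [TestFunction.toSchwartz_apply] }
      change Continuous T
      refine WithSeminorms.continuous_of_isBounded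
        (ContDiffMapSupportedIn.withSeminorms ℝ E ℝ ⊤ K) (schwartz_withSeminorms ℝ E ℂ) T ?_
      rintro ⟨k, l⟩
      obtain ⟨R, hR⟩ := K.isCompact.isBounded.exists_norm_le
      -- On `K` the weight `‖x‖ ^ k` is at most `R ^ k`, and off `K` all derivatives vanish. The
      -- maximum with `0` keeps the constant nonnegative when `K` is empty.
      refine ⟨{l}, ⟨(max R 0) ^ k, by positivity⟩, fun f => ?_⟩
      have hnn : 0 ≤ ContDiffMapSupportedIn.seminorm ℝ E ℝ ⊤ K l f := apply_nonneg _ _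
      rw [Finset.sup_singleton]
      change SchwartzMap.seminorm ℝ k l (T f) ≤
        (max R 0) ^ k * ContDiffMapSupportedIn.seminorm ℝ E ℝ ⊤ K l f
      refine SchwartzMap.seminorm_le_bound ℝ k l _ (by positivity) fun x => ?_
      have h1 : ‖iteratedFDeriv ℝ l (T f) x‖ = ‖iteratedFDeriv ℝ l f x‖ :=
        norm_iteratedFDeriv_ofReal_comp l f.contDiff x
      rw [h1]
      by_cases hx : x ∈ (K : Set E)
      · have h2 := ContDiffMapSupportedIn.norm_iteratedFDeriv_apply_le_seminorm_top ℝ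
          (i := l) (f := f) (x := x)
        have h3 : ‖x‖ ≤ max R 0 := (hR x hx).trans (le_max_left _ _)
        gcongr
      · rw [f.iteratedFDeriv_zero_on_compl hx]
        simp only [Pi.zero_apply, norm_zero, mul_zero]
        positivity)

end TestFunctionToSchwartz

/-! ### Fourier transform with kernel `e^{-iξ·x}`; distributions from functions of polynomial growth
-/

section SchwartzFourier

variable {E : Type*} [NormedAddCommGroup E] [InnerProductSpace ℝ E] [FiniteDimensional ℝ E]
  [MeasurableSpace E] [BorelSpace E]

variable (E) in
/-- Division by `2π`, as a linear automorphism. -/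
def scaleTwoPi : E ≃L[ℝ] E :=
  ContinuousLinearEquiv.smulLeft (Units.mk0 ((2 * Real.pi)⁻¹ : ℝ) (by positivity))

variable (E) in
/-- The Fourier transform `g ↦ ∫ e^{-i⟨ξ, x⟩} g(x) dx` on Schwartz functions. -/
def angularFourier : 𝓢(E, ℂ) →L[ℝ] 𝓢(E, ℂ) :=
  (compCLMOfContinuousLinearEquiv ℝ (scaleTwoPi E)).comp
    ((FourierTransform.fourierCLM ℂ 𝓢(E, ℂ)).restrictScalars ℝ)

/-- The kernel of `𝓕` is `e^{-2πi⟨x, ξ⟩}`; evaluation at `ξ/2π` removes the `2π` and introduces no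
normalising constant. -/
lemma angularFourier_apply (g : 𝓢(E, ℂ)) (ξ : E) :
    angularFourier E g ξ = ∫ x, Complex.exp (-(Complex.I * (⟪ξ, x⟫ : ℝ))) * g x := by
  have : angularFourier E g ξ = 𝓕 (g : E → ℂ) ((2 * Real.pi)⁻¹ • ξ) := rfl
  rw [this, Real.fourier_eq']
  refine integral_congr_ae (Eventually.of_forall fun x => ?_)
  simp only [smul_eq_mul, real_inner_smul_right]
  congr 2
  rw [real_inner_comm]
  push_cast
  field_simp

/-- The Fourier transform of a test function. -/
def testFourier (φ : 𝓓((⊤ : Opens E), ℝ)) : 𝓢(E, ℂ) := angularFourier E φ.toSchwartz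

lemma testFourier_apply (φ : 𝓓((⊤ : Opens E), ℝ)) (ξ : E) :
    testFourier φ ξ = ∫ x, Complex.exp (-(Complex.I * (⟪ξ, x⟫ : ℝ))) * (φ x : ℂ) :=
  angularFourier_apply _ _

/-- The right-hand side is the absolute value of a function to be assumed integrable, times a
Schwartz seminorm of `g`. Integrability of the product and continuity of the pairing in `g` both
follow from this one bound. -/
lemma norm_mul_schwartz_le (M : E → ℂ) (N : ℕ) (g : 𝓢(E, ℂ)) (ξ : E) : ‖M ξ * g ξ‖ ≤
    ‖M ξ * (((1 + ‖ξ‖) ^ N)⁻¹ : ℝ)‖ *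
      (2 ^ N * (Finset.Iic (N, 0)).sup (schwartzSeminormFamily ℝ E ℂ) g) := by
  have := one_add_le_sup_seminorm_apply (𝕜 := ℝ) (m := (N, 0)) (k := N) (n := 0) le_rfl le_rfl
    g ξ
  rw [norm_iteratedFDeriv_zero] at this
  rw [norm_mul, norm_mul, mul_assoc]
  gcongr
  have hp : 0 < (1 + ‖ξ‖) ^ N := by positivity
  rw [Complex.norm_real, Real.norm_of_nonneg (by positivity), inv_mul_eq_div, le_div_iff₀ hp,
    mul_comm]
  exact this

lemma integrable_mul_schwartz {M : E → ℂ} {N : ℕ}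
    (hM : Integrable fun ξ => M ξ * (((1 + ‖ξ‖) ^ N)⁻¹ : ℝ)) (g : 𝓢(E, ℂ)) :
    Integrable fun ξ => M ξ * g ξ := by
  refine (hM.norm.mul_const _).mono' ?_ (Eventually.of_forall (norm_mul_schwartz_le M N g))
  -- Measurability of `M * g` is read off from the factorisation into the weighted `M`, measurable
  -- by `hM`, and the continuous function `(1 + ‖ξ‖) ^ N * g`.
  have h1 : Continuous fun ξ : E => (((1 + ‖ξ‖) ^ N : ℝ) : ℂ) * g ξ := by
    have := g.continuous
    fun_prop
  refine (hM.aestronglyMeasurable.mul h1.aestronglyMeasurable).congr ?_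
  refine Eventually.of_forall fun ξ => ?_
  have hp : (((1 + ‖ξ‖) ^ N : ℝ) : ℂ) ≠ 0 := by
    have : 0 < (1 + ‖ξ‖) ^ N := by positivity
    exact_mod_cast this.ne'
  simp only [Pi.mul_apply, Complex.ofReal_inv]
  field_simp

/-- A function of polynomial growth, in the integrated sense, defines a continuous functional on
Schwartz functions. -/
def schwartzPairing (M : E → ℂ) (N : ℕ)
    (hM : Integrable fun ξ => M ξ * (((1 + ‖ξ‖) ^ N)⁻¹ : ℝ)) : 𝓢(E, ℂ) →L[ℝ] ℂ :=
  mkCLMtoNormedSpace (𝕜 := ℝ) (σ := RingHom.id ℝ) (fun g => ∫ ξ, M ξ * g ξ)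
    (fun f g => by
      simp only [add_apply, mul_add]
      exact integral_add (integrable_mul_schwartz hM f) (integrable_mul_schwartz hM g))
    (fun a f => by
      simp only [smul_apply, Complex.real_smul, RingHom.id_apply, ← mul_assoc,
        mul_comm _ (a : ℂ)]
      simp only [mul_assoc]
      exact integral_const_mul _ _)
    ⟨Finset.Iic (N, 0), (∫ ξ, ‖M ξ * (((1 + ‖ξ‖) ^ N)⁻¹ : ℝ)‖) * 2 ^ N, by positivity,
      fun g => by
        refine (norm_integral_le_of_norm_le (hM.norm.mul_const _)
          (Eventually.of_forall (norm_mul_schwartz_le M N g))).trans (le_of_eq ?_)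
        rw [integral_mul_const, mul_assoc]⟩

/-- The distribution with Fourier transform given by a function of polynomial growth. -/
def fourierDistribution (M : E → ℂ) (N : ℕ)
    (hM : Integrable fun ξ => M ξ * (((1 + ‖ξ‖) ^ N)⁻¹ : ℝ)) : 𝓓'((⊤ : Opens E), ℂ) :=
  ((schwartzPairing M N hM).comp ((angularFourier E).comp (testToSchwartzCLM E)) :
    𝓓((⊤ : Opens E), ℝ) →L[ℝ] ℂ)

lemma fourierDistribution_apply (M : E → ℂ) (N : ℕ)
    (hM : Integrable fun ξ => M ξ * (((1 + ‖ξ‖) ^ N)⁻¹ : ℝ)) (φ : 𝓓((⊤ : Opens E), ℝ)) :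
    fourierDistribution M N hM φ = ∫ ξ, M ξ * testFourier φ ξ := rfl

/-- The distribution given by a function of polynomial growth. -/
def functionDistribution (M : E → ℂ) (N : ℕ)
    (hM : Integrable fun ξ => M ξ * (((1 + ‖ξ‖) ^ N)⁻¹ : ℝ)) : 𝓓'((⊤ : Opens E), ℂ) :=
  ((schwartzPairing M N hM).comp (testToSchwartzCLM E) : 𝓓((⊤ : Opens E), ℝ) →L[ℝ] ℂ)

lemma functionDistribution_apply (M : E → ℂ) (N : ℕ)
    (hM : Integrable fun ξ => M ξ * (((1 + ‖ξ‖) ^ N)⁻¹ : ℝ)) (φ : 𝓓((⊤ : Opens E), ℝ)) :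
    functionDistribution M N hM φ = ∫ x, M x * (φ x : ℂ) := rfl

end SchwartzFourier

/-! ### Functions homogeneous of degree `d` and smooth off the origin -/

section Homogeneous

variable {E : Type*} [NormedAddCommGroup E] [NormedSpace ℝ E]
  {F : Type*} [NormedAddCommGroup F] [NormedSpace ℝ F]

/-- Functions that are smooth and positively homogeneous of degree `d` away from the origin. -/
structure IsHomogSmooth (d : ℝ) (c : E → F) : Prop where
  smooth : ContDiffOn ℝ ∞ c {0}ᶜ
  homog : ∀ r : ℝ, 0 < r → ∀ ξ : E, ξ ≠ 0 → c (r • ξ) = r ^ d • c ξ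

namespace IsHomogSmooth

variable {d d' : ℝ} {c : E → F}

lemma contDiffAt (hc : IsHomogSmooth d c) {ξ : E} (hξ : ξ ≠ 0) : ContDiffAt ℝ ∞ c ξ :=
  hc.smooth.contDiffAt (isOpen_compl_singleton.mem_nhds hξ)

lemma differentiableAt (hc : IsHomogSmooth d c) {ξ : E} (hξ : ξ ≠ 0) : DifferentiableAt ℝ c ξ :=
  (hc.contDiffAt hξ).differentiableAt (by simp)

lemma of_contDiffAt (h : ∀ ξ : E, ξ ≠ 0 → ContDiffAt ℝ ∞ c ξ)
    (h' : ∀ r : ℝ, 0 < r → ∀ ξ : E, ξ ≠ 0 → c (r • ξ) = r ^ d • c ξ) : IsHomogSmooth d c :=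
  ⟨fun ξ hξ => (h ξ hξ).contDiffWithinAt, h'⟩

lemma smul {a : E → ℝ} (ha : IsHomogSmooth d' a) (hc : IsHomogSmooth d c) :
    IsHomogSmooth (d' + d) (fun ξ => a ξ • c ξ) := by
  refine ⟨ha.smooth.smul hc.smooth, fun r hr ξ hξ => ?_⟩
  rw [ha.homog r hr ξ hξ, hc.homog r hr ξ hξ, Real.rpow_add hr, smul_eq_mul, smul_smul, smul_smul]
  congr 1
  ring

lemma mul {a c : E → ℂ} (ha : IsHomogSmooth d' a) (hc : IsHomogSmooth d c) :
    IsHomogSmooth (d' + d) (fun ξ => a ξ * c ξ) := by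
  refine ⟨ha.smooth.mul hc.smooth, fun r hr ξ hξ => ?_⟩
  rw [ha.homog r hr ξ hξ, hc.homog r hr ξ hξ, Real.rpow_add hr, smul_mul_smul_comm]

lemma comp_neg (hc : IsHomogSmooth d c) : IsHomogSmooth d (fun ξ => c (-ξ)) := by
  refine of_contDiffAt (fun ξ hξ => ?_) fun r hr ξ hξ => ?_
  · exact (hc.contDiffAt (neg_ne_zero.mpr hξ)).comp ξ contDiff_neg.contDiffAt
  · rw [← smul_neg, hc.homog r hr _ (neg_ne_zero.mpr hξ)]

lemma neg (hc : IsHomogSmooth d c) : IsHomogSmooth d (fun ξ => -c ξ) :=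
  ⟨hc.smooth.neg, fun r hr ξ hξ => by rw [hc.homog r hr ξ hξ, smul_neg]⟩

/-- Differentiate `ζ ↦ c (r • ζ)` once by the chain rule and once by homogeneity, and compare. -/
lemma fderiv_smul (hc : IsHomogSmooth d c) {r : ℝ} (hr : 0 < r) {ξ : E} (hξ : ξ ≠ 0) :
    fderiv ℝ c (r • ξ) = r ^ (d - 1) • fderiv ℝ c ξ := by
  have h1 : HasFDerivAt (fun ζ => c (r • ζ)) ((fderiv ℝ c (r • ξ)).comp
      (r • ContinuousLinearMap.id ℝ E)) ξ :=
    (hc.differentiableAt (smul_ne_zero hr.ne' hξ)).hasFDerivAt.comp ξ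
      ((hasFDerivAt_id ξ).const_smul r)
  have h2 : HasFDerivAt (fun ζ => c (r • ζ)) (r ^ d • fderiv ℝ c ξ) ξ := by
    refine ((hc.differentiableAt hξ).hasFDerivAt.const_smul (r ^ d)).congr_of_eventuallyEq ?_
    filter_upwards [isOpen_compl_singleton.mem_nhds hξ] with ζ hζ
    exact hc.homog r hr ζ hζ
  have h3 := h1.unique h2
  rw [Real.rpow_sub_one hr.ne', div_eq_inv_mul, ← smul_smul, ← h3]
  ext v
  simp [smul_smul, hr.ne']

lemma fderiv_apply (hc : IsHomogSmooth d c) (e : E) :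
    IsHomogSmooth (d - 1) (fun ξ => fderiv ℝ c ξ e) := by
  refine of_contDiffAt (fun ξ hξ => ?_) fun r hr ξ hξ => ?_
  · exact ((hc.contDiffAt hξ).fderiv_right (m := ∞) (by simp)).clm_apply contDiffAt_const
  · rw [hc.fderiv_smul hr hξ]
    rfl

/-- The maximum over the compact unit sphere, spread out by homogeneity. Homogeneity leaves the
value at the origin free, whence the condition `c 0 = 0`. -/
lemma exists_bound [FiniteDimensional ℝ E] (hc : IsHomogSmooth d c) (h0 : c 0 = 0) :
    ∃ C, 0 ≤ C ∧ ∀ ξ, ‖c ξ‖ ≤ C * ‖ξ‖ ^ d := by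
  have hcont : ContinuousOn c (Metric.sphere 0 1) :=
    hc.smooth.continuousOn.mono fun ξ hξ h => by
      rw [mem_singleton_iff.mp h] at hξ
      simp at hξ
  obtain ⟨C, hC⟩ := (isCompact_sphere (0 : E) 1).exists_bound_of_continuousOn hcont
  refine ⟨max C 0, le_max_right _ _, fun ξ => ?_⟩
  by_cases hξ : ξ = 0
  · rw [hξ, h0, norm_zero]
    positivity
  · have hn : 0 < ‖ξ‖ := norm_pos_iff.mpr hξ
    have h1 : ξ = ‖ξ‖ • (‖ξ‖⁻¹ • ξ) := by rw [smul_inv_smul₀ hn.ne']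
    have h2 : ‖‖ξ‖⁻¹ • ξ‖ = 1 := by rw [norm_smul, norm_inv, norm_norm, inv_mul_cancel₀ hn.ne']
    have h3 := hC (‖ξ‖⁻¹ • ξ) (by simpa using h2)
    rw [h1, hc.homog _ hn _ (smul_ne_zero (inv_ne_zero hn.ne') hξ), ← h1, norm_smul,
      Real.norm_of_nonneg (by positivity), mul_comm]
    gcongr
    exact h3.trans (le_max_left _ _)

/-- Homogeneous functions of degree `> 1`, multiplied by bounded functions, have zero derivative at
the origin. -/
lemma hasFDerivAt_zero {C : ℝ} {d : ℝ} (hd : 1 < d) {f : E → F}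
    (hf : ∀ ξ, ‖f ξ‖ ≤ C * ‖ξ‖ ^ d) : HasFDerivAt f (0 : E →L[ℝ] F) 0 := by
  have h0 : f 0 = 0 := by
    have := hf 0
    rw [norm_zero, Real.zero_rpow (by linarith), mul_zero] at this
    exact norm_le_zero_iff.mp this
  rw [hasFDerivAt_iff_isLittleO_nhds_zero]
  simp only [zero_add, h0, sub_zero, zero_apply]
  have h1 : f =O[𝓝 0] fun ξ => ‖ξ‖ ^ d := by
    refine Asymptotics.IsBigO.of_bound C (Eventually.of_forall fun ξ => ?_)
    rw [Real.norm_of_nonneg (by positivity)]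
    exact hf ξ
  refine h1.trans_isLittleO ?_
  refine Asymptotics.isLittleO_of_tendsto' (f := fun ξ : E => ‖ξ‖ ^ d) (g := fun ξ => ‖ξ‖) ?_ ?_
    |>.trans_isBigO (Asymptotics.isBigO_norm_left.mpr (Asymptotics.isBigO_refl _ _))
  · refine Eventually.of_forall fun ξ hξ => ?_
    rw [hξ, Real.zero_rpow (by linarith)]
  · have h2 : Tendsto (fun ξ : E => ‖ξ‖ ^ (d - 1)) (𝓝 0) (𝓝 0) := by
      have : ContinuousAt (fun ξ : E => ‖ξ‖ ^ (d - 1)) 0 :=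
        continuousAt_id.norm.rpow_const (Or.inr (by linarith))
      simpa [ContinuousAt, Real.zero_rpow (by linarith : d - 1 ≠ 0)] using this
    refine h2.congr' (Eventually.of_forall fun ξ => ?_)
    by_cases hξ : ξ = 0
    · simp [hξ, Real.zero_rpow (by linarith : d - 1 ≠ 0)]
    · rw [Real.rpow_sub_one (norm_ne_zero_iff.mpr hξ)]

lemma fderiv_zero [FiniteDimensional ℝ E] (hc : IsHomogSmooth d c) (h0 : c 0 = 0) (hd : 1 < d) :
    fderiv ℝ c 0 = 0 := by
  obtain ⟨C, -, hC⟩ := hc.exists_bound h0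
  exact (hasFDerivAt_zero hd hC).fderiv

lemma continuous [FiniteDimensional ℝ E] (hc : IsHomogSmooth d c) (h0 : c 0 = 0) (hd : 0 < d) :
    Continuous c := by
  rw [continuous_iff_continuousAt]
  intro ξ
  by_cases hξ : ξ = 0
  · subst hξ
    obtain ⟨C, -, hC⟩ := hc.exists_bound h0
    rw [ContinuousAt, h0]
    refine squeeze_zero_norm hC ?_
    have : ContinuousAt (fun ξ : E => C * ‖ξ‖ ^ d) 0 :=
      continuousAt_const.mul (continuousAt_id.norm.rpow_const (Or.inr hd.le))
    simpa [ContinuousAt, Real.zero_rpow hd.ne'] using this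
  · exact (hc.contDiffAt hξ).continuousAt

end IsHomogSmooth

end Homogeneous

/-! ### Nonstationary phase for phases homogeneous of degree one -/

section Nonstationary

variable {E : Type*} [NormedAddCommGroup E] [InnerProductSpace ℝ E] [FiniteDimensional ℝ E]
  [MeasurableSpace E] [BorelSpace E]

lemma integrable_rpow_mul_schwartz {d : ℝ} (hd : 0 ≤ d) (g : 𝓢(E, ℂ)) :
    Integrable fun ξ => ‖ξ‖ ^ d * ‖g ξ‖ := by
  have h0 : Integrable fun ξ => ‖g ξ‖ + ‖ξ‖ ^ ⌈d⌉₊ * ‖g ξ‖ :=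
    g.integrable.norm.add (g.integrable_pow_mul volume ⌈d⌉₊)
  refine h0.mono' ?_ (Eventually.of_forall fun ξ => ?_)
  · have := g.continuous
    exact ((continuous_norm.rpow_const fun _ => Or.inr hd).mul this.norm).aestronglyMeasurable
  · rw [norm_mul, norm_norm, Real.norm_of_nonneg (by positivity), ← one_add_mul]
    gcongr
    rcases le_total ‖ξ‖ 1 with h | h
    · have := Real.rpow_le_one (norm_nonneg ξ) h hd
      have : 0 ≤ ‖ξ‖ ^ ⌈d⌉₊ := by positivity
      linarith
    · have h1 := Real.rpow_le_rpow_of_exponent_le h (Nat.le_ceil d)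
      rw [Real.rpow_natCast] at h1
      linarith

variable {d : ℝ} {c : E → ℂ} {h : E → ℝ}

/-- The oscillating factor `e^{iλh}`. -/
def oscFactor (h : E → ℝ) (lam : ℝ) (ξ : E) : ℂ := Complex.exp (Complex.I * (lam * h ξ : ℝ))

lemma norm_oscFactor (lam : ℝ) (ξ : E) : ‖oscFactor h lam ξ‖ = 1 := by
  rw [oscFactor, mul_comm]
  exact Complex.norm_exp_ofReal_mul_I _

lemma aestronglyMeasurable_of_continuousOn_compl_zero [Nontrivial E] {F : Type*}
    [NormedAddCommGroup F] {f : E → F} (hf : ContinuousOn f {0}ᶜ) :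
    AEStronglyMeasurable f := by
  have := hf.aestronglyMeasurable (μ := volume) (measurableSet_singleton (0 : E)).compl
  rwa [restrict_compl_singleton] at this

lemma continuousOn_oscFactor (hh : IsHomogSmooth 1 h) (lam : ℝ) :
    ContinuousOn (oscFactor h lam) {0}ᶜ := by
  have := hh.smooth.continuousOn
  unfold oscFactor
  fun_prop

lemma integrable_homog_mul_schwartz_mul_osc [Nontrivial E] (hh : IsHomogSmooth 1 h)
    (hc : IsHomogSmooth d c)
    (h0 : c 0 = 0) (hd : 0 < d) (g : 𝓢(E, ℂ)) (lam : ℝ) :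
    Integrable fun ξ => c ξ * g ξ * oscFactor h lam ξ := by
  obtain ⟨C, hC0, hC⟩ := hc.exists_bound h0
  refine ((integrable_rpow_mul_schwartz hd.le g).const_mul C).mono' ?_
    (Eventually.of_forall fun ξ => ?_)
  · exact (((hc.continuous h0 hd).mul g.continuous).aestronglyMeasurable).mul
      (aestronglyMeasurable_of_continuousOn_compl_zero (continuousOn_oscFactor hh lam))
  · rw [norm_mul, norm_oscFactor, mul_one, norm_mul, ← mul_assoc]
    gcongr
    exact hC ξ

lemma hasFDerivAt_oscFactor {ξ : E} (hh : DifferentiableAt ℝ h ξ) (lam : ℝ) :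
    HasFDerivAt (oscFactor h lam)
      (oscFactor h lam ξ • (Complex.I • Complex.ofRealCLM.comp (lam • fderiv ℝ h ξ))) ξ := by
  have h1 : HasFDerivAt (fun ξ => (lam * h ξ : ℝ)) (lam • fderiv ℝ h ξ) ξ :=
    hh.hasFDerivAt.const_mul lam
  have h2 := (Complex.ofRealCLM.hasFDerivAt.comp ξ h1).const_mul Complex.I
  exact h2.cexp

/-- The phase need not be differentiable at the origin, but an amplitude of degree `d > 1` makes the
product `O(‖ξ‖ ^ d)` there. Hence integration by parts is possible on the whole space, without a
cutoff at the origin. -/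
lemma hasFDerivAt_homog_mul_osc (hh : IsHomogSmooth 1 h) (hc : IsHomogSmooth d c)
    (h0 : c 0 = 0) (hd : 1 < d) (lam : ℝ) (ξ : E) :
    HasFDerivAt (fun ξ => c ξ * oscFactor h lam ξ)
      (oscFactor h lam ξ • fderiv ℝ c ξ + c ξ • (oscFactor h lam ξ •
        (Complex.I • Complex.ofRealCLM.comp (lam • fderiv ℝ h ξ)))) ξ := by
  by_cases hξ : ξ = 0
  · subst hξ
    obtain ⟨C, -, hC⟩ := hc.exists_bound h0
    refine (IsHomogSmooth.hasFDerivAt_zero (C := C) hd fun ξ => ?_).congr_fderiv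
      (by ext v; simp [hc.fderiv_zero h0 hd, h0])
    rw [norm_mul, norm_oscFactor, mul_one]
    exact hC ξ
  · have := (hc.differentiableAt hξ).hasFDerivAt.mul
      (hasFDerivAt_oscFactor (hh.differentiableAt hξ) lam)
    rwa [add_comm] at this

/-- One integration by parts in the direction `e`. -/
lemma integral_homog_osc_by_parts [Nontrivial E] (hh : IsHomogSmooth 1 h) (hc : IsHomogSmooth d c)
    (h0 : c 0 = 0) (hd : 1 < d) (g : 𝓢(E, ℂ)) (lam : ℝ) (e : E) :
    Complex.I * lam * ∫ ξ, (fderiv ℝ h ξ e • c ξ) * g ξ * oscFactor h lam ξ =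
      -((∫ ξ, fderiv ℝ c ξ e * g ξ * oscFactor h lam ξ)
        + ∫ ξ, c ξ * (∂_{e} g) ξ * oscFactor h lam ξ) := by
  have hA : Integrable fun ξ => fderiv ℝ c ξ e * g ξ * oscFactor h lam ξ :=
    integrable_homog_mul_schwartz_mul_osc hh (hc.fderiv_apply e)
      (by rw [hc.fderiv_zero h0 hd]; rfl) (by linarith) g lam
  have hB : Integrable fun ξ => (fderiv ℝ h ξ e • c ξ) * g ξ * oscFactor h lam ξ :=
    integrable_homog_mul_schwartz_mul_osc hh ((hh.fderiv_apply e).smul hc)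
      (by rw [h0, smul_zero]) (by linarith) g lam
  have hC : Integrable fun ξ => c ξ * (∂_{e} g) ξ * oscFactor h lam ξ :=
    integrable_homog_mul_schwartz_mul_osc hh hc h0 (by linarith) _ lam
  have hD : Integrable fun ξ => c ξ * g ξ * oscFactor h lam ξ :=
    integrable_homog_mul_schwartz_mul_osc hh hc h0 (by linarith) _ lam
  have hder := hasFDerivAt_homog_mul_osc hh hc h0 hd lam
  have hsum : ∀ ξ, fderiv ℝ (fun ξ => c ξ * oscFactor h lam ξ) ξ e * g ξ =
      fderiv ℝ c ξ e * g ξ * oscFactor h lam ξ +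
        Complex.I * lam * ((fderiv ℝ h ξ e • c ξ) * g ξ * oscFactor h lam ξ) := by
    intro ξ
    rw [(hder ξ).fderiv]
    simp only [add_apply, smul_apply, ContinuousLinearMap.comp_apply, smul_eq_mul,
      Complex.ofRealCLM_apply, Complex.ofReal_mul, Complex.real_smul]
    ring
  have hgd : ∀ ξ, fderiv ℝ g ξ e = (∂_{e} g) ξ := fun ξ =>
    (SchwartzMap.lineDerivOp_apply_eq_fderiv e g ξ).symm
  have key := integral_mul_fderiv_eq_neg_fderiv_mul_of_integrable (𝕜 := ℂ) (μ := volume)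
    (f := fun ξ => c ξ * oscFactor h lam ξ) (g := g) (v := e)
    (by simp only [hsum]; exact hA.add (hB.const_mul _))
    (by refine hC.congr (Eventually.of_forall fun ξ => ?_); simp only [hgd]; ring)
    (by refine hD.congr (Eventually.of_forall fun ξ => ?_); ring)
    (fun ξ _ => (hder ξ).differentiableAt) (fun ξ _ => g.differentiableAt)
  simp only [hsum] at key
  rw [integral_add hA (hB.const_mul _), integral_const_mul] at key
  have h3 : ∫ ξ, c ξ * oscFactor h lam ξ * fderiv ℝ g ξ e =
      ∫ ξ, c ξ * (∂_{e} g) ξ * oscFactor h lam ξ := by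
    refine integral_congr_ae (Eventually.of_forall fun ξ => ?_)
    simp only [hgd]
    ring
  rw [h3] at key
  linear_combination key

/-- Nonstationary phase: if the amplitude vanishes near the critical points of the phase, the
oscillatory integral decays at a rate determined by the order of vanishing at the origin. -/
lemma nonstationary_phase [Nontrivial E] (hh : IsHomogSmooth 1 h) (k : ℕ) :
    ∀ (d : ℝ) (c : E → ℂ), (k : ℝ) < d → IsHomogSmooth d c → c 0 = 0 →
      (∀ ξ, ξ ≠ 0 → fderiv ℝ h ξ = 0 → c =ᶠ[𝓝 ξ] 0) → ∀ g : 𝓢(E, ℂ),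
      ∃ C, ∀ lam : ℝ, 0 < lam → ‖∫ ξ, c ξ * g ξ * oscFactor h lam ξ‖ ≤ C / lam ^ k := by
  induction k with
  | zero =>
    intro d c hd hc h0 _ g
    refine ⟨∫ ξ, ‖c ξ * g ξ‖, fun lam _ => ?_⟩
    rw [pow_zero, div_one]
    refine (norm_integral_le_integral_norm _).trans (le_of_eq ?_)
    simp only [norm_mul, norm_oscFactor, mul_one]
  | succ k ih =>
    intro d c hd hc h0 hcrit g
    push_cast at hd
    have hk0 : (0 : ℝ) ≤ k := k.cast_nonneg
    let b := stdOrthonormalBasis ℝ E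
    let q : E → ℝ := fun ξ => ∑ j, (fderiv ℝ h ξ (b j)) ^ 2
    have hq : ∀ ξ, fderiv ℝ h ξ ≠ 0 → q ξ ≠ 0 := by
      intro ξ hξ hq0
      apply hξ
      have h1 : ∀ j, fderiv ℝ h ξ (b j) = 0 := by
        intro j
        have := (Finset.sum_eq_zero_iff_of_nonneg (fun j _ => sq_nonneg _)).mp hq0 j
          (Finset.mem_univ j)
        exact pow_eq_zero_iff (two_ne_zero) |>.mp this
      have h2 : (fderiv ℝ h ξ : E →ₗ[ℝ] ℝ) = 0 :=
        b.toBasis.ext fun j => by simpa using h1 j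
      exact ContinuousLinearMap.coe_injective h2
    have hqs : ∀ ξ, ξ ≠ 0 → ContDiffAt ℝ ∞ q ξ := fun ξ hξ =>
      ContDiffAt.sum fun j _ => ((hh.fderiv_apply (b j)).contDiffAt hξ).pow 2
    -- Division by the gradient: `c = ∑ ∂ⱼh • cⱼ`, with `q = |∇h|²`. Since `∇h` has degree zero,
    -- each `cⱼ` still has degree `d`. At critical points `q = 0`, but `c` vanishes in a
    -- neighbourhood, so `cⱼ` is smooth there too.
    let cj : Fin (Module.finrank ℝ E) → E → ℂ :=
      fun j ξ => (fderiv ℝ h ξ (b j) / q ξ) • c ξ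
    have hcj : ∀ j, IsHomogSmooth d (cj j) := by
      intro j
      refine .of_contDiffAt (fun ξ hξ => ?_) fun r hr ξ hξ => ?_
      · by_cases hcr : fderiv ℝ h ξ = 0
        · refine (contDiffAt_const (c := (0 : ℂ))).congr_of_eventuallyEq ?_
          filter_upwards [hcrit ξ hξ hcr] with ζ hζ
          simp [cj, hζ]
        · exact (((hh.fderiv_apply (b j)).contDiffAt hξ).div (hqs ξ hξ) (hq ξ hcr)).smul
            (hc.contDiffAt hξ)
      · have h1 : fderiv ℝ h (r • ξ) = fderiv ℝ h ξ := by
          rw [hh.fderiv_smul hr hξ, sub_self, Real.rpow_zero, one_smul]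
        simp only [cj, q, h1, hc.homog r hr ξ hξ]
        rw [smul_comm]
    have hcj0 : ∀ j, cj j 0 = 0 := fun j => by simp [cj, h0]
    have hcjcrit : ∀ j, ∀ ξ, ξ ≠ 0 → fderiv ℝ h ξ = 0 → cj j =ᶠ[𝓝 ξ] 0 := by
      intro j ξ hξ hcr
      filter_upwards [hcrit ξ hξ hcr] with ζ hζ
      simp [cj, hζ]
    have hcjcrit' : ∀ j, ∀ ξ, ξ ≠ 0 → fderiv ℝ h ξ = 0 →
        (fun ξ => fderiv ℝ (cj j) ξ (b j)) =ᶠ[𝓝 ξ] 0 := by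
      intro j ξ hξ hcr
      filter_upwards [(hcjcrit j ξ hξ hcr).eventuallyEq_nhds] with ζ hζ
      rw [hζ.fderiv_eq]
      simp
    have hdec : ∀ ξ, ξ ≠ 0 → c ξ = ∑ j, fderiv ℝ h ξ (b j) • cj j ξ := by
      intro ξ hξ
      by_cases hcr : fderiv ℝ h ξ = 0
      · have : c ξ = 0 := (hcrit ξ hξ hcr).self_of_nhds
        simp [cj, this]
      · simp only [cj, smul_smul]
        rw [← Finset.sum_smul]
        have : ∑ j, fderiv ℝ h ξ (b j) * (fderiv ℝ h ξ (b j) / q ξ) = 1 := by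
          simp only [mul_div_assoc', ← pow_two]
          rw [← Finset.sum_div]
          exact div_self (hq ξ hcr)
        rw [this, one_smul]
    -- A derivative falling on `cⱼ` lowers the degree by one. This is why the bound `lam ^ (-k)`
    -- asks for `k < d`; a derivative falling on `g` costs nothing.
    have hA : ∀ j, ∃ C, ∀ lam : ℝ, 0 < lam →
        ‖∫ ξ, fderiv ℝ (cj j) ξ (b j) * g ξ * oscFactor h lam ξ‖ ≤ C / lam ^ k := fun j =>
      ih (d - 1) _ (by linarith) ((hcj j).fderiv_apply (b j))
        (by rw [(hcj j).fderiv_zero (hcj0 j) (by linarith)]; rfl) (hcjcrit' j) g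
    have hB : ∀ j, ∃ C, ∀ lam : ℝ, 0 < lam →
        ‖∫ ξ, cj j ξ * (∂_{b j} g) ξ * oscFactor h lam ξ‖ ≤ C / lam ^ k := fun j =>
      ih d _ (by linarith) (hcj j) (hcj0 j) (hcjcrit j) _
    choose CA hCA using hA
    choose CB hCB using hB
    refine ⟨∑ j, (CA j + CB j), fun lam hlam => ?_⟩
    have hsplit : ∫ ξ, c ξ * g ξ * oscFactor h lam ξ =
        ∑ j, ∫ ξ, (fderiv ℝ h ξ (b j) • cj j ξ) * g ξ * oscFactor h lam ξ := by
      rw [← integral_finsetSum]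
      · refine integral_congr_ae ?_
        have hae : ∀ᵐ ξ : E, ξ ≠ 0 := compl_mem_ae_iff.mpr (measure_singleton _)
        filter_upwards [hae] with ξ hξ
        rw [hdec ξ hξ, Finset.sum_mul, Finset.sum_mul]
      · intro j _
        exact integrable_homog_mul_schwartz_mul_osc hh ((hh.fderiv_apply (b j)).smul (hcj j))
          (by simp only [hcj0, smul_zero]) (by linarith) g lam
    have hbp := fun j => integral_homog_osc_by_parts hh (hcj j) (hcj0 j) (by linarith) g lam (b j)
    have hnorm : lam * ‖∫ ξ, c ξ * g ξ * oscFactor h lam ξ‖ ≤ (∑ j, (CA j + CB j)) / lam ^ k := by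
      have h1 : lam * ‖∫ ξ, c ξ * g ξ * oscFactor h lam ξ‖ =
          ‖Complex.I * lam * ∫ ξ, c ξ * g ξ * oscFactor h lam ξ‖ := by
        rw [norm_mul, norm_mul, Complex.norm_I, one_mul, Complex.norm_real,
          Real.norm_of_nonneg hlam.le]
      rw [h1, hsplit, Finset.mul_sum, Finset.sum_div]
      refine norm_sum_le_of_le _ fun j _ => ?_
      rw [hbp j, norm_neg, add_div]
      exact norm_add_le_of_le (hCA j lam hlam) (hCB j lam hlam)
    rw [pow_succ, ← div_div, le_div_iff₀ hlam, mul_comm]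
    exact hnorm

end Nonstationary

/-! ### Second order Taylor formula -/

section Taylor

lemma two_le_infty : (2 : WithTop ℕ∞) ≤ ∞ := by
  change ((2 : ℕ∞) : WithTop ℕ∞) ≤ ((⊤ : ℕ∞) : WithTop ℕ∞)
  exact WithTop.coe_le_coe.mpr le_top

variable {E : Type*} [NormedAddCommGroup E] [NormedSpace ℝ E]

/-- Second order Taylor formula at a critical zero. -/
lemma taylor_two_of_critical {h : E → ℝ} {x : E} (hs : ContDiffAt ℝ ∞ h x) (h0 : h x = 0)
    (h1 : fderiv ℝ h x = 0) {ε : ℝ} (hε : 0 < ε) :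
    ∃ δ > 0, ∀ y : E, ‖y‖ ≤ δ →
      |h (x + y) - (1 / 2) * iteratedFDeriv ℝ 2 h x ![y, y]| ≤ ε * ‖y‖ ^ 2 := by
  have hsym : IsSymmSndFDerivAt ℝ h x := hs.isSymmSndFDerivAt (by simpa using two_le_infty)
  have hd1 : ∀ᶠ z in 𝓝 x, DifferentiableAt ℝ h z :=
    ((hs.of_le two_le_infty).eventually (by simp)).mono fun z hz => hz.differentiableAt (by simp)
  have hd2 : HasFDerivAt (fderiv ℝ h) (fderiv ℝ (fderiv ℝ h) x) x :=
    ((hs.fderiv_right (m := 1) (by rw [one_add_one_eq_two]; exact two_le_infty)).differentiableAt (by simp)).hasFDerivAt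
  have hlo := (hasFDerivAt_iff_isLittleO_nhds_zero.mp hd2).def hε
  have hd1' : ∀ᶠ y in 𝓝 (0 : E), DifferentiableAt ℝ h (x + y) := by
    have : Tendsto (fun y => x + y) (𝓝 (0 : E)) (𝓝 x) := by
      simpa using (continuous_const_add x).tendsto (0 : E)
    exact this.eventually hd1
  obtain ⟨δ, hδ, hball⟩ := Metric.eventually_nhds_iff.mp (hlo.and hd1')
  refine ⟨δ / 2, by positivity, fun y hy => ?_⟩
  set B := fderiv ℝ (fderiv ℝ h) x with hB
  -- The mean value inequality on the ball of radius `‖y‖` is applied to `h (x + z) - B z z / 2`. By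
  -- symmetry of `B` its derivative is `h'(x + z) - B z`, of norm at most `ε ‖y‖` on that ball.
  -- Halving `δ` keeps the closed ball inside the region where this is known.
  have hder : ∀ z ∈ Metric.closedBall (0 : E) ‖y‖,
      HasFDerivWithinAt (fun z => h (x + z) - (1 / 2) * B z z) (fderiv ℝ h (x + z) - B z)
        (Metric.closedBall (0 : E) ‖y‖) z := by
    intro z hz
    have hz' : dist z 0 < δ := by
      rw [dist_zero_right]
      have := mem_closedBall_zero_iff.mp hz
      linarith
    have e1 : HasFDerivAt (fun z => h (x + z)) (fderiv ℝ h (x + z)) z := by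
      exact (hball hz').2.hasFDerivAt.comp z ((hasFDerivAt_id z).const_add x)
    have e2 : HasFDerivAt (fun z => B z z) (B z + B.flip z) z := by
      have := (B.hasFDerivAt (x := z)).clm_apply (hasFDerivAt_id z)
      refine this.congr_fderiv ?_
      ext v
      simp
    refine ((e1.sub (e2.const_mul (1 / 2))).congr_fderiv ?_).hasFDerivWithinAt
    ext v
    have := hsym z v
    simp only [sub_apply, add_apply, smul_apply, ContinuousLinearMap.flip_apply, smul_eq_mul]
    rw [← hB] at this
    rw [this]
    ring
  have hbd : ∀ z ∈ Metric.closedBall (0 : E) ‖y‖, ‖fderiv ℝ h (x + z) - B z‖ ≤ ε * ‖y‖ := by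
    intro z hz
    have hz0 := mem_closedBall_zero_iff.mp hz
    have hz' : dist z 0 < δ := by
      rw [dist_zero_right]
      linarith
    have := (hball hz').1
    rw [h1, sub_zero] at this
    exact this.trans (by gcongr)
  have := (convex_closedBall (0 : E) ‖y‖).norm_image_sub_le_of_norm_hasFDerivWithin_le hder hbd
    (x := 0) (y := y)
    (mem_closedBall_zero_iff.mpr (by simp)) (mem_closedBall_zero_iff.mpr le_rfl)
  simp only [add_zero, h0, map_zero, sub_zero, mul_zero] at this
  rw [iteratedFDeriv_two_apply]
  simpa [pow_two, mul_assoc, Real.norm_eq_abs] using this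

end Taylor

/-! ### Splitting along a unit vector -/

section Slice

variable {E : Type*} [NormedAddCommGroup E] [InnerProductSpace ℝ E] [FiniteDimensional ℝ E]
  [MeasurableSpace E] [BorelSpace E]

/-- The splitting of a Euclidean space along a unit vector. -/
def sliceEquiv {Θ : E} (hΘ : ‖Θ‖ = 1) : ℝ × ((ℝ ∙ Θ)ᗮ : Submodule ℝ E) ≃ᵐ E :=
  ((LinearIsometryEquiv.toSpanUnitSingleton Θ hΘ).toHomeomorph.toMeasurableEquiv.prodCongr
    (MeasurableEquiv.refl _)).trans
    ((MeasurableEquiv.toLp 2 ((ℝ ∙ Θ : Submodule ℝ E) × ((ℝ ∙ Θ)ᗮ : Submodule ℝ E))).trans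
      (ℝ ∙ Θ : Submodule ℝ E).orthogonalDecomposition.symm.toHomeomorph.toMeasurableEquiv)

lemma sliceEquiv_apply {Θ : E} (hΘ : ‖Θ‖ = 1) (p : ℝ × ((ℝ ∙ Θ)ᗮ : Submodule ℝ E)) :
    sliceEquiv hΘ p = p.1 • Θ + (p.2 : E) := by
  have h1 : sliceEquiv hΘ p = (ℝ ∙ Θ : Submodule ℝ E).orthogonalDecomposition.symm
      (WithLp.toLp 2 (LinearIsometryEquiv.toSpanUnitSingleton Θ hΘ p.1, p.2)) := rfl
  rw [h1]
  simp

lemma measurePreserving_sliceEquiv {Θ : E} (hΘ : ‖Θ‖ = 1) :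
    MeasurePreserving (sliceEquiv hΘ) := by
  refine MeasurePreserving.trans (μb := volume) ?_ (MeasurePreserving.trans (μb := volume) ?_ ?_)
  · exact (LinearIsometryEquiv.toSpanUnitSingleton Θ hΘ).measurePreserving.prod
      (MeasurePreserving.id _)
  · exact WithLp.volume_preserving_toLp _ _
  · exact (ℝ ∙ Θ : Submodule ℝ E).orthogonalDecomposition.symm.measurePreserving

lemma integrable_slice_iff {Θ : E} (hΘ : ‖Θ‖ = 1) {F : Type*} [NormedAddCommGroup F]
    {f : E → F} : Integrable (fun p : ℝ × ((ℝ ∙ Θ)ᗮ : Submodule ℝ E) => f (p.1 • Θ + (p.2 : E))) ↔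
      Integrable f := by
  rw [← (measurePreserving_sliceEquiv hΘ).integrable_comp_emb (sliceEquiv hΘ).measurableEmbedding]
  refine integrable_congr (Eventually.of_forall fun p => ?_)
  simp [sliceEquiv_apply]

lemma integral_slice {Θ : E} (hΘ : ‖Θ‖ = 1) {F : Type*} [NormedAddCommGroup F] [NormedSpace ℝ F]
    {f : E → F} (hf : Integrable f) :
    ∫ x, f x = ∫ t : ℝ, ∫ y : ((ℝ ∙ Θ)ᗮ : Submodule ℝ E), f (t • Θ + (y : E)) := by
  rw [← (measurePreserving_sliceEquiv hΘ).integral_comp (sliceEquiv hΘ).measurableEmbedding]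
  simp only [sliceEquiv_apply]
  exact integral_prod _ ((integrable_slice_iff hΘ).mpr hf)

lemma norm_sq_smul_add_orth {Θ : E} (hΘ : ‖Θ‖ = 1) (t : ℝ)
    (y : ((ℝ ∙ Θ)ᗮ : Submodule ℝ E)) : ‖t • Θ + (y : E)‖ ^ 2 = t ^ 2 + ‖y‖ ^ 2 := by
  have horth : ⟪t • Θ, (y : E)⟫ = 0 := by
    rw [real_inner_smul_left, Submodule.mem_orthogonal_singleton_iff_inner_right.mp y.2, mul_zero]
  have h := norm_add_sq_eq_norm_sq_add_norm_sq_real horth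
  rw [norm_smul, hΘ, mul_one, Real.norm_eq_abs, abs_mul_abs_self] at h
  rw [pow_two, h, Submodule.coe_norm]
  ring

lemma inner_smul_add_orth {Θ : E} (hΘ : ‖Θ‖ = 1) (t : ℝ)
    (y : ((ℝ ∙ Θ)ᗮ : Submodule ℝ E)) : ⟪Θ, t • Θ + (y : E)⟫ = t := by
  rw [inner_add_right, real_inner_smul_right, real_inner_self_eq_norm_sq, hΘ,
    Submodule.mem_orthogonal_singleton_iff_inner_right.mp y.2]
  ring

lemma one_le_norm_add_orth {Θ : E} (hΘ : ‖Θ‖ = 1)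
    (y : ((ℝ ∙ Θ)ᗮ : Submodule ℝ E)) : 1 ≤ ‖Θ + (y : E)‖ := by
  have h := norm_sq_smul_add_orth hΘ 1 y
  rw [one_smul] at h
  have : (1 : ℝ) ^ 2 ≤ ‖Θ + (y : E)‖ ^ 2 := by
    rw [h]
    nlinarith [sq_nonneg ‖y‖]
  exact le_of_sq_le_sq this (norm_nonneg _) |>.trans' (le_refl _)

end Slice

/-! ### Fourier integrals along rays -/

section RadialFourier

variable {E : Type*} [NormedAddCommGroup E] [InnerProductSpace ℝ E] [FiniteDimensional ℝ E]
  [MeasurableSpace E] [BorelSpace E]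

/-- The Fourier integral along the ray in direction `θ`. -/
def rayFourier (d : ℝ) (g : 𝓢(E, ℂ)) (θ : E) (τ : ℝ) : ℂ :=
  ∫ r in Ioi (0 : ℝ), ((r ^ d : ℝ) : ℂ) * g (r • θ) * Complex.exp (Complex.I * (r * τ : ℝ))

/-- Schwartz decay of order `⌈d⌉ + 2` at `r • θ`. As `‖θ‖ ≥ 1`, one has `1 + r ≤ 1 + r ‖θ‖`, so the
bound is uniform in `θ` and integrable in `r`. -/
lemma exists_bound_ray {d : ℝ} (hd : 0 ≤ d) (g : 𝓢(E, ℂ)) :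
    ∃ C, 0 ≤ C ∧ ∀ θ : E, 1 ≤ ‖θ‖ → ∀ r : ℝ, 0 ≤ r →
      ‖((r ^ d : ℝ) : ℂ) * g (r • θ)‖ ≤ C * (1 + r ^ 2)⁻¹ := by
  set N := ⌈d⌉₊ + 2
  refine ⟨2 ^ N * (Finset.Iic (N, 0)).sup (schwartzSeminormFamily ℝ E ℂ) g, by positivity,
    fun θ hθ r hr => ?_⟩
  have h1 := one_add_le_sup_seminorm_apply (𝕜 := ℝ) (m := (N, 0)) (k := N) (n := 0) le_rfl le_rfl
    g (r • θ)
  rw [norm_iteratedFDeriv_zero, norm_smul, Real.norm_of_nonneg hr] at h1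
  have h2 : r ^ d * (1 + r ^ 2) ≤ (1 + r * ‖θ‖) ^ N := by
    have e0 : 1 + r ≤ 1 + r * ‖θ‖ := by nlinarith
    have e1 : r ^ d ≤ (1 + r) ^ ⌈d⌉₊ := by
      rw [← Real.rpow_natCast]
      calc r ^ d ≤ (1 + r) ^ d := by gcongr; linarith
        _ ≤ _ := Real.rpow_le_rpow_of_exponent_le (by linarith) (Nat.le_ceil d)
    have e2 : 1 + r ^ 2 ≤ (1 + r) ^ 2 := by nlinarith
    calc r ^ d * (1 + r ^ 2) ≤ (1 + r) ^ ⌈d⌉₊ * (1 + r) ^ 2 := by gcongr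
      _ = (1 + r) ^ N := by rw [← pow_add]
      _ ≤ _ := by gcongr
  rw [norm_mul, Complex.norm_real, Real.norm_of_nonneg (by positivity), ← div_eq_mul_inv,
    le_div_iff₀ (by positivity)]
  calc r ^ d * ‖g (r • θ)‖ * (1 + r ^ 2) = r ^ d * (1 + r ^ 2) * ‖g (r • θ)‖ := by ring
    _ ≤ (1 + r * ‖θ‖) ^ N * ‖g (r • θ)‖ := by gcongr
    _ ≤ _ := h1

lemma norm_cexp_I_mul_real (t : ℝ) : ‖Complex.exp (Complex.I * t)‖ = 1 := by
  rw [mul_comm]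
  exact Complex.norm_exp_ofReal_mul_I _

lemma continuous_rayIntegrand {d : ℝ} (hd : 0 ≤ d) (g : 𝓢(E, ℂ)) (θ : E) (τ : ℝ) :
    Continuous fun r : ℝ =>
      ((r ^ d : ℝ) : ℂ) * g (r • θ) * Complex.exp (Complex.I * (r * τ : ℝ)) := by
  have h1 : Continuous fun r : ℝ => r ^ d := continuous_id.rpow_const fun _ => Or.inr hd
  have h2 := g.continuous
  fun_prop

lemma integrableOn_rayIntegrand {d : ℝ} (hd : 0 ≤ d) (g : 𝓢(E, ℂ)) {θ : E} (hθ : 1 ≤ ‖θ‖)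
    (τ : ℝ) : IntegrableOn (fun r : ℝ =>
      ((r ^ d : ℝ) : ℂ) * g (r • θ) * Complex.exp (Complex.I * (r * τ : ℝ))) (Ioi 0) := by
  obtain ⟨C, -, hC⟩ := exists_bound_ray hd g
  refine ((integrable_inv_one_add_sq.const_mul C).integrableOn).mono'
    (continuous_rayIntegrand hd g θ τ).aestronglyMeasurable ?_
  filter_upwards [ae_restrict_mem measurableSet_Ioi] with r hr
  rw [norm_mul, norm_cexp_I_mul_real, mul_one]
  exact hC θ hθ r (le_of_lt hr)

/-- Integration by parts in `r`. The radial derivative of `g (r • θ)` is expanded in a fixed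
orthonormal basis, so that the new integrands are again ray integrals of Schwartz functions
independent of `θ`. The boundary term at `0` vanishes because `d ≥ 1`. -/
lemma rayFourier_by_parts {d : ℝ} (hd : 1 ≤ d) (g : 𝓢(E, ℂ)) {θ : E} (hθ : 1 ≤ ‖θ‖) (τ : ℝ) :
    Complex.I * τ * rayFourier d g θ τ = -(d * rayFourier (d - 1) g θ τ
      + ∑ j, ((⟪stdOrthonormalBasis ℝ E j, θ⟫ : ℝ) : ℂ) *
          rayFourier d (∂_{stdOrthonormalBasis ℝ E j} g) θ τ) := by
  set b := stdOrthonormalBasis ℝ E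
  have hA := (integrableOn_rayIntegrand (d := d - 1) (by linarith) g hθ τ).const_mul (d : ℂ)
  have hB := fun j => (integrableOn_rayIntegrand (d := d) (by linarith) (∂_{b j} g) hθ τ).const_mul
    ((⟪b j, θ⟫ : ℝ) : ℂ)
  have hC := (integrableOn_rayIntegrand (d := d) (by linarith) g hθ τ).const_mul (Complex.I * τ)
  have hB' := integrable_finsetSum (μ := volume.restrict (Ioi (0 : ℝ))) Finset.univ
    fun j _ => hB j
  have hder : ∀ r ∈ Ioi (0 : ℝ), HasDerivAt (fun r : ℝ =>
      ((r ^ d : ℝ) : ℂ) * g (r • θ) * Complex.exp (Complex.I * (r * τ : ℝ)))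
      ((d : ℂ) * (((r ^ (d - 1) : ℝ) : ℂ) * g (r • θ) * Complex.exp (Complex.I * (r * τ : ℝ)))
        + ∑ j, ((⟪b j, θ⟫ : ℝ) : ℂ) * (((r ^ d : ℝ) : ℂ) * (∂_{b j} g) (r • θ)
            * Complex.exp (Complex.I * (r * τ : ℝ)))
        + Complex.I * τ * (((r ^ d : ℝ) : ℂ) * g (r • θ)
            * Complex.exp (Complex.I * (r * τ : ℝ)))) r := by
    intro r hr
    have e1 : HasDerivAt (fun r : ℝ => ((r ^ d : ℝ) : ℂ)) ((d * r ^ (d - 1) : ℝ) : ℂ) r :=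
      (Real.hasDerivAt_rpow_const (Or.inl (ne_of_gt hr))).ofReal_comp
    have e2 : HasDerivAt (fun r : ℝ => g (r • θ)) (fderiv ℝ g (r • θ) θ) r := by
      have : HasDerivAt (fun r : ℝ => r • θ) θ r := by
        simpa using (hasDerivAt_id r).smul_const θ
      exact (g.hasFDerivAt (r • θ)).comp_hasDerivAt r this
    have e3 : HasDerivAt (fun r : ℝ => Complex.exp (Complex.I * (r * τ : ℝ)))
        (Complex.exp (Complex.I * (r * τ : ℝ)) * (Complex.I * τ)) r := by
      have : HasDerivAt (fun r : ℝ => Complex.I * ((r * τ : ℝ) : ℂ)) (Complex.I * τ) r := by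
        have := ((hasDerivAt_id r).mul_const τ).ofReal_comp.const_mul Complex.I
        simpa using this
      exact this.cexp
    have e4 : fderiv ℝ g (r • θ) θ = ∑ j, ((⟪b j, θ⟫ : ℝ) : ℂ) * (∂_{b j} g) (r • θ) := by
      conv_lhs => rw [← b.sum_repr θ, map_sum]
      refine Finset.sum_congr rfl fun j _ => ?_
      rw [map_smul, b.repr_apply_apply, Complex.real_smul, lineDerivOp_apply_eq_fderiv,
        b.sum_repr]
    refine ((e1.mul e2).mul e3).congr_deriv ?_
    have e5 : ∑ j, ((⟪b j, θ⟫ : ℝ) : ℂ) * (((r ^ d : ℝ) : ℂ) * (∂_{b j} g) (r • θ)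
            * Complex.exp (Complex.I * (r * τ : ℝ))) =
        ((r ^ d : ℝ) : ℂ) * fderiv ℝ g (r • θ) θ * Complex.exp (Complex.I * (r * τ : ℝ)) := by
      rw [e4, Finset.mul_sum, Finset.sum_mul]
      refine Finset.sum_congr rfl fun j _ => ?_
      ring
    rw [e5]
    simp only [Pi.mul_apply]
    push_cast
    ring
  have hlim : Tendsto (fun r : ℝ =>
      ((r ^ d : ℝ) : ℂ) * g (r • θ) * Complex.exp (Complex.I * (r * τ : ℝ))) atTop (𝓝 0) := by
    obtain ⟨C, -, hC⟩ := exists_bound_ray (d := d) (by linarith) g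
    have ht : Tendsto (fun r : ℝ => C * (1 + r ^ 2)⁻¹) atTop (𝓝 0) := by
      have : Tendsto (fun r : ℝ => 1 + r ^ 2) atTop atTop :=
        tendsto_atTop_add_const_left _ _ (tendsto_pow_atTop two_ne_zero)
      simpa using this.inv_tendsto_atTop.const_mul C
    refine squeeze_zero_norm' ?_ ht
    filter_upwards [eventually_ge_atTop 0] with r hr
    rw [norm_mul, norm_cexp_I_mul_real, mul_one]
    exact hC θ hθ r hr
  have key := integral_Ioi_of_hasDerivAt_of_tendsto
    (continuous_rayIntegrand (d := d) (by linarith) g θ τ).continuousWithinAt hder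
    ((hA.add hB').add hC) hlim
  have hsum1 := integral_add (hA.add hB') hC
  have hsum2 := integral_add hA hB'
  simp only [Pi.add_apply] at hsum1
  rw [hsum1, hsum2, integral_const_mul, integral_const_mul,
    integral_finsetSum _ fun j _ => hB j] at key
  simp only [integral_const_mul] at key
  rw [Real.zero_rpow (by linarith)] at key
  simp only [Complex.ofReal_zero, zero_mul, sub_zero] at key
  simp only [rayFourier]
  linear_combination key

/-- Each integration by parts gains a factor `τ` and lowers the exponent of `r` by at most one, so
`k` steps are possible when `k ≤ d`. The bound `‖θ‖ ≤ R` controls the coefficients `⟪bⱼ, θ⟫`. -/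
lemma rayFourier_decay_aux (R : ℝ) (k : ℕ) : ∀ d : ℝ, (k : ℝ) ≤ d → ∀ g : 𝓢(E, ℂ),
    ∃ C, 0 ≤ C ∧ ∀ θ : E, 1 ≤ ‖θ‖ → ‖θ‖ ≤ R → ∀ τ : ℝ, |τ| ^ k * ‖rayFourier d g θ τ‖ ≤ C := by
  induction k with
  | zero =>
    intro d hd g
    simp only [Nat.cast_zero] at hd
    obtain ⟨C, hC0, hC⟩ := exists_bound_ray hd g
    refine ⟨∫ r in Ioi (0 : ℝ), C * (1 + r ^ 2)⁻¹, by positivity, fun θ hθ _ τ => ?_⟩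
    rw [pow_zero, one_mul]
    refine norm_integral_le_of_norm_le (integrable_inv_one_add_sq.const_mul C).integrableOn ?_
    filter_upwards [ae_restrict_mem measurableSet_Ioi] with r hr
    rw [norm_mul, norm_cexp_I_mul_real, mul_one]
    exact hC θ hθ r (le_of_lt hr)
  | succ k ih =>
    intro d hd g
    push_cast at hd
    have hk0 : (0 : ℝ) ≤ k := k.cast_nonneg
    obtain ⟨CA, hCA0, hCA⟩ := ih (d - 1) (by linarith) g
    have hB := fun j => ih d (by linarith) (∂_{stdOrthonormalBasis ℝ E j} g)
    choose CB hCB0 hCB using hB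
    refine ⟨|d| * CA + ∑ j, |R| * CB j, ?_, fun θ hθ hθR τ => ?_⟩
    · have := Finset.sum_nonneg fun j (_ : j ∈ Finset.univ) => mul_nonneg (abs_nonneg R) (hCB0 j)
      positivity
    · have h1 : |τ| ^ (k + 1) * ‖rayFourier d g θ τ‖ =
          |τ| ^ k * ‖Complex.I * τ * rayFourier d g θ τ‖ := by
        rw [norm_mul, norm_mul, Complex.norm_I, one_mul, Complex.norm_real, Real.norm_eq_abs,
          pow_succ, mul_assoc]
      rw [h1, rayFourier_by_parts (by linarith) g hθ τ, norm_neg]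
      refine (mul_le_mul_of_nonneg_left ((norm_add_le _ _).trans
        (add_le_add le_rfl (norm_sum_le _ _))) (by positivity)).trans ?_
      rw [mul_add, Finset.mul_sum]
      refine add_le_add ?_ (Finset.sum_le_sum fun j _ => ?_)
      · rw [norm_mul, Complex.norm_real, Real.norm_eq_abs, mul_left_comm]
        gcongr
        exact hCA θ hθ hθR τ
      · rw [norm_mul, Complex.norm_real, Real.norm_eq_abs, mul_left_comm]
        have h2 : |⟪stdOrthonormalBasis ℝ E j, θ⟫| ≤ |R| := by
          refine (abs_real_inner_le_norm _ _).trans ?_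
          rw [(stdOrthonormalBasis ℝ E).norm_eq_one, one_mul]
          exact hθR.trans (le_abs_self R)
        gcongr
        exact hCB j θ hθ hθR τ

lemma rayFourier_decay (R : ℝ) (k : ℕ) {d : ℝ} (hd : (k : ℝ) ≤ d) (g : 𝓢(E, ℂ)) :
    ∃ C, 0 ≤ C ∧ ∀ θ : E, 1 ≤ ‖θ‖ → ‖θ‖ ≤ R → ∀ τ : ℝ,
      ‖rayFourier d g θ τ‖ ≤ C * ((1 + |τ|) ^ k)⁻¹ := by
  obtain ⟨C₀, h00, h0⟩ := rayFourier_decay_aux R 0 d (by simpa using k.cast_nonneg.trans hd) g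
  obtain ⟨C₁, h10, h1⟩ := rayFourier_decay_aux R k d hd g
  refine ⟨2 ^ k * (C₀ + C₁), by positivity, fun θ hθ hθR τ => ?_⟩
  have e0 := h0 θ hθ hθR τ
  have e1 := h1 θ hθ hθR τ
  rw [pow_zero, one_mul] at e0
  rw [← div_eq_mul_inv, le_div_iff₀ (by positivity)]
  have e2 : (1 + |τ|) ^ k ≤ 2 ^ k * (1 + |τ| ^ k) := by
    rcases le_total |τ| 1 with h | h
    · calc (1 + |τ|) ^ k ≤ 2 ^ k := by gcongr; linarith
        _ ≤ _ := le_mul_of_one_le_right (by positivity) (by linarith [pow_nonneg (abs_nonneg τ) k])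
    · calc (1 + |τ|) ^ k ≤ (2 * |τ|) ^ k := by gcongr; linarith
        _ = 2 ^ k * |τ| ^ k := mul_pow _ _ _
        _ ≤ _ := by gcongr; linarith
  calc ‖rayFourier d g θ τ‖ * (1 + |τ|) ^ k
      ≤ ‖rayFourier d g θ τ‖ * (2 ^ k * (1 + |τ| ^ k)) := by gcongr
    _ = 2 ^ k * (‖rayFourier d g θ τ‖ + |τ| ^ k * ‖rayFourier d g θ τ‖) := by ring
    _ ≤ _ := by gcongr

lemma continuousOn_rayFourier {d : ℝ} (hd : 0 ≤ d) (g : 𝓢(E, ℂ)) :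
    ContinuousOn (fun p : E × ℝ => rayFourier d g p.1 p.2) {p | 1 ≤ ‖p.1‖} := by
  obtain ⟨C, hC0, hC⟩ := exists_bound_ray hd g
  unfold rayFourier
  refine continuousOn_of_dominated (bound := fun r => C * (1 + r ^ 2)⁻¹) ?_ ?_ ?_ ?_
  · intro p _
    exact (continuous_rayIntegrand hd g p.1 p.2).aestronglyMeasurable
  · intro p hp
    filter_upwards [ae_restrict_mem measurableSet_Ioi] with r hr
    rw [norm_mul, norm_cexp_I_mul_real, mul_one]
    exact hC p.1 hp r (le_of_lt hr)
  · exact (integrable_inv_one_add_sq.const_mul C).integrableOn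
  · refine Eventually.of_forall fun r => ?_
    have := g.continuous
    refine Continuous.continuousOn ?_
    fun_prop

end RadialFourier

/-! ### Gaussian integrals with a complex parameter -/

section Gaussian

open scoped Matrix

variable {d : ℕ}

lemma Matrix.PosSemidef.exists_conjTranspose_mul_self {M : Matrix (Fin d) (Fin d) ℝ}
    (hM : M.PosSemidef) : ∃ B : Matrix (Fin d) (Fin d) ℝ, M = Bᵀ * B := by
  open scoped MatrixOrder in
  have h0 : 0 ≤ M := Matrix.nonneg_iff_posSemidef.mpr hM
  have h1 : (CFC.sqrt M).PosSemidef := Matrix.nonneg_iff_posSemidef.mp (CFC.sqrt_nonneg M)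
  have h2 : (CFC.sqrt M)ᵀ = CFC.sqrt M := by
    have := h1.isHermitian.eq
    rwa [Matrix.conjTranspose_eq_transpose_of_trivial] at this
  exact ⟨CFC.sqrt M, by rw [h2, CFC.sqrt_mul_sqrt_self M h0]⟩

/-- The quadratic form `(1/2) xᵀ M x`. -/
def halfQuadForm (M : Matrix (Fin d) (Fin d) ℝ) (x : Euc d) : ℝ :=
  (1 / 2) * (x.ofLp ⬝ᵥ M *ᵥ x.ofLp)

lemma continuous_halfQuadForm (M : Matrix (Fin d) (Fin d) ℝ) : Continuous (halfQuadForm M) := by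
  unfold halfQuadForm
  simp only [dotProduct, Matrix.mulVec]
  fun_prop

lemma halfQuadForm_transpose_mul_self (B : Matrix (Fin d) (Fin d) ℝ) (x : Euc d) :
    halfQuadForm (Bᵀ * B) x = (1 / 2) * ‖Matrix.toEuclideanLin B x‖ ^ 2 := by
  rw [halfQuadForm, EuclideanSpace.real_norm_sq_eq, ← Matrix.mulVec_mulVec, Matrix.dotProduct_mulVec,
    Matrix.vecMul_transpose]
  simp [dotProduct, pow_two, Matrix.ofLp_toLpLin]

lemma det_toEuclideanLin (B : Matrix (Fin d) (Fin d) ℝ) :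
    LinearMap.det (Matrix.toEuclideanLin B) = B.det := by
  rw [Matrix.toEuclideanLin_eq_toLin_orthonormal, LinearMap.det_toLin]

/-- Writing `M = Bᵀ B`, the substitution `x ↦ B x` reduces the integral to the isotropic Gaussian,
with Jacobian `|det B| = √(det M)`. -/
lemma gaussian_quadForm_aux {M : Matrix (Fin d) (Fin d) ℝ} (hM : M.PosDef) {b : ℂ}
    (hb : 0 < b.re) :
    Integrable (fun x : Euc d => Complex.exp (-b * (halfQuadForm M x : ℝ))) ∧
    ∫ x : Euc d, Complex.exp (-b * (halfQuadForm M x : ℝ)) =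
      (2 * Real.pi / b) ^ ((d : ℂ) / 2) / (Real.sqrt M.det : ℝ) := by
  obtain ⟨B, rfl⟩ := hM.posSemidef.exists_conjTranspose_mul_self
  have hdet : (Bᵀ * B).det = B.det ^ 2 := by rw [Matrix.det_mul, Matrix.det_transpose, pow_two]
  have hB : B.det ≠ 0 := by
    intro h
    have := hM.det_pos
    rw [hdet, h] at this
    simp at this
  have hL : LinearMap.det (Matrix.toEuclideanLin B) ≠ 0 := by rwa [det_toEuclideanLin]
  let L : Euc d ≃L[ℝ] Euc d :=
    (LinearEquiv.ofIsUnitDet (f := Matrix.toEuclideanLin B)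
      (v := (EuclideanSpace.basisFun (Fin d) ℝ).toBasis)
      (v' := (EuclideanSpace.basisFun (Fin d) ℝ).toBasis)
      (by rw [LinearMap.det_toMatrix]; exact hL.isUnit)).toContinuousLinearEquiv
  have hLa : ∀ x, L x = Matrix.toEuclideanLin B x := fun x => rfl
  have hmap : Measure.map L volume = ENNReal.ofReal |(B.det)⁻¹| • (volume : Measure (Euc d)) := by
    rw [← det_toEuclideanLin, ← Measure.map_linearMap_addHaar_eq_smul_addHaar volume hL]
    rfl
  have hb2 : 0 < (b / 2).re := by simpa using hb
  have hg : Integrable fun x : Euc d => Complex.exp (-(b / 2) * ‖x‖ ^ 2) := by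
    simpa using GaussianFourier.integrable_cexp_neg_mul_sq_norm_add hb2 0 (0 : Euc d)
  have hfun : (fun x : Euc d => Complex.exp (-b * (halfQuadForm (Bᵀ * B) x : ℝ))) =
      (fun x : Euc d => Complex.exp (-(b / 2) * ‖x‖ ^ 2)) ∘ L := by
    ext x
    rw [halfQuadForm_transpose_mul_self, Function.comp_apply, hLa]
    congr 1
    push_cast
    ring
  have hme : MeasurableEmbedding L := L.toHomeomorph.measurableEmbedding
  constructor
  · rw [hfun, ← hme.integrable_map_iff, hmap]
    exact hg.smul_measure ENNReal.ofReal_ne_top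
  · rw [hfun]
    have h1 : ∫ x, ((fun x : Euc d => Complex.exp (-(b / 2) * ‖x‖ ^ 2)) ∘ L) x =
        ∫ x, Complex.exp (-(b / 2) * ‖x‖ ^ 2) ∂(Measure.map L volume) := by
      rw [hme.integral_map]
      rfl
    rw [h1, hmap, integral_smul_measure, ENNReal.toReal_ofReal (abs_nonneg _),
      GaussianFourier.integral_cexp_neg_mul_sq_norm hb2, hdet, Real.sqrt_sq_eq_abs,
      finrank_euclideanSpace_fin, abs_inv, Complex.real_smul, div_eq_inv_mul _ ((|B.det| : ℝ) : ℂ)]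
    congr 1
    · push_cast
      rfl
    · congr 1
      have : b ≠ 0 := fun h => by simp [h] at hb
      field_simp

/-- The constant is the minimum of the form on the unit sphere; in dimension zero the sphere is
empty and any constant serves. -/
lemma exists_le_halfQuadForm {M : Matrix (Fin d) (Fin d) ℝ} (hM : M.PosDef) :
    ∃ a > 0, ∀ x : Euc d, a * ‖x‖ ^ 2 ≤ halfQuadForm M x := by
  have hpos : ∀ x : Euc d, x ≠ 0 → 0 < halfQuadForm M x := by
    intro x hx
    have h1 : x.ofLp ≠ 0 := fun h => hx ((WithLp.ofLp_eq_zero 2).mp h)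
    have := hM.dotProduct_mulVec_pos h1
    rw [halfQuadForm]
    simpa using this
  have hsc : ∀ (r : ℝ) (x : Euc d), halfQuadForm M (r • x) = r ^ 2 * halfQuadForm M x := by
    intro r x
    simp only [halfQuadForm, WithLp.ofLp_smul, Matrix.mulVec_smul, dotProduct_smul, smul_dotProduct,
      smul_eq_mul]
    ring
  rcases (Metric.sphere (0 : Euc d) 1).eq_empty_or_nonempty with hE | hE
  · refine ⟨1, one_pos, fun x => ?_⟩
    have hx : x = 0 := by
      by_contra hx
      have : ‖x‖⁻¹ • x ∈ Metric.sphere (0 : Euc d) 1 := by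
        simp [norm_smul, norm_ne_zero_iff.mpr hx]
      rw [hE] at this
      exact this
    rw [hx]
    simp [halfQuadForm]
  · obtain ⟨x₀, hx₀, hmin⟩ := (isCompact_sphere (0 : Euc d) 1).exists_isMinOn hE
      (continuous_halfQuadForm M).continuousOn
    have hx₀' : x₀ ≠ 0 := fun h => by simp [h] at hx₀
    refine ⟨halfQuadForm M x₀, hpos x₀ hx₀', fun x => ?_⟩
    by_cases hx : x = 0
    · simp [hx, halfQuadForm]
    · have hn : 0 < ‖x‖ := norm_pos_iff.mpr hx
      have h1 : ‖x‖⁻¹ • x ∈ Metric.sphere (0 : Euc d) 1 := by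
        simp [norm_smul, hn.ne']
      have h2 := hmin h1
      simp only [mem_ofPred_eq, hsc] at h2
      rw [inv_pow, ← div_eq_inv_mul, le_div_iff₀ (by positivity)] at h2
      exact h2

end Gaussian

/-! ### Oscillatory integrals over a cone -/

section Cone

variable {E : Type*} [NormedAddCommGroup E] [InnerProductSpace ℝ E] [FiniteDimensional ℝ E]
  [MeasurableSpace E] [BorelSpace E]

/-- The function `c` is supported in the cone of aperture `δ` around `Θ`. -/
def SupportedInCone (Θ : E) (δ : ℝ) (c : E → ℂ) : Prop :=
  ∀ ξ, c ξ ≠ 0 → 0 < ⟪Θ, ξ⟫ ∧ ‖ξ‖ ^ 2 ≤ (1 + δ ^ 2) * ⟪Θ, ξ⟫ ^ 2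

/-- At the point `Θ + y` the cone condition reads `1 + ‖y‖² ≤ 1 + δ²`. -/
lemma SupportedInCone.norm_le {Θ : E} {δ : ℝ} {c : E → ℂ} (hc : SupportedInCone Θ δ c)
    (hΘ : ‖Θ‖ = 1) (hδ : 0 ≤ δ) {y : ((ℝ ∙ Θ)ᗮ : Submodule ℝ E)} (hy : c (Θ + (y : E)) ≠ 0) :
    ‖y‖ ≤ δ := by
  have h1 := (hc _ hy).2
  have h2 := norm_sq_smul_add_orth hΘ 1 y
  have h3 := inner_smul_add_orth hΘ 1 y
  rw [one_smul] at h2 h3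
  rw [h2, h3] at h1
  exact le_of_sq_le_sq (by linarith) hδ

variable {d : ℝ} {c : E → ℂ} {h : E → ℝ} {Θ : E}

lemma add_orth_ne_zero (hΘ : ‖Θ‖ = 1) (y : ((ℝ ∙ Θ)ᗮ : Submodule ℝ E)) : Θ + (y : E) ≠ 0 := by
  intro h
  have := one_le_norm_add_orth hΘ y
  rw [h, norm_zero] at this
  linarith

lemma IsHomogSmooth.continuous_comp_add_orth {F : Type*} [NormedAddCommGroup F] [NormedSpace ℝ F]
    {f : E → F} (hf : IsHomogSmooth d f) (hΘ : ‖Θ‖ = 1) :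
    Continuous fun y : ((ℝ ∙ Θ)ᗮ : Submodule ℝ E) => f (Θ + (y : E)) :=
  hf.smooth.continuousOn.comp_continuous (by fun_prop) fun y => add_orth_ne_zero hΘ y

/-- An oscillatory integral over a cone, in the projective coordinates `ξ = r (Θ + y)`. -/
lemma integral_cone_eq (hΘ : ‖Θ‖ = 1) (hh : IsHomogSmooth 1 h) (hc : IsHomogSmooth d c)
    (h0 : c 0 = 0) (hd : 0 < d) {δ : ℝ} (hδ : 0 ≤ δ) (hsupp : SupportedInCone Θ δ c)
    (g : 𝓢(E, ℂ)) (lam : ℝ) :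
    ∫ ξ, c ξ * g ξ * oscFactor h lam ξ = ∫ y : ((ℝ ∙ Θ)ᗮ : Submodule ℝ E), c (Θ + (y : E)) *
      rayFourier (d + Module.finrank ℝ ((ℝ ∙ Θ)ᗮ : Submodule ℝ E)) g (Θ + (y : E))
        (lam * h (Θ + (y : E))) := by
  set W : Submodule ℝ E := (ℝ ∙ Θ)ᗮ with hW
  set m := Module.finrank ℝ W
  have : Nontrivial E := ⟨Θ, 0, fun h => by simp [h] at hΘ⟩
  have hp : 0 ≤ d + m := by positivity
  let K : ℝ → W → ℂ := fun t y => c (Θ + (y : E)) * (((t ^ (d + m) : ℝ) : ℂ) *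
    g (t • (Θ + (y : E))) * Complex.exp (Complex.I * (t * (lam * h (Θ + (y : E))) : ℝ)))
  -- The substitution `y ↦ t y` in the slice at height `t` has Jacobian `t ^ m`. With the `t ^ d`
  -- coming from `c` this gives `t ^ (d + m)`, and the phase becomes linear in `t`.
  have hinner : ∀ t : ℝ, 0 < t → ∫ y : W, c (t • Θ + (y : E)) * g (t • Θ + (y : E)) *
      oscFactor h lam (t • Θ + (y : E)) = ∫ y : W, K t y := by
    intro t ht
    have h1 := Measure.integral_comp_smul_of_nonneg (volume : Measure W)
      (fun y : W => c (t • Θ + (y : E)) * g (t • Θ + (y : E)) *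
        oscFactor h lam (t • Θ + (y : E))) t (hR := ht.le)
    rw [eq_inv_smul_iff₀ (pow_ne_zero _ ht.ne')] at h1
    rw [← h1, ← integral_smul]
    refine integral_congr_ae (Eventually.of_forall fun y => ?_)
    have h2 : t • Θ + ((t • y : W) : E) = t • (Θ + (y : E)) := by
      rw [smul_add, Submodule.coe_smul]
    simp only [K, h2]
    rw [hc.homog t ht _ (add_orth_ne_zero hΘ y), oscFactor,
      hh.homog t ht _ (add_orth_ne_zero hΘ y), Real.rpow_one, Real.rpow_add ht,
      Real.rpow_natCast, smul_eq_mul, Complex.real_smul, Complex.real_smul,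
      show lam * (t * h (Θ + (y : E))) = t * (lam * h (Θ + (y : E))) by ring]
    push_cast
    ring
  have hint := integrable_homog_mul_schwartz_mul_osc hh hc h0 hd g lam
  rw [integral_slice hΘ hint]
  -- Slices at height `t ≤ 0` do not meet the cone.
  have hneg : ∀ t : ℝ, t ∉ Ioi (0 : ℝ) → ∫ y : W, c (t • Θ + (y : E)) * g (t • Θ + (y : E)) *
      oscFactor h lam (t • Θ + (y : E)) = 0 := by
    intro t ht
    have : ∀ y : W, c (t • Θ + (y : E)) = 0 := by
      intro y
      by_contra hne
      have h1 := (hsupp _ hne).1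
      rw [inner_smul_add_orth hΘ t y] at h1
      exact ht h1
    simp [this]
  rw [← setIntegral_eq_integral_of_forall_compl_eq_zero (s := Ioi (0 : ℝ)) hneg,
    setIntegral_congr_fun measurableSet_Ioi hinner]
  have hcc := hc.continuous_comp_add_orth (Θ := Θ) hΘ
  have hhc := hh.continuous_comp_add_orth (Θ := Θ) hΘ
  -- The domination for Fubini is a product: `(1 + t²)⁻¹` in the radial variable, uniformly in `y`,
  -- and a continuous function of compact support in `y`.
  have hKint : Integrable (Function.uncurry K)
      ((volume.restrict (Ioi (0 : ℝ))).prod (volume : Measure W)) := by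
    obtain ⟨C, hC0, hC⟩ := exists_bound_ray hp g
    have hcs : HasCompactSupport fun y : W => c (Θ + (y : E)) := by
      refine HasCompactSupport.of_support_subset_isCompact (isCompact_closedBall (0 : W) δ) ?_
      intro y hy
      exact mem_closedBall_zero_iff.mpr (hsupp.norm_le hΘ hδ hy)
    have hb : Integrable (fun p : ℝ × W => (C * (1 + p.1 ^ 2)⁻¹) * ‖c (Θ + (p.2 : E))‖)
        ((volume.restrict (Ioi (0 : ℝ))).prod (volume : Measure W)) :=
      ((integrable_inv_one_add_sq.const_mul C).integrableOn).mul_prod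
        (hcc.integrable_of_hasCompactSupport hcs).norm
    refine hb.mono' ?_ ?_
    · have hgc := g.continuous
      have hr : Continuous fun t : ℝ => t ^ (d + m) :=
        continuous_id.rpow_const fun _ => Or.inr hp
      have hcont : Continuous (Function.uncurry K) := by
        simp only [K, Function.uncurry_def]
        have e1 : Continuous fun p : ℝ × W => c (Θ + (p.2 : E)) := hcc.comp continuous_snd
        have e2 : Continuous fun p : ℝ × W => h (Θ + (p.2 : E)) := hhc.comp continuous_snd
        have e3 : Continuous fun p : ℝ × W => p.1 ^ (d + m) := hr.comp continuous_fst
        have e4 : Continuous fun p : ℝ × W => g (p.1 • (Θ + (p.2 : E))) :=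
          hgc.comp (by fun_prop)
        exact e1.mul (((Complex.continuous_ofReal.comp e3).mul e4).mul (Complex.continuous_exp.comp
          (continuous_const.mul (Complex.continuous_ofReal.comp
            (continuous_fst.mul (continuous_const.mul e2))))))
      exact hcont.aestronglyMeasurable
    · have hae : ∀ᵐ p : ℝ × W ∂((volume.restrict (Ioi (0 : ℝ))).prod (volume : Measure W)),
          p.1 ∈ Ioi (0 : ℝ) :=
        Measure.quasiMeasurePreserving_fst.ae (ae_restrict_mem measurableSet_Ioi)
      filter_upwards [hae] with p hp
      simp only [K, Function.uncurry_def]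
      rw [norm_mul, norm_mul _ (Complex.exp _), norm_cexp_I_mul_real, mul_one, mul_comm]
      gcongr
      exact hC _ (one_le_norm_add_orth hΘ p.2) _ (le_of_lt hp)
  rw [integral_integral_swap hKint]
  refine integral_congr_ae (Eventually.of_forall fun y => ?_)
  simp only [K, rayFourier]
  rw [integral_const_mul]

end Cone

/-! ### Localisation at a nondegenerate critical ray -/

section StationaryRay

open scoped Matrix

variable {n : ℕ} {Θ : Euc n}

/-- Coordinates in the hyperplane orthogonal to `Θ`. -/
def orthCoord (Θ : Euc n) :
    Euc (Module.finrank ℝ ((ℝ ∙ Θ)ᗮ : Submodule ℝ (Euc n))) ≃ₗᵢ[ℝ]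
      ((ℝ ∙ Θ)ᗮ : Submodule ℝ (Euc n)) :=
  (stdOrthonormalBasis ℝ ((ℝ ∙ Θ)ᗮ : Submodule ℝ (Euc n))).repr.symm

/-- Signs are arranged so that `halfQuadForm (-tangentHessian h Θ)` is the positive form of which
the second order Taylor term of `h` is the negative. -/
lemma hessian_orthCoord (h : Euc n → ℝ)
    (z : Euc (Module.finrank ℝ ((ℝ ∙ Θ)ᗮ : Submodule ℝ (Euc n)))) :
    iteratedFDeriv ℝ 2 h Θ ![(orthCoord Θ z : Euc n), (orthCoord Θ z : Euc n)] =
      -2 * halfQuadForm (-tangentHessian h Θ) z := by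
  set b := stdOrthonormalBasis ℝ ((ℝ ∙ Θ)ᗮ : Submodule ℝ (Euc n)) with hb
  have h1 : ((orthCoord Θ z : ((ℝ ∙ Θ)ᗮ : Submodule ℝ (Euc n))) : Euc n) =
      ∑ i, z i • (b i : Euc n) := by
    rw [orthCoord, ← hb, ← b.sum_repr_symm]
    push_cast
    rfl
  rw [iteratedFDeriv_two_apply, h1]
  simp only [Matrix.cons_val_zero, Matrix.cons_val_one, map_sum, map_smul]
  simp only [halfQuadForm, dotProduct, Matrix.mulVec, Matrix.neg_apply, tangentHessian,
    Matrix.of_apply, iteratedFDeriv_two_apply, Matrix.cons_val_zero, Matrix.cons_val_one,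
    sum_apply, smul_apply, smul_eq_mul, ← hb, Finset.mul_sum]
  rw [Finset.sum_comm]
  refine Finset.sum_congr rfl fun i _ => Finset.sum_congr rfl fun j _ => ?_
  ring

lemma posDef_neg_tangentHessian {h : Euc n → ℝ} (hs : ContDiffAt ℝ ∞ h Θ)
    (hneg : ∀ v : Euc n, ⟪Θ, v⟫ = 0 → v ≠ 0 → iteratedFDeriv ℝ 2 h Θ ![v, v] < 0) :
    (-tangentHessian h Θ).PosDef := by
  have hsym : IsSymmSndFDerivAt ℝ h Θ := hs.isSymmSndFDerivAt (by simpa using two_le_infty)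
  refine Matrix.PosDef.of_dotProduct_mulVec_pos ?_ fun x hx => ?_
  · ext i j
    simp only [tangentHessian, Matrix.conjTranspose_apply, Matrix.neg_apply, Matrix.of_apply,
      iteratedFDeriv_two_apply, Matrix.cons_val_zero, Matrix.cons_val_one, star_trivial]
    rw [hsym]
  · set z : Euc (Module.finrank ℝ ((ℝ ∙ Θ)ᗮ : Submodule ℝ (Euc n))) := WithLp.toLp 2 x
    have hz : (orthCoord Θ z : Euc n) ≠ 0 := by
      intro h0
      apply hx
      have h1 : orthCoord Θ z = 0 := by exact_mod_cast h0
      have h2 : z = 0 := (orthCoord Θ).map_eq_zero_iff.mp h1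
      exact (WithLp.toLp_eq_zero 2).mp h2
    have h3 := hneg _ (Submodule.mem_orthogonal_singleton_iff_inner_right.mp (orthCoord Θ z).2) hz
    rw [hessian_orthCoord, halfQuadForm] at h3
    simp only [star_trivial]
    change 0 < z.ofLp ⬝ᵥ _ *ᵥ z.ofLp
    linarith

lemma tendsto_rayFourier {d : ℝ} (hd : 0 ≤ d) (g : 𝓢(Euc n, ℂ)) {l : Filter ℝ} {p : ℝ → Euc n}
    {q : ℝ → ℝ} {τ : ℝ} (hΘ : 1 ≤ ‖Θ‖) (hp : Tendsto p l (𝓝 Θ)) (hq : Tendsto q l (𝓝 τ))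
    (hone : ∀ t, 1 ≤ ‖p t‖) :
    Tendsto (fun t => rayFourier d g (p t) (q t)) l (𝓝 (rayFourier d g Θ τ)) := by
  have hcont := continuousOn_rayFourier hd g (Θ, τ) hΘ
  exact hcont.tendsto.comp (f := fun t => (p t, q t)) (tendsto_nhdsWithin_iff.mpr
    ⟨hp.prodMk_nhds hq, Eventually.of_forall fun t => hone t⟩)

set_option maxHeartbeats 1000000 in
/-- Localisation of the oscillatory integral near a nondegenerate critical ray. -/
lemma tendsto_integral_cone (hΘ : ‖Θ‖ = 1) {h : Euc n → ℝ} (hh : IsHomogSmooth 1 h)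
    (hv : h Θ = 0) (hcrit : fderiv ℝ h Θ = 0)
    (hneg : ∀ v : Euc n, ⟪Θ, v⟫ = 0 → v ≠ 0 → iteratedFDeriv ℝ 2 h Θ ![v, v] < 0) :
    ∃ δ > 0, ∀ (d : ℝ) (c : Euc n → ℂ), 1 ≤ d → IsHomogSmooth d c → c 0 = 0 →
      SupportedInCone Θ δ c → ∀ g : 𝓢(Euc n, ℂ),
      Tendsto (fun lam : ℝ =>
        ((lam ^ ((Module.finrank ℝ ((ℝ ∙ Θ)ᗮ : Submodule ℝ (Euc n)) : ℝ) / 2) : ℝ) : ℂ) *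
          ∫ ξ, c ξ * g ξ * oscFactor h lam ξ) atTop
        (𝓝 (∫ z, c Θ *
          rayFourier (d + Module.finrank ℝ ((ℝ ∙ Θ)ᗮ : Submodule ℝ (Euc n))) g Θ
            (-halfQuadForm (-tangentHessian h Θ) z))) := by
  set W : Submodule ℝ (Euc n) := (ℝ ∙ Θ)ᗮ with hW
  set m := Module.finrank ℝ W
  have hΘ0 : Θ ≠ 0 := fun h => by simp [h] at hΘ
  set Q := halfQuadForm (-tangentHessian h Θ) with hQ
  obtain ⟨a, ha, hQa⟩ := exists_le_halfQuadForm
    (posDef_neg_tangentHessian (hh.contDiffAt hΘ0) hneg)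
  set J : Euc m → Euc n := fun z => (orthCoord Θ z : Euc n) with hJ
  have hJn : ∀ z, ‖J z‖ = ‖z‖ := fun z => (orthCoord Θ).norm_map z
  have hJc : Continuous J := continuous_subtype_val.comp (orthCoord Θ).continuous
  have hJs : ∀ (s : ℝ) z, J (s • z) = s • J z := fun s z => by simp [hJ]
  have hQs : ∀ (s : ℝ) z, Q (s • z) = s ^ 2 * Q z := by
    intro r x
    simp only [hQ, halfQuadForm, WithLp.ofLp_smul, Matrix.mulVec_smul, dotProduct_smul,
      smul_dotProduct, smul_eq_mul]
    ring
  have htaylor : ∀ ε > 0, ∃ δ > 0, ∀ z : Euc m, ‖z‖ ≤ δ → |h (Θ + J z) + Q z| ≤ ε * ‖z‖ ^ 2 := by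
    intro ε hε
    obtain ⟨δ, hδ, hd⟩ := taylor_two_of_critical (hh.contDiffAt hΘ0) hv hcrit hε
    refine ⟨δ, hδ, fun z hz => ?_⟩
    have := hd (J z) (by rwa [hJn])
    rw [hessian_orthCoord, hJn] at this
    convert this using 2
    ring
  -- This `δ` is the aperture of the cone. The Taylor error is at most half of the lower bound `a
  -- ‖z‖²` of `Q`, so `-h (Θ + J z) ≥ (a / 2) ‖z‖²` on the support of the amplitude.
  obtain ⟨δ, hδ, hlow⟩ := htaylor (a / 2) (by positivity)
  refine ⟨δ, hδ, fun d c hd hc h0 hsupp g => ?_⟩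
  have hp : ((m + 1 : ℕ) : ℝ) ≤ d + m := by push_cast; linarith
  have hp0 : 0 ≤ d + m := by positivity
  -- Decay of order `m + 1` is available because `d ≥ 1`, and suffices because `(1 + ‖z‖²) ^ (-(m +
  -- 1))` is integrable on an `m`-dimensional space. On the cone `‖Θ + y‖ ≤ 1 + δ`.
  obtain ⟨CF, hCF0, hCF⟩ := rayFourier_decay (1 + δ) (m + 1) hp g
  have hcc : Continuous fun z : Euc m => c (Θ + J z) :=
    (hc.continuous_comp_add_orth hΘ).comp (orthCoord Θ).continuous
  have hhc : Continuous fun z : Euc m => h (Θ + J z) :=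
    (hh.continuous_comp_add_orth hΘ).comp (orthCoord Θ).continuous
  have hone : ∀ z, 1 ≤ ‖Θ + J z‖ := fun z => one_le_norm_add_orth hΘ _
  have hzle : ∀ z, c (Θ + J z) ≠ 0 → ‖z‖ ≤ δ := by
    intro z hz
    rw [← (orthCoord Θ).norm_map z]
    exact hsupp.norm_le hΘ hδ.le hz
  obtain ⟨Cc, hCc⟩ : ∃ Cc, ∀ z, ‖c (Θ + J z)‖ ≤ Cc := by
    obtain ⟨C, hC⟩ := (isCompact_closedBall (0 : Euc m) δ).exists_bound_of_continuousOn
      hcc.continuousOn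
    refine ⟨max C 0, fun z => ?_⟩
    by_cases hz : c (Θ + J z) = 0
    · rw [hz, norm_zero]
      exact le_max_right _ _
    · exact (hC z (mem_closedBall_zero_iff.mpr (hzle z hz))).trans (le_max_left _ _)
  have hCc0 : 0 ≤ Cc := (norm_nonneg _).trans (hCc 0)
  let G : ℝ → Euc m → ℂ := fun lam z =>
    c (Θ + J z) * rayFourier (d + m) g (Θ + J z) (lam * h (Θ + J z))
  -- The substitution `y = lam ^ (-1/2) z`, whose Jacobian is the prefactor.
  have hmain : ∀ lam : ℝ, 0 < lam → ((lam ^ ((m : ℝ) / 2) : ℝ) : ℂ) *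
      ∫ ξ, c ξ * g ξ * oscFactor h lam ξ = ∫ z, G lam ((Real.sqrt lam)⁻¹ • z) := by
    intro lam hlam
    have hsq : 0 < Real.sqrt lam := Real.sqrt_pos.mpr hlam
    rw [integral_cone_eq hΘ hh hc h0 (by linarith) hδ.le hsupp g lam,
      ← (orthCoord Θ).measurePreserving.integral_comp
        (orthCoord Θ).toHomeomorph.measurableEmbedding,
      Measure.integral_comp_smul_of_nonneg _ _ _ (hR := (inv_pos.mpr hsq).le),
      finrank_euclideanSpace_fin, Complex.real_smul]
    congr 2
    rw [inv_pow, inv_inv, Real.sqrt_eq_rpow, ← Real.rpow_mul_natCast hlam.le]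
    congr 1
    ring
  refine (tendsto_congr' ?_).mpr (tendsto_integral_filter_of_dominated_convergence
    (F := fun lam z => G lam ((Real.sqrt lam)⁻¹ • z))
    (fun z => Cc * (CF * ((min 1 (a / 2)) ^ (m + 1))⁻¹) *
      (1 + ‖z‖ ^ 2) ^ (-(2 * ((m : ℝ) + 1)) / 2)) ?_ ?_ ?_ ?_)
  · filter_upwards [eventually_gt_atTop 0] with lam hlam
    exact hmain lam hlam
  · refine Eventually.of_forall fun lam => Continuous.aestronglyMeasurable ?_
    have hray : Continuous fun z => rayFourier (d + m) g (Θ + J z) (lam * h (Θ + J z)) :=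
      (continuousOn_rayFourier hp0 g).comp_continuous
        (f := fun z => (Θ + J z, lam * h (Θ + J z)))
        ((continuous_const.add hJc).prodMk (continuous_const.mul hhc)) fun z => hone z
    exact (hcc.mul hray).comp (continuous_const_smul _)
  · filter_upwards [eventually_gt_atTop 0] with lam hlam
    refine Eventually.of_forall fun z => ?_
    have hmin : 0 < min 1 (a / 2) := by positivity
    set w := (Real.sqrt lam)⁻¹ • z with hw
    have hwn : lam * ‖w‖ ^ 2 = ‖z‖ ^ 2 := by
      have hsq : 0 < Real.sqrt lam := Real.sqrt_pos.mpr hlam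
      rw [hw, norm_smul, norm_inv, Real.norm_of_nonneg hsq.le, mul_pow, inv_pow,
        Real.sq_sqrt hlam.le]
      field_simp
    by_cases hcw : c (Θ + J w) = 0
    · simp only [G, hcw, zero_mul, norm_zero]
      positivity
    · have hwδ := hzle w hcw
      have e1 := hCF (Θ + J w) (hone w)
        ((norm_add_le _ _).trans (by rw [hΘ, hJn]; linarith)) (lam * h (Θ + J w))
      -- After the rescaling the argument of the ray integral is at least of size `‖z‖²`, uniformly
      -- in `lam`; its decay then gives the dominating function.
      have e2 : a / 2 * ‖z‖ ^ 2 ≤ |lam * h (Θ + J w)| := by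
        have f1 := hlow w hwδ
        have f2 := hQa w
        have f3 : h (Θ + J w) ≤ -(a / 2 * ‖w‖ ^ 2) := by
          have := (abs_le.mp f1).2
          linarith
        rw [abs_mul, abs_of_pos hlam, ← hwn]
        have f4 : a / 2 * ‖w‖ ^ 2 ≤ |h (Θ + J w)| := by
          have := neg_abs_le (h (Θ + J w))
          linarith
        nlinarith
      have e3 : min 1 (a / 2) * (1 + ‖z‖ ^ 2) ≤ 1 + |lam * h (Θ + J w)| := by
        have g1 := min_le_left 1 (a / 2)
        have g2 := min_le_right 1 (a / 2)
        nlinarith [sq_nonneg ‖z‖]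
      simp only [G]
      rw [norm_mul, mul_assoc]
      gcongr
      · exact hCc w
      · refine e1.trans ?_
        rw [mul_assoc]
        gcongr
        have e4 : (1 + ‖z‖ ^ 2) ^ (-(2 * ((m : ℝ) + 1)) / 2) = ((1 + ‖z‖ ^ 2) ^ (m + 1))⁻¹ := by
          rw [show -(2 * ((m : ℝ) + 1)) / 2 = -((m + 1 : ℕ) : ℝ) by push_cast; ring,
            Real.rpow_neg (by positivity), Real.rpow_natCast]
        rw [e4, ← mul_inv, ← mul_pow]
        gcongr
  · refine (integrable_rpow_neg_one_add_norm_sq ?_).const_mul _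
    rw [finrank_euclideanSpace_fin]
    have : (0 : ℝ) ≤ m := m.cast_nonneg
    linarith
  · refine Eventually.of_forall fun z => ?_
    have hs : Tendsto (fun lam : ℝ => (Real.sqrt lam)⁻¹ • z) atTop (𝓝 0) := by
      have := (Real.tendsto_sqrt_atTop.inv_tendsto_atTop).smul_const z
      simpa using this
    have hJ0 : J 0 = 0 := by simp [hJ]
    have t1 : Tendsto (fun lam : ℝ => Θ + J ((Real.sqrt lam)⁻¹ • z)) atTop (𝓝 Θ) := by
      have hJΘ : Continuous fun z => Θ + J z := continuous_const.add hJc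
      have hlim := hJΘ.tendsto 0
      rw [hJ0, add_zero] at hlim
      exact hlim.comp hs
    have t2 : Tendsto (fun lam : ℝ => lam * h (Θ + J ((Real.sqrt lam)⁻¹ • z))) atTop
        (𝓝 (-Q z)) := by
      rw [Metric.tendsto_nhds]
      intro ε hε
      -- The relative error is chosen so that, after multiplication by `lam * ‖w‖² = ‖z‖²`, less
      -- than `ε` remains even when `z = 0`.
      obtain ⟨δ', hδ', hd'⟩ := htaylor (ε / (2 * (‖z‖ ^ 2 + 1))) (by positivity)
      have hsmall := hs.eventually (Metric.closedBall_mem_nhds 0 hδ')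
      filter_upwards [hsmall, eventually_gt_atTop 0] with lam hl hlam
      have hw := hd' _ (mem_closedBall_zero_iff.mp hl)
      have hsq : 0 < Real.sqrt lam := Real.sqrt_pos.mpr hlam
      rw [hQs, norm_smul, mul_pow, norm_inv, Real.norm_of_nonneg hsq.le, inv_pow,
        Real.sq_sqrt hlam.le] at hw
      rw [Real.dist_eq, sub_neg_eq_add]
      have f1 : lam * h (Θ + J ((Real.sqrt lam)⁻¹ • z)) + Q z =
          lam * (h (Θ + J ((Real.sqrt lam)⁻¹ • z)) + lam⁻¹ * Q z) := by
        field_simp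
      rw [f1, abs_mul, abs_of_pos hlam]
      calc lam * |h (Θ + J ((Real.sqrt lam)⁻¹ • z)) + lam⁻¹ * Q z|
          ≤ lam * (ε / (2 * (‖z‖ ^ 2 + 1)) * (lam⁻¹ * ‖z‖ ^ 2)) := by gcongr
        _ = ε * (‖z‖ ^ 2 / (2 * (‖z‖ ^ 2 + 1))) := by field_simp
        _ < ε * 1 := by
          gcongr
          rw [div_lt_one (by positivity)]
          nlinarith [sq_nonneg ‖z‖]
        _ = ε := mul_one ε
    have hcΘ : ContinuousAt c Θ := (hc.contDiffAt hΘ0).continuousAt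
    refine (hcΘ.tendsto.comp t1).mul ?_
    exact tendsto_rayFourier hp0 g hΘ.ge t1 t2 (fun lam => hone _)

end StationaryRay

/-! ### The Fresnel integral transverse to a ray -/

section GaussianRay

variable {m : ℕ} {E : Type*} [NormedAddCommGroup E] [InnerProductSpace ℝ E]
  [FiniteDimensional ℝ E] [MeasurableSpace E] [BorelSpace E]

lemma norm_cpow_ofReal_div_le {b : ℂ} {r : ℝ} (hr : 0 < r) (hb : r ≤ ‖b‖) :
    ‖(2 * Real.pi / b) ^ ((m : ℂ) / 2)‖ ≤ (2 * Real.pi / r) ^ ((m : ℝ) / 2) := by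
  have h1 : ((m : ℂ) / 2) = (((m : ℝ) / 2 : ℝ) : ℂ) := by push_cast; ring
  have h2 : ‖(2 * Real.pi / b : ℂ)‖ = 2 * Real.pi / ‖b‖ := by
    rw [norm_div, norm_mul, Complex.norm_real, Real.norm_of_nonneg Real.pi_pos.le]
    simp
  rw [h1, Complex.norm_cpow_real, h2]
  have := Real.pi_pos
  gcongr

lemma Complex.ofReal_mul_cpow {r : ℝ} (hr : 0 < r) {z : ℂ} (hz : z ≠ 0) (s : ℂ) :
    ((r : ℂ) * z) ^ s = (r : ℂ) ^ s * z ^ s := by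
  have hr' : (r : ℂ) ≠ 0 := by exact_mod_cast hr.ne'
  rw [Complex.cpow_def_of_ne_zero (mul_ne_zero hr' hz), Complex.cpow_def_of_ne_zero hr',
    Complex.cpow_def_of_ne_zero hz, Complex.log_ofReal_mul hr hz, Complex.ofReal_log hr.le,
    add_mul, Complex.exp_add]

/-- The phase `e^{-iπm/4}` of stationary phase arises here, from `1/i = -i` and `log (-i) = -iπ/2`.
-/
lemma two_pi_div_I_mul_cpow {r : ℝ} (hr : 0 < r) :
    (2 * Real.pi / (Complex.I * r) : ℂ) ^ ((m : ℂ) / 2) =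
      (((2 * Real.pi / r) ^ ((m : ℝ) / 2) : ℝ) : ℂ) *
        Complex.exp (-(Complex.I * Real.pi * m / 4)) := by
  have hpos : 0 < 2 * Real.pi / r := by positivity
  have h1 : (2 * Real.pi / (Complex.I * r) : ℂ) = ((2 * Real.pi / r : ℝ) : ℂ) * (-Complex.I) := by
    push_cast
    have : (r : ℂ) ≠ 0 := by exact_mod_cast hr.ne'
    field_simp
    rw [Complex.I_sq]
    ring
  rw [h1, Complex.ofReal_mul_cpow hpos (by simp)]
  congr 1
  · rw [Complex.ofReal_cpow hpos.le]
    push_cast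
    rfl
  · rw [Complex.cpow_def_of_ne_zero (by simp), Complex.log_neg_I]
    congr 1
    ring

/-- The Fourier transform along a ray, integrated over a nondegenerate quadratic phase. -/
lemma integral_rayFourier_halfQuadForm {M : Matrix (Fin m) (Fin m) ℝ} (hM : M.PosDef) {p : ℝ}
    (hp : ((m + 1 : ℕ) : ℝ) ≤ p) (g : 𝓢(E, ℂ)) {θ : E} (hθ : 1 ≤ ‖θ‖) :
    ∫ z, rayFourier p g θ (-halfQuadForm M z) =
      ((((2 * Real.pi) ^ ((m : ℝ) / 2) / Real.sqrt M.det : ℝ) : ℂ) *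
        Complex.exp (-(Complex.I * Real.pi * m / 4))) *
        ∫ r in Ioi (0 : ℝ), ((r ^ (p - (m : ℝ) / 2) : ℝ) : ℂ) * g (r • θ) := by
  set Q := halfQuadForm M with hQ
  have hm0 : (0 : ℝ) ≤ m := m.cast_nonneg
  have hpm : (m : ℝ) + 1 ≤ p := by push_cast at hp; exact hp
  have hp0 : 0 ≤ p := by linarith
  obtain ⟨a, ha, hQa⟩ := exists_le_halfQuadForm hM
  have hQ0 : ∀ z, 0 ≤ Q z := fun z => (by positivity : 0 ≤ a * ‖z‖ ^ 2).trans (hQa z)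
  have hQc : Continuous Q := continuous_halfQuadForm M
  obtain ⟨CF, hCF0, hCF⟩ := rayFourier_decay ‖θ‖ (m + 1) hp g
  have hray : Continuous fun z => rayFourier p g θ (-Q z) :=
    (continuousOn_rayFourier hp0 g).comp_continuous (f := fun z => (θ, -Q z))
      (continuous_const.prodMk hQc.neg) fun _ => hθ
  let D : ℝ → ℝ → ℂ := fun δ r => (2 * Real.pi / (δ + Complex.I * r)) ^ ((m : ℂ) / 2) /
    (Real.sqrt M.det : ℝ)
  -- The factor `e^{-δQ}` provides absolute convergence in the pair `(z, r)`. After Fubini the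
  -- integral over `z` is a Gaussian with parameter `δ + i r`; the limit `δ → 0⁺` is taken on both
  -- sides afterwards.
  have hfub : ∀ δ : ℝ, 0 < δ → ∫ z, Complex.exp (-δ * Q z) * rayFourier p g θ (-Q z) =
      ∫ r in Ioi (0 : ℝ), ((r ^ p : ℝ) : ℂ) * g (r • θ) * D δ r := by
    intro δ hδ
    let K : Euc m → ℝ → ℂ := fun z r => Complex.exp (-δ * Q z) *
      (((r ^ p : ℝ) : ℂ) * g (r • θ) * Complex.exp (Complex.I * (r * (-Q z) : ℝ)))
    have hb : 0 < (δ : ℂ).re := by simpa using hδ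
    have hint1 := (gaussian_quadForm_aux hM hb).1
    have hint2 := integrableOn_rayIntegrand hp0 g hθ 0
    have hK : Integrable (Function.uncurry K)
        ((volume : Measure (Euc m)).prod (volume.restrict (Ioi (0 : ℝ)))) := by
      refine (hint1.norm.mul_prod hint2.norm).mono' ?_ (Eventually.of_forall fun q => ?_)
      · have h1 : Continuous fun r : ℝ => r ^ p := continuous_id.rpow_const fun _ => Or.inr hp0
        have h1' : Continuous fun q : Euc m × ℝ => q.2 ^ p := h1.comp continuous_snd
        have h2 := g.continuous
        have : Continuous (Function.uncurry K) := by
          simp only [K, Function.uncurry_def]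
          fun_prop
        exact this.aestronglyMeasurable
      · simp only [K, Function.uncurry_def]
        rw [norm_mul, norm_mul _ (Complex.exp _), norm_mul _ (Complex.exp _),
          norm_cexp_I_mul_real, norm_cexp_I_mul_real]
    have h1 : ∀ z, Complex.exp (-δ * Q z) * rayFourier p g θ (-Q z) =
        ∫ r in Ioi (0 : ℝ), K z r := fun z => by
      simp only [K, rayFourier]
      rw [integral_const_mul]
    simp_rw [h1]
    rw [integral_integral_swap hK]
    refine integral_congr_ae (Eventually.of_forall fun r => ?_)
    have hb' : 0 < ((δ : ℂ) + Complex.I * r).re := by simpa using hδ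
    simp only [D]
    rw [← (gaussian_quadForm_aux hM hb').2, ← integral_const_mul]
    refine integral_congr_ae (Eventually.of_forall fun z => ?_)
    simp only [K, ← hQ]
    rw [mul_comm, mul_assoc, ← Complex.exp_add]
    congr 2
    push_cast
    ring
  have hleft : Tendsto (fun δ : ℝ => ∫ z, Complex.exp (-δ * Q z) * rayFourier p g θ (-Q z))
      (𝓝[>] 0) (𝓝 (∫ z, rayFourier p g θ (-Q z))) := by
    refine tendsto_integral_filter_of_dominated_convergence
      (fun z => CF * ((min 1 a) ^ (m + 1))⁻¹ *
        (1 + ‖z‖ ^ 2) ^ (-(2 * ((m : ℝ) + 1)) / 2)) ?_ ?_ ?_ ?_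
    · refine Eventually.of_forall fun δ => Continuous.aestronglyMeasurable ?_
      fun_prop
    · filter_upwards [self_mem_nhdsWithin] with δ hδ
      refine Eventually.of_forall fun z => ?_
      have hδ' : 0 < δ := hδ
      have hmin : 0 < min 1 a := by positivity
      have e1 : ‖Complex.exp (-δ * Q z)‖ ≤ 1 := by
        rw [Complex.norm_exp]
        have := mul_nonneg hδ'.le (hQ0 z)
        simpa using this
      have e2 : min 1 a * (1 + ‖z‖ ^ 2) ≤ 1 + |-Q z| := by
        rw [abs_neg, abs_of_nonneg (hQ0 z)]
        have g1 := min_le_left 1 a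
        have g2 := min_le_right 1 a
        have g3 := hQa z
        nlinarith [sq_nonneg ‖z‖]
      have e4 : (1 + ‖z‖ ^ 2) ^ (-(2 * ((m : ℝ) + 1)) / 2) = ((1 + ‖z‖ ^ 2) ^ (m + 1))⁻¹ := by
        rw [show -(2 * ((m : ℝ) + 1)) / 2 = -((m + 1 : ℕ) : ℝ) by push_cast; ring,
          Real.rpow_neg (by positivity), Real.rpow_natCast]
      rw [norm_mul]
      refine (mul_le_of_le_one_left (norm_nonneg _) e1).trans ((hCF θ hθ le_rfl _).trans ?_)
      rw [e4, mul_assoc, ← mul_inv, ← mul_pow]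
      gcongr
    · refine (integrable_rpow_neg_one_add_norm_sq ?_).const_mul _
      rw [finrank_euclideanSpace_fin]
      linarith
    · refine Eventually.of_forall fun z => ?_
      have : Continuous fun δ : ℝ => Complex.exp (-δ * Q z) * rayFourier p g θ (-Q z) := by
        fun_prop
      have h2 := this.tendsto 0
      simp only [Complex.ofReal_zero, neg_zero, zero_mul, Complex.exp_zero, one_mul] at h2
      exact h2.mono_left nhdsWithin_le_nhds
  have hpw : ∀ r : ℝ, 0 < r → Tendsto (fun δ : ℝ => D δ r) (𝓝[>] 0)
      (𝓝 (D 0 r)) := by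
    intro r hr
    have hr' : (r : ℂ) ≠ 0 := by exact_mod_cast hr.ne'
    refine Tendsto.mono_left ?_ nhdsWithin_le_nhds
    have hc : ContinuousAt (fun δ : ℝ => (2 * Real.pi / (δ + Complex.I * r) : ℂ)) 0 := by
      refine ContinuousAt.div (by fun_prop) (by fun_prop) ?_
      simp [hr']
    -- At `δ = 0` the base of the power lies on the negative imaginary axis, away from the branch
    -- cut, so the principal power is continuous there.
    have hs : (2 * Real.pi / (((0 : ℝ) : ℂ) + Complex.I * r) : ℂ) ∈ Complex.slitPlane := by
      refine Or.inr ?_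
      have : (2 * Real.pi / (((0 : ℝ) : ℂ) + Complex.I * r) : ℂ) =
          ((2 * Real.pi / r : ℝ) : ℂ) * (-Complex.I) := by
        push_cast
        field_simp
        simp only [zero_add]
        field_simp
        rw [Complex.I_sq]
        ring
      rw [this, Complex.im_ofReal_mul]
      have : 2 * Real.pi / r ≠ 0 := by positivity
      simpa using this
    exact ((hc.cpow continuousAt_const hs).div_const _).tendsto
  -- Since `r ≤ |δ + i r|`, the Gaussian factor is at most a constant times `r ^ (-m/2)` for every
  -- `δ`; the product with `r ^ p` stays integrable because `p ≥ m + 1`.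
  have hright : Tendsto (fun δ : ℝ => ∫ r in Ioi (0 : ℝ), ((r ^ p : ℝ) : ℂ) * g (r • θ) * D δ r)
      (𝓝[>] 0) (𝓝 (∫ r in Ioi (0 : ℝ), ((r ^ p : ℝ) : ℂ) * g (r • θ) * D 0 r)) := by
    have hint := (integrableOn_rayIntegrand (d := p - (m : ℝ) / 2) (by linarith) g hθ 0).norm
    refine tendsto_integral_filter_of_dominated_convergence
      (fun r => ‖((r ^ (p - (m : ℝ) / 2) : ℝ) : ℂ) * g (r • θ) *
        Complex.exp (Complex.I * (r * 0 : ℝ))‖ * ((2 * Real.pi) ^ ((m : ℝ) / 2) /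
          Real.sqrt M.det)) ?_ ?_ (hint.mul_const _) ?_
    · refine Eventually.of_forall fun δ => Measurable.aestronglyMeasurable ?_
      have := g.continuous.measurable
      simp only [D]
      have h3 : Measurable fun r : ℝ => r • θ := measurable_id.smul_const θ
      have h4 : Measurable fun r : ℝ => g (r • θ) := this.comp h3
      fun_prop
    · filter_upwards [self_mem_nhdsWithin] with δ hδ
      filter_upwards [ae_restrict_mem measurableSet_Ioi] with r hr
      have hr' : 0 < r := hr
      have hle : r ≤ ‖(δ + Complex.I * r : ℂ)‖ := by
        have := Complex.abs_im_le_norm (δ + Complex.I * r : ℂ)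
        simp only [Complex.add_im, Complex.ofReal_im, Complex.mul_im, Complex.I_re, zero_mul,
          Complex.I_im, one_mul, Complex.ofReal_re, zero_add] at this
        exact (le_abs_self r).trans this
      have h5 := norm_cpow_ofReal_div_le (m := m) hr' hle
      simp only [D]
      rw [norm_mul, norm_div, norm_mul _ (Complex.exp _), norm_cexp_I_mul_real, mul_one,
        norm_mul, norm_mul, Complex.norm_real, Complex.norm_real, Complex.norm_real,
        Real.norm_of_nonneg (Real.sqrt_nonneg _),
        Real.norm_of_nonneg (Real.rpow_nonneg hr'.le _),
        Real.norm_of_nonneg (Real.rpow_nonneg hr'.le _)]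
      calc r ^ p * ‖g (r • θ)‖ * (‖(2 * Real.pi / (δ + Complex.I * r) : ℂ) ^ ((m : ℂ) / 2)‖ /
            Real.sqrt M.det)
          ≤ r ^ p * ‖g (r • θ)‖ * ((2 * Real.pi / r) ^ ((m : ℝ) / 2) / Real.sqrt M.det) := by
            gcongr
        _ = _ := by
            rw [Real.div_rpow (by positivity) hr'.le, Real.rpow_sub hr']
            ring
    · filter_upwards [ae_restrict_mem measurableSet_Ioi] with r hr
      exact (hpw r hr).const_mul _
  have hev : (fun δ : ℝ => ∫ z, Complex.exp (-δ * Q z) * rayFourier p g θ (-Q z)) =ᶠ[𝓝[>] 0]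
      fun δ : ℝ => ∫ r in Ioi (0 : ℝ), ((r ^ p : ℝ) : ℂ) * g (r • θ) * D δ r := by
    filter_upwards [self_mem_nhdsWithin] with δ hδ
    exact hfub δ hδ
  rw [tendsto_nhds_unique (hleft.congr' hev) hright, ← integral_const_mul]
  refine setIntegral_congr_fun measurableSet_Ioi fun r hr => ?_
  have hr' : 0 < r := hr
  simp only [D]
  rw [Complex.ofReal_zero, zero_add, two_pi_div_I_mul_cpow hr', Real.div_rpow (by positivity) hr'.le,
    Real.rpow_sub hr']
  push_cast
  ring

end GaussianRay

/-! ### Conical cutoff functions -/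

section ConeCutoff

variable {E : Type*} [NormedAddCommGroup E] [InnerProductSpace ℝ E]

/-- A homogeneous cutoff function to a cone around a ray. -/
lemma exists_cone_cutoff {Θ : E} (hΘ : ‖Θ‖ = 1) {δ : ℝ} (hδ : 0 < δ) :
    ∃ χ : E → ℂ, IsHomogSmooth 0 χ ∧ SupportedInCone Θ δ χ ∧
      ∀ r : ℝ, 0 < r → χ =ᶠ[𝓝 (r • Θ)] 1 := by
  have h1 : 1 < Real.sqrt (1 + δ ^ 2) := by
    rw [Real.lt_sqrt zero_le_one]
    nlinarith
  -- `a` is the cosine of the opening angle, whose tangent is `δ`. The cutoff is a smooth step in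
  -- the cosine `⟪Θ, ξ⟫ / ‖ξ‖`: zero up to `a`, one from the midpoint `b` of `a` and `1` onwards.
  set a := (Real.sqrt (1 + δ ^ 2))⁻¹ with ha
  have ha0 : 0 < a := by positivity
  have ha1 : a < 1 := inv_lt_one_of_one_lt₀ h1
  have ha2 : a ^ 2 * (1 + δ ^ 2) = 1 := by
    rw [ha, inv_pow, Real.sq_sqrt (by positivity), inv_mul_cancel₀ (by positivity)]
  set b := (a + 1) / 2 with hb
  have hab : 0 < b - a := by rw [hb]; linarith
  have hcont : ∀ ξ : E, ξ ≠ 0 → ContDiffAt ℝ ∞ (fun ξ : E => ⟪Θ, ξ⟫ / ‖ξ‖) ξ := fun ξ hξ =>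
    (contDiffAt_const.inner ℝ contDiffAt_id).div (contDiffAt_norm ℝ hξ) (norm_ne_zero_iff.mpr hξ)
  refine ⟨fun ξ => (Real.smoothTransition ((⟪Θ, ξ⟫ / ‖ξ‖ - a) / (b - a)) : ℝ), ?_, ?_, ?_⟩
  · refine IsHomogSmooth.of_contDiffAt (fun ξ hξ => ?_) fun r hr ξ hξ => ?_
    · exact Complex.ofRealCLM.contDiff.contDiffAt.comp ξ
        (Real.smoothTransition.contDiffAt.comp ξ
          (((hcont ξ hξ).sub contDiffAt_const).div_const _))
    · have : ⟪Θ, r • ξ⟫ / ‖r • ξ‖ = ⟪Θ, ξ⟫ / ‖ξ‖ := by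
        rw [real_inner_smul_right, norm_smul, Real.norm_of_nonneg hr.le]
        exact mul_div_mul_left _ _ hr.ne'
      simp only [this, Real.rpow_zero, one_smul]
  · intro ξ hξ
    have h2 : a < ⟪Θ, ξ⟫ / ‖ξ‖ := by
      by_contra hle
      apply hξ
      rw [Complex.ofReal_eq_zero]
      exact Real.smoothTransition.zero_of_nonpos
        (div_nonpos_of_nonpos_of_nonneg (by linarith) hab.le)
    have hn : 0 < ‖ξ‖ := by
      rcases (norm_nonneg ξ).eq_or_lt with h0 | h0
      · rw [← h0, div_zero] at h2
        linarith
      · exact h0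
    rw [lt_div_iff₀ hn] at h2
    refine ⟨lt_trans (by positivity) h2, ?_⟩
    have h3 : (a * ‖ξ‖) ^ 2 ≤ ⟪Θ, ξ⟫ ^ 2 := by gcongr
    calc ‖ξ‖ ^ 2 = (1 + δ ^ 2) * (a * ‖ξ‖) ^ 2 := by
          rw [mul_pow, ← mul_assoc, mul_comm (1 + δ ^ 2), ha2, one_mul]
      _ ≤ _ := by gcongr
  · intro r hr
    have hr0 : r • Θ ≠ 0 := smul_ne_zero hr.ne' fun h => by simp [h] at hΘ
    have hval : ⟪Θ, r • Θ⟫ / ‖r • Θ‖ = 1 := by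
      rw [real_inner_smul_right, real_inner_self_eq_norm_sq, norm_smul, hΘ,
        Real.norm_of_nonneg hr.le]
      field_simp
    have hev := (hcont _ hr0).continuousAt.eventually
      (lt_mem_nhds (show b < ⟪Θ, r • Θ⟫ / ‖r • Θ‖ by rw [hval, hb]; linarith))
    filter_upwards [hev] with ξ hξ
    simp only [Pi.one_apply, Complex.ofReal_eq_one]
    refine Real.smoothTransition.one_of_one_le ?_
    rw [le_div_iff₀ hab]
    linarith

lemma SupportedInCone.eventually_eq_zero {Θ : E} (hΘ : ‖Θ‖ = 1) {δ : ℝ} {χ : E → ℂ}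
    (hχ : SupportedInCone Θ δ χ) {r : ℝ} (hr : 0 < r) : χ =ᶠ[𝓝 (-(r • Θ))] 0 := by
  have hc : ContinuousAt (fun ξ : E => ⟪Θ, ξ⟫) (-(r • Θ)) := by fun_prop
  have hlt : ⟪Θ, -(r • Θ)⟫ < 0 := by
    rw [inner_neg_right, real_inner_smul_right, real_inner_self_eq_norm_sq, hΘ]
    linarith
  filter_upwards [hc.eventually (gt_mem_nhds hlt)] with ξ hξ
  by_contra hne
  exact absurd (hχ ξ hne).1 hξ.le.not_gt

end ConeCutoff

/-! ### Stationary phase with a pair of opposite critical rays -/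

section StationaryPhase

variable {n : ℕ} {Θ : Euc n}

/-- The constant in the stationary phase formula at a critical ray where the Hessian is negative
definite on the orthogonal hyperplane. -/
def stationaryFactor (h : Euc n → ℝ) (Θ : Euc n) : ℂ :=
  (((2 * Real.pi) ^ ((Module.finrank ℝ ((ℝ ∙ Θ)ᗮ : Submodule ℝ (Euc n)) : ℝ) / 2) /
      Real.sqrt (-tangentHessian h Θ).det : ℝ) : ℂ) *
    Complex.exp (-(Complex.I * Real.pi *
      (Module.finrank ℝ ((ℝ ∙ Θ)ᗮ : Submodule ℝ (Euc n)) : ℕ) / 4))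

lemma tendsto_integral_supportedInCone (hΘ : ‖Θ‖ = 1) {h : Euc n → ℝ} (hh : IsHomogSmooth 1 h)
    (hv : h Θ = 0) (hcrit : fderiv ℝ h Θ = 0)
    (hneg : ∀ v : Euc n, ⟪Θ, v⟫ = 0 → v ≠ 0 → iteratedFDeriv ℝ 2 h Θ ![v, v] < 0) :
    ∃ δ > 0, ∀ (d : ℝ) (c : Euc n → ℂ), 1 ≤ d → IsHomogSmooth d c → c 0 = 0 →
      SupportedInCone Θ δ c → ∀ g : 𝓢(Euc n, ℂ),
      Tendsto (fun lam : ℝ =>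
        ((lam ^ ((Module.finrank ℝ ((ℝ ∙ Θ)ᗮ : Submodule ℝ (Euc n)) : ℝ) / 2) : ℝ) : ℂ) *
          ∫ ξ, c ξ * g ξ * oscFactor h lam ξ) atTop
        (𝓝 (c Θ * (stationaryFactor h Θ * ∫ r in Ioi (0 : ℝ),
          ((r ^ (d + (Module.finrank ℝ ((ℝ ∙ Θ)ᗮ : Submodule ℝ (Euc n)) : ℝ) / 2) : ℝ) : ℂ) *
            g (r • Θ)))) := by
  obtain ⟨δ, hδ, H⟩ := tendsto_integral_cone hΘ hh hv hcrit hneg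
  refine ⟨δ, hδ, fun d c hd hc h0 hsupp g => ?_⟩
  have hΘ0 : Θ ≠ 0 := fun h => by simp [h] at hΘ
  have := H d c hd hc h0 hsupp g
  rw [integral_const_mul, integral_rayFourier_halfQuadForm
    (posDef_neg_tangentHessian (hh.contDiffAt hΘ0) hneg) (by push_cast; linarith) g hΘ.ge] at this
  rw [show d + (Module.finrank ℝ ((ℝ ∙ Θ)ᗮ : Submodule ℝ (Euc n)) : ℝ) / 2 =
    d + Module.finrank ℝ ((ℝ ∙ Θ)ᗮ : Submodule ℝ (Euc n)) -
      (Module.finrank ℝ ((ℝ ∙ Θ)ᗮ : Submodule ℝ (Euc n)) : ℝ) / 2 by ring]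
  exact this

/-- The function `ξ ↦ conj (g (-ξ))`. -/
def conjNeg (g : 𝓢(Euc n, ℂ)) : 𝓢(Euc n, ℂ) :=
  postcompCLM (𝕜 := ℝ) (Complex.conjCLE : ℂ →L[ℝ] ℂ)
    (compCLMOfContinuousLinearEquiv ℝ (ContinuousLinearEquiv.neg ℝ (M := Euc n)) g)

lemma conjNeg_apply (g : 𝓢(Euc n, ℂ)) (ξ : Euc n) :
    conjNeg g ξ = starRingEnd ℂ (g (-ξ)) := rfl

/-- Conjugation combined with reflection exchanges the phases `h` and `-h(-·)`. This brings the
contribution of the opposite ray, where the Hessian of a locally odd phase has the opposite sign,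
back to the negative definite case. -/
lemma conj_oscFactor_neg (h : Euc n → ℝ) (lam : ℝ) (ξ : Euc n) :
    starRingEnd ℂ (oscFactor (fun ξ => -h (-ξ)) lam ξ) = oscFactor h lam (-ξ) := by
  rw [oscFactor, oscFactor, ← Complex.exp_conj, map_mul, Complex.conj_I, Complex.conj_ofReal]
  congr 1
  push_cast
  ring

/-- The stationary phase formula for phases that are homogeneous of degree one, with one pair of
critical rays in the support of the amplitude. -/
theorem tendsto_integral_homog_osc (hΘ : ‖Θ‖ = 1) {h : Euc n → ℝ} (hh : IsHomogSmooth 1 h)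
    (hv : h Θ = 0) (hcrit : fderiv ℝ h Θ = 0)
    (hneg : ∀ v : Euc n, ⟪Θ, v⟫ = 0 → v ≠ 0 → iteratedFDeriv ℝ 2 h Θ ![v, v] < 0)
    (hodd : (fun ξ => -h (-ξ)) =ᶠ[𝓝 Θ] h) {d : ℝ} {c : Euc n → ℂ}
    (hd : ((Module.finrank ℝ ((ℝ ∙ Θ)ᗮ : Submodule ℝ (Euc n)) + 1 : ℕ) : ℝ) < d)
    (hc : IsHomogSmooth d c) (h0 : c 0 = 0)
    (hsupp : ∀ ξ, ξ ≠ 0 → fderiv ℝ h ξ = 0 → c =ᶠ[𝓝 ξ] 0 ∨ unitDir ξ = Θ ∨ unitDir ξ = -Θ)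
    (g : 𝓢(Euc n, ℂ)) :
    Tendsto (fun lam : ℝ =>
      ((lam ^ ((Module.finrank ℝ ((ℝ ∙ Θ)ᗮ : Submodule ℝ (Euc n)) : ℝ) / 2) : ℝ) : ℂ) *
        ∫ ξ, c ξ * g ξ * oscFactor h lam ξ) atTop
      (𝓝 (c Θ * (stationaryFactor h Θ * ∫ r in Ioi (0 : ℝ),
          ((r ^ (d + (Module.finrank ℝ ((ℝ ∙ Θ)ᗮ : Submodule ℝ (Euc n)) : ℝ) / 2) : ℝ) : ℂ) *
            g (r • Θ)) +
        c (-Θ) * (starRingEnd ℂ (stationaryFactor h Θ) * ∫ r in Ioi (0 : ℝ),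
          ((r ^ (d + (Module.finrank ℝ ((ℝ ∙ Θ)ᗮ : Submodule ℝ (Euc n)) : ℝ) / 2) : ℝ) : ℂ) *
            g (-(r • Θ))))) := by
  set m := Module.finrank ℝ ((ℝ ∙ Θ)ᗮ : Submodule ℝ (Euc n)) with hm
  have : Nontrivial (Euc n) := ⟨Θ, 0, fun h => by simp [h] at hΘ⟩
  have hΘ0 : Θ ≠ 0 := fun h => by simp [h] at hΘ
  have hd1 : 1 ≤ d := by
    push_cast at hd
    have : (0 : ℝ) ≤ m := m.cast_nonneg
    linarith
  set k : Euc n → ℝ := fun ξ => -h (-ξ) with hk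
  have hkh : IsHomogSmooth 1 k := hh.comp_neg.neg
  obtain ⟨δ₁, hδ₁, H₁⟩ := tendsto_integral_supportedInCone hΘ hh hv hcrit hneg
  obtain ⟨δ₂, hδ₂, H₂⟩ := tendsto_integral_supportedInCone hΘ hkh (hodd.eq_of_nhds.trans hv)
    (hodd.fderiv_eq.trans hcrit)
    (fun v hv hv0 => by
      rw [(hodd.iteratedFDeriv ℝ 2).eq_of_nhds]
      exact hneg v hv hv0)
  have hfac : stationaryFactor k Θ = stationaryFactor h Θ := by
    have : tangentHessian k Θ = tangentHessian h Θ := by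
      simp only [tangentHessian, (hodd.iteratedFDeriv ℝ 2).eq_of_nhds]
    simp only [stationaryFactor, this]
  obtain ⟨χ₁, hχ₁, hs₁, he₁⟩ := exists_cone_cutoff hΘ hδ₁
  obtain ⟨χ₂, hχ₂, hs₂, he₂⟩ := exists_cone_cutoff hΘ hδ₂
  have hχ₁Θ : χ₁ Θ = 1 := by simpa using (he₁ 1 one_pos).eq_of_nhds
  have hχ₂Θ : χ₂ Θ = 1 := by simpa using (he₂ 1 one_pos).eq_of_nhds
  -- Partition of the amplitude into a cone around `Θ`, a cone around `-Θ`, and a rest that vanishes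
  -- near every critical point.
  have hc₁ : IsHomogSmooth d fun ξ => χ₁ ξ * c ξ := by simpa using hχ₁.mul hc
  have hc₂ : IsHomogSmooth d fun ξ => χ₂ (-ξ) * c ξ := by simpa using hχ₂.comp_neg.mul hc
  have hχ₃ : IsHomogSmooth 0 fun ξ => 1 - χ₁ ξ - χ₂ (-ξ) := by
    refine ⟨(contDiffOn_const.sub hχ₁.smooth).sub hχ₂.comp_neg.smooth, fun r hr ξ hξ => ?_⟩
    rw [hχ₁.homog r hr ξ hξ, hχ₂.comp_neg.homog r hr ξ hξ]
    simp
  have hc₃ : IsHomogSmooth d fun ξ => (1 - χ₁ ξ - χ₂ (-ξ)) * c ξ := by simpa using hχ₃.mul hc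
  have t₁ := H₁ d _ hd1 hc₁ (by simp [h0]) (fun ξ hξ => hs₁ ξ (left_ne_zero_of_mul hξ)) g
  simp only [hχ₁Θ, one_mul] at t₁
  have hc₂' : IsHomogSmooth d fun ξ => starRingEnd ℂ (χ₂ ξ * c (-ξ)) := by
    have h1 : IsHomogSmooth d fun ξ => χ₂ ξ * c (-ξ) := by simpa using hχ₂.mul hc.comp_neg
    refine ⟨Complex.conjCLE.contDiff.comp_contDiffOn h1.smooth, fun r hr ξ hξ => ?_⟩
    rw [h1.homog r hr ξ hξ, Complex.real_smul, map_mul, Complex.conj_ofReal, Complex.real_smul]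
  -- The ray `-Θ`: the formula at `Θ` is applied to the phase `k` and to the reflected and
  -- conjugated amplitude and Schwartz function; the result is then conjugated. Near `Θ` the phase
  -- `k` coincides with `h`, so the constant is the same.
  have t₂ := H₂ d _ hd1 hc₂' (by simp [h0])
    (fun ξ hξ => hs₂ ξ (fun h => hξ (by simp [h]))) (conjNeg g)
  replace t₂ := (Complex.continuous_conj.tendsto _).comp t₂
  simp only [Function.comp_def, map_mul, Complex.conj_ofReal, hχ₂Θ, one_mul, hfac,
    Complex.conj_conj, ← integral_conj, conjNeg_apply] at t₂
  have t₃ : Tendsto (fun lam : ℝ => ((lam ^ ((m : ℝ) / 2) : ℝ) : ℂ) *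
      ∫ ξ, ((1 - χ₁ ξ - χ₂ (-ξ)) * c ξ) * g ξ * oscFactor h lam ξ) atTop (𝓝 0) := by
    -- Decay of order `m + 1` beats the factor `lam ^ (m / 2)`; this is what the hypothesis `m + 1 <
    -- d` is for.
    obtain ⟨C, hC⟩ := nonstationary_phase hh (m + 1) d _ hd hc₃ (by simp [h0]) (by
      intro ξ hξ hcr
      have hnorm : 0 < ‖ξ‖ := norm_pos_iff.mpr hξ
      have hξu : ‖ξ‖ • unitDir ξ = ξ := by
        rw [unitDir, smul_smul, mul_inv_cancel₀ hnorm.ne', one_smul]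
      rcases hsupp ξ hξ hcr with hz | hu | hu
      · filter_upwards [hz] with ζ hζ
        simp [hζ]
      · rw [hu] at hξu
        have e1 := he₁ _ hnorm
        have e2 := hs₂.eventually_eq_zero hΘ hnorm
        rw [hξu] at e1 e2
        have e3 := (continuous_neg.tendsto ξ).eventually e2
        filter_upwards [e1, e3] with ζ h1 h2
        simp [h1, h2]
      · rw [hu, smul_neg] at hξu
        have e1 := hs₁.eventually_eq_zero hΘ hnorm
        rw [hξu] at e1
        have e2 := he₂ _ hnorm
        rw [← neg_neg (‖ξ‖ • Θ), hξu] at e2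
        have e3 := (continuous_neg.tendsto ξ).eventually e2
        filter_upwards [e1, e3] with ζ h1 h2
        simp [h1, h2]) g
    refine squeeze_zero_norm' (a := fun lam : ℝ => C * lam ^ (-(((m : ℝ) / 2) + 1))) ?_ ?_
    · filter_upwards [eventually_gt_atTop 0] with lam hlam
      rw [norm_mul, Complex.norm_real, Real.norm_of_nonneg (Real.rpow_nonneg hlam.le _)]
      calc lam ^ ((m : ℝ) / 2) * _ ≤ lam ^ ((m : ℝ) / 2) * (C / lam ^ (m + 1)) := by
            gcongr
            exact hC lam hlam
        _ = C * (lam ^ ((m : ℝ) / 2) / lam ^ (m + 1)) := by ring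
        _ = _ := by
            rw [← Real.rpow_natCast lam (m + 1), ← Real.rpow_sub hlam]
            congr 2
            push_cast
            ring
    · have := (tendsto_rpow_neg_atTop (y := (m : ℝ) / 2 + 1) (by positivity)).const_mul C
      simpa using this
  have hsum := (t₁.add t₂).add t₃
  rw [add_zero] at hsum
  refine hsum.congr fun lam => ?_
  have i₁ := integrable_homog_mul_schwartz_mul_osc hh hc₁ (by simp [h0]) (by linarith) g lam
  have i₂ := integrable_homog_mul_schwartz_mul_osc hh hc₂ (by simp [h0]) (by linarith) g lam
  have i₃ := integrable_homog_mul_schwartz_mul_osc hh hc₃ (by simp [h0]) (by linarith) g lam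
  have e₂ : ∫ ξ, (χ₂ (-ξ) * c ξ) * g ξ * oscFactor h lam ξ = ∫ ξ, χ₂ ξ * c (-ξ) * g (-ξ) *
      starRingEnd ℂ (oscFactor k lam ξ) := by
    rw [← integral_neg_eq_self]
    refine integral_congr_ae (Eventually.of_forall fun ξ => ?_)
    simp only [neg_neg, hk, conj_oscFactor_neg]
  have e : ∫ ξ, c ξ * g ξ * oscFactor h lam ξ = (∫ ξ, (χ₁ ξ * c ξ) * g ξ * oscFactor h lam ξ) +
      (∫ ξ, (χ₂ (-ξ) * c ξ) * g ξ * oscFactor h lam ξ) +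
      ∫ ξ, ((1 - χ₁ ξ - χ₂ (-ξ)) * c ξ) * g ξ * oscFactor h lam ξ := by
    rw [← integral_add i₁ i₂]
    refine Eq.trans ?_ (integral_add (i₁.add i₂) i₃)
    refine integral_congr_ae (Eventually.of_forall fun ξ => ?_)
    simp only []
    ring
  rw [e, ← e₂, ← mul_add, ← mul_add]

end StationaryPhase

/-! ### Determinant and signature of the tangential Hessian -/

section Hessian

open scoped Matrix

variable {n : ℕ}

lemma norm_unitDir {ξ : Euc n} (hξ : ξ ≠ 0) : ‖unitDir ξ‖ = 1 :=
  norm_eq_one_of_eq_unitDir hξ rfl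

lemma unitDir_ne_zero {ξ : Euc n} (hξ : ξ ≠ 0) : unitDir ξ ≠ 0 := fun h => by
  have := norm_unitDir hξ
  rw [h, norm_zero] at this
  exact zero_ne_one this

lemma unitDir_of_norm_eq_one {ξ : Euc n} (hξ : ‖ξ‖ = 1) : unitDir ξ = ξ := by
  rw [unitDir, hξ, inv_one, one_smul]

lemma norm_smul_unitDir (ξ : Euc n) : ‖ξ‖ • unitDir ξ = ξ := by
  by_cases h : ξ = 0
  · simp [h]
  · rw [unitDir, smul_smul, mul_inv_cancel₀ (norm_ne_zero_iff.mpr h), one_smul]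

lemma unitDir_smul {r : ℝ} (hr : 0 < r) (ξ : Euc n) : unitDir (r • ξ) = unitDir ξ := by
  rw [unitDir, unitDir, norm_smul, Real.norm_of_nonneg hr.le, smul_smul, mul_inv, mul_comm r⁻¹,
    mul_assoc, inv_mul_cancel₀ hr.ne', mul_one]

lemma unitDir_neg (ξ : Euc n) : unitDir (-ξ) = -unitDir ξ := by
  rw [unitDir, unitDir, norm_neg, smul_neg]

lemma contDiffAt_unitDir {ξ : Euc n} (hξ : ξ ≠ 0) : ContDiffAt ℝ ∞ (unitDir : Euc n → Euc n) ξ :=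
  ((contDiffAt_norm ℝ hξ).inv (norm_ne_zero_iff.mpr hξ)).smul contDiffAt_id

lemma finrank_orthogonal_span_singleton_eq {α : Euc n} (hα : ‖α‖ = 1) :
    Module.finrank ℝ ((ℝ ∙ α)ᗮ : Submodule ℝ (Euc n)) + 1 = n := by
  have h := Submodule.finrank_add_finrank_orthogonal (ℝ ∙ α)
  rw [finrank_span_singleton (fun h => by simp [h] at hα), finrank_euclideanSpace_fin] at h
  omega

lemma matrixSgn_of_posDef {d : ℕ} {A : Matrix (Fin d) (Fin d) ℝ} (hA : A.PosDef) :
    matrixSgn A = d := by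
  have hr := hA.isHermitian.roots_charpoly_eq_eigenvalues
  have hpos : ∀ i, 0 < hA.isHermitian.eigenvalues i := hA.eigenvalues_pos
  rw [matrixSgn, hr, Multiset.filter_eq_self.mpr, Multiset.filter_eq_nil.mpr]
  · simp
  · simp only [Multiset.mem_map]
    rintro _ ⟨i, -, rfl⟩
    exact (hpos i).not_gt
  · simp only [Multiset.mem_map]
    rintro _ ⟨i, -, rfl⟩
    exact hpos i

lemma matrixSgn_of_posDef_neg {d : ℕ} {A : Matrix (Fin d) (Fin d) ℝ} (hA : (-A).PosDef) :
    matrixSgn A = -d := by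
  have hH : A.IsHermitian := by simpa using hA.isHermitian.neg
  have hr := hH.roots_charpoly_eq_eigenvalues
  have hneg : ∀ i, hH.eigenvalues i < 0 := by
    intro i
    have h0 : (hH.eigenvectorBasis i).ofLp ≠ 0 := fun h =>
      hH.eigenvectorBasis.toBasis.ne_zero i (by simpa using h)
    have := hA.dotProduct_mulVec_pos h0
    rw [hH.eigenvalues_eq]
    simpa [Matrix.neg_mulVec] using this
  rw [matrixSgn, hr, Multiset.filter_eq_self (p := fun t => t < 0) |>.mpr,
    Multiset.filter_eq_nil.mpr]
  · simp
  · simp only [Multiset.mem_map]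
    rintro _ ⟨i, -, rfl⟩
    exact (hneg i).not_gt
  · simp only [Multiset.mem_map]
    rintro _ ⟨i, -, rfl⟩
    exact hneg i

/-- The matrix of the Hessian at `α` in an orthonormal basis of a subspace. -/
def subspaceHessian (H : Euc n → ℝ) (α : Euc n) (W : Submodule ℝ (Euc n)) :
    Matrix (Fin (Module.finrank ℝ W)) (Fin (Module.finrank ℝ W)) ℝ :=
  Matrix.of fun i j => iteratedFDeriv ℝ 2 H α
    ![(stdOrthonormalBasis ℝ W i : Euc n), (stdOrthonormalBasis ℝ W j : Euc n)]

lemma tangentHessian_eq_subspaceHessian (H : Euc n → ℝ) (α : Euc n) :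
    tangentHessian H α = subspaceHessian H α (ℝ ∙ α)ᗮ := rfl

/-- The size of the matrix and its basis depend on the subspace, so an equality of subspaces has to
be substituted as a whole. It is needed because `α` and `-α` have the same orthogonal hyperplane. -/
lemma det_subspaceHessian_congr (H : Euc n → ℝ) (α : Euc n) {W W' : Submodule ℝ (Euc n)}
    (h : W = W') : (subspaceHessian H α W).det = (subspaceHessian H α W').det := by
  subst h
  rfl

/-- The operator representing a bilinear form. -/
def bilinOperator {E : Type*} [NormedAddCommGroup E] [InnerProductSpace ℝ E] [CompleteSpace E]
    (A : E →L[ℝ] E →L[ℝ] ℝ) : E →ₗ[ℝ] E where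
  toFun v := (InnerProductSpace.toDual ℝ E).symm (A v)
  map_add' v w := by rw [map_add, map_add]
  map_smul' r v := by rw [map_smul, map_smulₛₗ]; rfl

/-- In an orthonormal basis the matrix of a bilinear form is, up to transposition, the matrix of the
representing operator. Its determinant is therefore independent of the basis. -/
lemma det_bilin_orthonormalBasis {E : Type*} [NormedAddCommGroup E] [InnerProductSpace ℝ E]
    [FiniteDimensional ℝ E] {ι : Type*} [Fintype ι] [DecidableEq ι]
    (b : OrthonormalBasis ι ℝ E) (A : E →L[ℝ] E →L[ℝ] ℝ) :
    (Matrix.of fun i j => A (b i) (b j)).det = LinearMap.det (bilinOperator A) := by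
  rw [← LinearMap.det_toMatrix b.toBasis, ← Matrix.det_transpose]
  congr 1
  ext i j
  rw [LinearMap.toMatrix_apply, OrthonormalBasis.coe_toBasis_repr_apply,
    OrthonormalBasis.repr_apply_apply, real_inner_comm, OrthonormalBasis.coe_toBasis]
  exact (InnerProductSpace.toDual_symm_apply (𝕜 := ℝ) (x := b i) (y := A (b j))).symm

/-- The chosen orthonormal basis of the hyperplane `αᗮ` has no evident regularity in `α`, so
smoothness of the determinant is not visible from its definition. By Euler's identity `α` lies in
the kernel of the full Hessian; adding `α ⊗ α` therefore gives, in a basis adapted to `α`, a block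
matrix with blocks `1` and the tangential Hessian. In the standard basis the entries of the same
form are smooth in `α`. -/
lemma det_subspaceHessian_orthogonal {H : Euc n → ℝ} (hH : IsHomogSmooth 1 H) {α : Euc n}
    (hα : ‖α‖ = 1) : (subspaceHessian H α (ℝ ∙ α)ᗮ).det =
      (Matrix.of fun i j : Fin n => fderiv ℝ (fderiv ℝ H) α (EuclideanSpace.single i 1)
        (EuclideanSpace.single j 1) + α i * α j).det := by
  have hα0 : α ≠ 0 := fun h => by simp [h] at hα
  set W : Submodule ℝ (Euc n) := (ℝ ∙ α)ᗮ
  set b := stdOrthonormalBasis ℝ W with hb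
  let A : Euc n →L[ℝ] Euc n →L[ℝ] ℝ := fderiv ℝ (fderiv ℝ H) α +
    (innerSL ℝ α).smulRight (innerSL ℝ α)
  have hA : ∀ v w, A v w = fderiv ℝ (fderiv ℝ H) α v w + ⟪α, v⟫ * ⟪α, w⟫ := fun v w => by
    simp [A]
  have hd1 : DifferentiableAt ℝ (fderiv ℝ H) α :=
    ((hH.contDiffAt hα0).fderiv_right (m := ∞) (by simp)).differentiableAt (by simp)
  -- The derivative of `H` is homogeneous of degree zero, hence constant along the ray through `α`.
  have hEuler : ∀ w, fderiv ℝ (fderiv ℝ H) α α w = 0 := by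
    have hc : HasDerivAt (fun t : ℝ => fderiv ℝ H (t • α)) (fderiv ℝ (fderiv ℝ H) α α) 1 := by
      have h1 : HasDerivAt (fun t : ℝ => t • α) α 1 := by
        simpa using (hasDerivAt_id (1 : ℝ)).smul_const α
      have h2 : HasFDerivAt (fderiv ℝ H) (fderiv ℝ (fderiv ℝ H) α) ((1 : ℝ) • α) := by
        rw [one_smul]
        exact hd1.hasFDerivAt
      exact h2.comp_hasDerivAt 1 h1
    have hc' : (fun t : ℝ => fderiv ℝ H (t • α)) =ᶠ[𝓝 1] fun _ => fderiv ℝ H α := by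
      filter_upwards [lt_mem_nhds (show (0 : ℝ) < 1 from one_pos)] with t ht
      rw [hH.fderiv_smul ht hα0]
      simp
    have h0 := hc.unique ((hasDerivAt_const (1 : ℝ) (fderiv ℝ H α)).congr_of_eventuallyEq hc')
    intro w
    rw [h0]
    rfl
  have hsym : IsSymmSndFDerivAt ℝ H α :=
    (hH.contDiffAt hα0).isSymmSndFDerivAt (by simpa using two_le_infty)
  have hbo : ∀ i, ⟪α, (b i : Euc n)⟫ = 0 := fun i =>
    Submodule.mem_orthogonal_singleton_iff_inner_right.mp (b i).2
  let w : Unit ⊕ Fin (Module.finrank ℝ W) → Euc n := Sum.elim (fun _ => α) fun i => (b i : Euc n)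
  have hw : Orthonormal ℝ w := by
    rw [orthonormal_iff_ite]
    have hbb := orthonormal_iff_ite.mp b.orthonormal
    rintro (i | i) (j | j)
    · simp [w, hα]
    · simp [w, hbo]
    · simp only [w, Sum.elim_inl, Sum.elim_inr, reduceCtorEq, if_false]
      rw [real_inner_comm]
      exact hbo i
    · have := hbb i j
      rw [Submodule.coe_inner] at this
      simpa [w] using this
  have hcard : Fintype.card (Unit ⊕ Fin (Module.finrank ℝ W)) = Module.finrank ℝ (Euc n) := by
    have : Module.finrank ℝ W + 1 = n := finrank_orthogonal_span_singleton_eq hα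
    rw [finrank_euclideanSpace_fin, Fintype.card_sum, Fintype.card_fin, Fintype.card_unit]
    omega
  let bb : OrthonormalBasis (Unit ⊕ Fin (Module.finrank ℝ W)) ℝ (Euc n) :=
    (basisOfOrthonormalOfCardEqFinrank hw hcard).toOrthonormalBasis (by simpa using hw)
  have hbb : ∀ i, bb i = w i := fun i => by simp [bb]
  have h1 := (det_bilin_orthonormalBasis bb A).trans
    (det_bilin_orthonormalBasis (EuclideanSpace.basisFun (Fin n) ℝ) A).symm
  have h2 : (Matrix.of fun i j => A (bb i) (bb j)) =
      Matrix.fromBlocks 1 0 0 (subspaceHessian H α W) := by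
    ext (i | i) (j | j)
    · simp [hbb, hA, w, hEuler, hα]
    · simp [hbb, hA, w, hEuler, hbo]
    · simp only [Matrix.of_apply, hbb, hA, w, Sum.elim_inl, Sum.elim_inr, hbo, zero_mul, add_zero,
        Matrix.fromBlocks_apply₂₁, Matrix.zero_apply]
      rw [hsym, hEuler]
    · have hbo' : ⟪α, (stdOrthonormalBasis ℝ W i : Euc n)⟫ = 0 := hbo i
      simp [hbb, hA, w, hbo', subspaceHessian, iteratedFDeriv_two_apply, hb]
  rw [h2, Matrix.det_fromBlocks_zero₂₁, Matrix.det_one, one_mul] at h1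
  rw [h1]
  congr 1
  ext i j
  simp [hA, EuclideanSpace.inner_single_right]

lemma contDiffAt_det_tangentHessian {H : Euc n → ℝ} (hH : IsHomogSmooth 1 H) {ξ : Euc n}
    (hξ : ξ ≠ 0) : ContDiffAt ℝ ∞ (fun ζ => (tangentHessian H (unitDir ζ)).det) ξ := by
  have hev : (fun ζ => (tangentHessian H (unitDir ζ)).det) =ᶠ[𝓝 ξ] fun ζ =>
      (Matrix.of fun i j : Fin n => fderiv ℝ (fderiv ℝ H) (unitDir ζ) (EuclideanSpace.single i 1)
        (EuclideanSpace.single j 1) + unitDir ζ i * unitDir ζ j).det := by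
    filter_upwards [isOpen_compl_singleton.mem_nhds hξ] with ζ hζ
    exact det_subspaceHessian_orthogonal hH (norm_unitDir hζ)
  refine ContDiffAt.congr_of_eventuallyEq ?_ hev
  have h1 : ContDiffAt ℝ ∞ (fderiv ℝ (fderiv ℝ H)) (unitDir ξ) :=
    ((hH.contDiffAt (unitDir_ne_zero hξ)).fderiv_right (m := ∞) (by simp)).fderiv_right (m := ∞)
      (by simp)
  have h2 := h1.comp ξ (contDiffAt_unitDir hξ)
  have h3 : ∀ i : Fin n, ContDiffAt ℝ ∞ (fun ζ : Euc n => unitDir ζ i) ξ := fun i =>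
    contDiffAt_euclidean.mp (contDiffAt_unitDir hξ) i
  simp only [Matrix.det_apply, Matrix.of_apply]
  refine ContDiffAt.sum fun σ _ => ContDiffAt.const_smul _ (contDiffAt_prod fun i _ => ?_)
  exact ((h2.clm_apply contDiffAt_const).clm_apply contDiffAt_const).add ((h3 _).mul (h3 _))

end Hessian

/-! ### The phase, the factor `ω` and the phase centred at `x₀` -/

section Phase

open scoped Matrix

variable {n : ℕ} {Ω : Set (Euc n)} {H : Euc n → ℝ} {α : Euc n}

lemma IsOpenInSphere.norm_eq_one (hΩ : IsOpenInSphere Ω) (hα : α ∈ Ω) : ‖α‖ = 1 := by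
  obtain ⟨U, -, rfl⟩ := hΩ
  simpa using hα.2

lemma IsOpenInSphere.eventually_unitDir_mem (hΩ : IsOpenInSphere Ω) {ξ : Euc n} (hξ : ξ ≠ 0)
    (hα : unitDir ξ ∈ Ω) : ∀ᶠ ζ in 𝓝 ξ, ζ ≠ 0 ∧ unitDir ζ ∈ Ω := by
  obtain ⟨U, hU, rfl⟩ := hΩ
  have h1 := (contDiffAt_unitDir hξ).continuousAt.eventually (hU.mem_nhds hα.1)
  filter_upwards [h1, isOpen_compl_singleton.mem_nhds hξ] with ζ h2 h3
  exact ⟨h3, h2, by simpa using norm_unitDir h3⟩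

lemma IsPhase.isHomogSmooth (hH : IsPhase Ω H) : IsHomogSmooth 1 H :=
  ⟨hH.smooth, fun r hr ξ hξ => by rw [hH.homogeneous r hr ξ hξ, Real.rpow_one, smul_eq_mul]⟩

/-- Homogeneity spreads oddness from `Ω` to the open cone over it, so that the identity may be
differentiated. -/
lemma IsPhase.eventually_odd (hH : IsPhase Ω H) (hΩ : IsOpenInSphere Ω) (hα : α ∈ Ω) :
    (fun ξ => -H (-ξ)) =ᶠ[𝓝 α] H := by
  have hα1 := hΩ.norm_eq_one hα
  have hα0 : α ≠ 0 := fun h => by simp [h] at hα1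
  filter_upwards [hΩ.eventually_unitDir_mem hα0 (by rwa [unitDir_of_norm_eq_one hα1])] with ξ hξ
  have h1 := hH.homogeneous ‖ξ‖ (norm_pos_iff.mpr hξ.1) (unitDir ξ) (unitDir_ne_zero hξ.1)
  have h2 := hH.homogeneous ‖ξ‖ (norm_pos_iff.mpr hξ.1) (-unitDir ξ)
    (neg_ne_zero.mpr (unitDir_ne_zero hξ.1))
  rw [smul_neg, hH.odd _ hξ.2] at h2
  rw [norm_smul_unitDir] at h1 h2
  rw [h1, h2]
  ring

lemma fderiv_comp_neg_eq {E F : Type*} [NormedAddCommGroup E] [NormedSpace ℝ E]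
    [NormedAddCommGroup F] [NormedSpace ℝ F] (f : E → F) (x : E) :
    fderiv ℝ (fun y => f (-y)) x = -fderiv ℝ f (-x) := by
  have := (ContinuousLinearEquiv.neg ℝ (M := E)).comp_right_fderiv (f := f) (x := x)
  refine this.trans ?_
  ext v
  simp

lemma fderiv_neg_of_eventually_odd (h : (fun ξ => -H (-ξ)) =ᶠ[𝓝 α] H) :
    fderiv ℝ H (-α) = fderiv ℝ H α := by
  rw [← h.fderiv_eq, fderiv_fun_neg, fderiv_comp_neg_eq, neg_neg]

lemma iteratedFDeriv_two_neg_of_eventually_odd (h : (fun ξ => -H (-ξ)) =ᶠ[𝓝 α] H)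
    (v : Fin 2 → Euc n) : iteratedFDeriv ℝ 2 H (-α) v = -iteratedFDeriv ℝ 2 H α v := by
  have h1 : (fun ξ => fderiv ℝ H (-ξ)) =ᶠ[𝓝 α] fderiv ℝ H := by
    filter_upwards [h.eventuallyEq_nhds] with ξ hξ
    exact fderiv_neg_of_eventually_odd hξ
  have h2 := h1.fderiv_eq (𝕜 := ℝ)
  rw [fderiv_comp_neg_eq (fderiv ℝ H)] at h2
  rw [iteratedFDeriv_two_apply, iteratedFDeriv_two_apply, ← h2]
  simp

lemma IsPhase.posDef_neg_tangentHessian (hH : IsPhase Ω H) (hΩ : IsOpenInSphere Ω) (hα : α ∈ Ω) :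
    (-tangentHessian H α).PosDef := by
  have hα0 : α ≠ 0 := fun h => by simpa [h] using hΩ.norm_eq_one hα
  exact _root_.posDef_neg_tangentHessian (hH.isHomogSmooth.contDiffAt hα0) (hH.hessian_neg α hα)

lemma tangentHessian_fun_neg : tangentHessian (fun ξ => -H ξ) α = -tangentHessian H α := by
  ext i j
  simp only [tangentHessian, Matrix.of_apply, Matrix.neg_apply, iteratedFDeriv_two_apply]
  have : fderiv ℝ (fun ξ => -H ξ) = fun ξ => -fderiv ℝ H ξ := by
    ext1 ξ
    rw [fderiv_fun_neg]
  rw [this, fderiv_fun_neg]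
  rfl

lemma IsPhase.posDef_tangentHessian_neg (hH : IsPhase Ω H) (hΩ : IsOpenInSphere Ω) (hα : α ∈ Ω) :
    (tangentHessian H (-α)).PosDef := by
  have hα0 : α ≠ 0 := fun h => by simpa [h] using hΩ.norm_eq_one hα
  have h1 : (-tangentHessian (fun ξ => -H ξ) (-α)).PosDef := by
    refine _root_.posDef_neg_tangentHessian
      (hH.isHomogSmooth.neg.contDiffAt (neg_ne_zero.mpr hα0)) fun v hv hv0 => ?_
    have h2 : iteratedFDeriv ℝ 2 (fun ξ => -H ξ) (-α) ![v, v] =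
        -iteratedFDeriv ℝ 2 H (-α) ![v, v] := by
      rw [show (fun ξ => -H ξ) = -H from rfl, iteratedFDeriv_neg]
      rfl
    rw [h2, iteratedFDeriv_two_neg_of_eventually_odd (hH.eventually_odd hΩ hα), neg_neg]
    refine hH.hessian_neg α hα v ?_ hv0
    simpa using hv
  rwa [tangentHessian_fun_neg, neg_neg] at h1

lemma abs_det_tangentHessian_neg (h : (fun ξ => -H (-ξ)) =ᶠ[𝓝 α] H) :
    |(tangentHessian H (-α)).det| = |(tangentHessian H α).det| := by
  have hs : (ℝ ∙ (-α))ᗮ = ((ℝ ∙ α)ᗮ : Submodule ℝ (Euc n)) := by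
    rw [← Submodule.span_neg {α}, Set.neg_singleton]
  rw [tangentHessian_eq_subspaceHessian, det_subspaceHessian_congr H (-α) hs,
    tangentHessian_eq_subspaceHessian]
  have : subspaceHessian H (-α) (ℝ ∙ α)ᗮ = -subspaceHessian H α (ℝ ∙ α)ᗮ := by
    ext i j
    exact iteratedFDeriv_two_neg_of_eventually_odd h _
  rw [this, Matrix.det_neg, abs_mul, abs_pow, abs_neg, abs_one, one_pow, one_mul]

lemma IsPhase.omegaFactor_eq (hH : IsPhase Ω H) (hΩ : IsOpenInSphere Ω) (hα : α ∈ Ω) :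
    omegaFactor H α = (Real.sqrt |(tangentHessian H α).det| : ℂ) *
      Complex.exp (Complex.I * Real.pi * ((n : ℂ) - 1) / 4) /
        (((2 * Real.pi) ^ (((n : ℝ) - 1) / 2) : ℝ) : ℂ) := by
  have hn := finrank_orthogonal_span_singleton_eq (hΩ.norm_eq_one hα)
  have hn' : (Module.finrank ℝ ((ℝ ∙ α)ᗮ : Submodule ℝ (Euc n)) : ℂ) = (n : ℂ) - 1 := by
    rw [eq_sub_iff_add_eq]
    exact_mod_cast hn
  rw [omegaFactor, matrixSgn_of_posDef_neg (hH.posDef_neg_tangentHessian hΩ hα)]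
  push_cast
  rw [hn']
  congr 3
  ring

lemma IsPhase.omegaFactor_neg_eq (hH : IsPhase Ω H) (hΩ : IsOpenInSphere Ω) (hα : -α ∈ Ω) :
    omegaFactor H α = (Real.sqrt |(tangentHessian H α).det| : ℂ) *
      Complex.exp (-(Complex.I * Real.pi * ((n : ℂ) - 1) / 4)) /
        (((2 * Real.pi) ^ (((n : ℝ) - 1) / 2) : ℝ) : ℂ) := by
  have hn := finrank_orthogonal_span_singleton_eq
    (α := α) (by simpa using hΩ.norm_eq_one hα)
  have hn' : (Module.finrank ℝ ((ℝ ∙ α)ᗮ : Submodule ℝ (Euc n)) : ℂ) = (n : ℂ) - 1 := by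
    rw [eq_sub_iff_add_eq]
    exact_mod_cast hn
  have hp := hH.posDef_tangentHessian_neg hΩ hα
  rw [neg_neg] at hp
  rw [omegaFactor, matrixSgn_of_posDef hp]
  push_cast
  rw [hn']
  congr 3
  ring

/-- Over `Ω` and `-Ω` the Hessian is definite. The signature is thus constant on each of them, and
the determinant is nonzero, so the absolute value and the square root are smooth. -/
lemma IsPhase.contDiffAt_omegaFactor (hH : IsPhase Ω H) (hΩ : IsOpenInSphere Ω) {ξ : Euc n}
    (hξ : ξ ≠ 0) (hα : unitDir ξ ∈ Ω ∪ -Ω) :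
    ContDiffAt ℝ ∞ (fun ζ => omegaFactor H (unitDir ζ)) ξ := by
  have hdet : ∀ hd : (tangentHessian H (unitDir ξ)).det ≠ 0, ContDiffAt ℝ ∞
      (fun ζ => (Real.sqrt |(tangentHessian H (unitDir ζ)).det| : ℂ)) ξ := fun hd => by
    have h1 := contDiffAt_det_tangentHessian hH.isHomogSmooth hξ
    have h2 : ContDiffAt ℝ ∞ (fun ζ => |(tangentHessian H (unitDir ζ)).det|) ξ := h1.abs hd
    exact Complex.ofRealCLM.contDiff.contDiffAt.comp ξ (h2.sqrt (abs_ne_zero.mpr hd))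
  rcases hα with hα | hα
  · have h2 := hdet (by
      have := (hH.posDef_neg_tangentHessian hΩ hα).det_pos.ne'
      rw [Matrix.det_neg] at this
      exact right_ne_zero_of_mul this)
    refine ContDiffAt.congr_of_eventuallyEq ((h2.mul (contDiffAt_const
      (c := Complex.exp (Complex.I * Real.pi * ((n : ℂ) - 1) / 4)))).div_const
        (((2 * Real.pi) ^ (((n : ℝ) - 1) / 2) : ℝ) : ℂ)) ?_
    filter_upwards [hΩ.eventually_unitDir_mem hξ hα] with ζ hζ
    exact hH.omegaFactor_eq hΩ hζ.2
  · rw [Set.mem_neg, ← unitDir_neg] at hα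
    have h2 := hdet (by
      have := (hH.posDef_tangentHessian_neg hΩ hα).det_pos.ne'
      rwa [unitDir_neg, neg_neg] at this)
    refine ContDiffAt.congr_of_eventuallyEq ((h2.mul (contDiffAt_const
      (c := Complex.exp (-(Complex.I * Real.pi * ((n : ℂ) - 1) / 4))))).div_const
        (((2 * Real.pi) ^ (((n : ℝ) - 1) / 2) : ℝ) : ℂ)) ?_
    have hev := (continuous_neg.tendsto ξ).eventually
      (hΩ.eventually_unitDir_mem (neg_ne_zero.mpr hξ) hα)
    filter_upwards [hev] with ζ hζ
    rw [unitDir_neg] at hζ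
    exact hH.omegaFactor_neg_eq hΩ hζ.2

lemma sqrt_det_neg_eq {d : ℕ} (A : Matrix (Fin d) (Fin d) ℝ) (hA : (-A).PosDef) :
    Real.sqrt (-A).det = Real.sqrt |A.det| ∧ Real.sqrt |A.det| ≠ 0 := by
  have h1 := hA.det_pos
  have h2 : |A.det| = (-A).det := by
    rw [← abs_of_pos h1, Matrix.det_neg, abs_mul, abs_pow, abs_neg, abs_one, one_pow, one_mul]
  rw [h2]
  exact ⟨rfl, (Real.sqrt_pos.mpr h1).ne'⟩

/-- The normalisation `ω` of the amplitude inverts the stationary phase constant; for a negative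
definite Hessian the signature is `-(n - 1)`. -/
lemma IsPhase.stationaryFactor_mul_omegaFactor (hH : IsPhase Ω H) (hΩ : IsOpenInSphere Ω)
    (hα : α ∈ Ω) : stationaryFactor H α * omegaFactor H α = 1 := by
  have hn := finrank_orthogonal_span_singleton_eq (hΩ.norm_eq_one hα)
  set m := Module.finrank ℝ ((ℝ ∙ α)ᗮ : Submodule ℝ (Euc n)) with hm
  have hn' : (n : ℝ) = m + 1 := by exact_mod_cast hn.symm
  have hn'' : (n : ℂ) = m + 1 := by exact_mod_cast hn.symm
  obtain ⟨h1, h2⟩ := sqrt_det_neg_eq _ (hH.posDef_neg_tangentHessian hΩ hα)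
  have h3 : ((2 * Real.pi) ^ ((m : ℝ) / 2) : ℝ) ≠ 0 := by positivity
  rw [hH.omegaFactor_eq hΩ hα, stationaryFactor, h1, hn', hn'', add_sub_cancel_right,
    add_sub_cancel_right, Complex.exp_neg, Complex.ofReal_div]
  change (((2 * Real.pi) ^ ((m : ℝ) / 2) : ℝ) : ℂ) / _ *
    (Complex.exp (Complex.I * Real.pi * (m : ℂ) / 4))⁻¹ * _ = 1
  have h4 : ((Real.sqrt |(tangentHessian H α).det| : ℝ) : ℂ) ≠ 0 := by exact_mod_cast h2
  have h5 : (((2 * Real.pi) ^ ((m : ℝ) / 2) : ℝ) : ℂ) ≠ 0 := by exact_mod_cast h3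
  have h6 := Complex.exp_ne_zero (Complex.I * Real.pi * m / 4)
  field_simp

/-- At `-α` the Hessian changes sign: the absolute value of the determinant is kept and the
signature reversed, so `ω(-α)` is the conjugate of `ω(α)`. -/
lemma IsPhase.conj_stationaryFactor_mul_omegaFactor (hH : IsPhase Ω H) (hΩ : IsOpenInSphere Ω)
    (hα : α ∈ Ω) : starRingEnd ℂ (stationaryFactor H α) * omegaFactor H (-α) = 1 := by
  have h := hH.stationaryFactor_mul_omegaFactor hΩ hα
  have h1 : omegaFactor H (-α) = starRingEnd ℂ (omegaFactor H α) := by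
    rw [hH.omegaFactor_neg_eq hΩ (α := -α) (by rwa [neg_neg]), hH.omegaFactor_eq hΩ hα,
      abs_det_tangentHessian_neg (hH.eventually_odd hΩ hα), map_div₀, map_mul, ← Complex.exp_conj,
      Complex.conj_ofReal, Complex.conj_ofReal]
    congr 3
    simp only [map_div₀, map_mul, Complex.conj_I, Complex.conj_ofReal, map_sub, map_one,
      Complex.conj_natCast, map_ofNat]
    ring
  rw [h1, ← map_mul, h, map_one]

/-- The phase centred at a point `x₀`. -/
def centredPhase (H : Euc n → ℝ) (x₀ : Euc n) (ξ : Euc n) : ℝ := H ξ - ⟪x₀, ξ⟫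

lemma IsPhase.isHomogSmooth_centredPhase (hH : IsPhase Ω H) (x₀ : Euc n) :
    IsHomogSmooth 1 (centredPhase H x₀) := by
  refine ⟨hH.smooth.sub (contDiff_const.inner ℝ contDiff_id).contDiffOn, fun r hr ξ hξ => ?_⟩
  simp only [centredPhase]
  rw [hH.homogeneous r hr ξ hξ, Real.rpow_one, smul_eq_mul, real_inner_smul_right]
  ring

lemma IsPhase.fderiv_centredPhase (hH : IsPhase Ω H) (x₀ : Euc n) {ξ : Euc n} (hξ : ξ ≠ 0) :
    fderiv ℝ (centredPhase H x₀) ξ = fderiv ℝ H ξ - innerSL ℝ x₀ := by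
  have h1 := (hH.isHomogSmooth.differentiableAt hξ).hasFDerivAt
  have h2 : HasFDerivAt (fun ζ : Euc n => ⟪x₀, ζ⟫) (innerSL ℝ x₀) ξ := (innerSL ℝ x₀).hasFDerivAt
  exact (h1.sub h2).fderiv

lemma IsPhase.fderiv_centredPhase_eq_zero_iff (hH : IsPhase Ω H) (x₀ : Euc n) {ξ : Euc n}
    (hξ : ξ ≠ 0) : fderiv ℝ (centredPhase H x₀) ξ = 0 ↔ gradient H ξ = x₀ := by
  rw [hH.fderiv_centredPhase x₀ hξ, sub_eq_zero, gradient, LinearIsometryEquiv.symm_apply_eq]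
  rfl

lemma IsPhase.iteratedFDeriv_two_centredPhase (hH : IsPhase Ω H) (x₀ : Euc n) {ξ : Euc n}
    (hξ : ξ ≠ 0) (v : Fin 2 → Euc n) :
    iteratedFDeriv ℝ 2 (centredPhase H x₀) ξ v = iteratedFDeriv ℝ 2 H ξ v := by
  have h1 : fderiv ℝ (centredPhase H x₀) =ᶠ[𝓝 ξ] fun ζ => fderiv ℝ H ζ - innerSL ℝ x₀ := by
    filter_upwards [isOpen_compl_singleton.mem_nhds hξ] with ζ hζ
    exact hH.fderiv_centredPhase x₀ hζ
  rw [iteratedFDeriv_two_apply, iteratedFDeriv_two_apply, h1.fderiv_eq, fderiv_sub_const]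

lemma IsPhase.stationaryFactor_centredPhase (hH : IsPhase Ω H) (x₀ : Euc n) (hα : α ≠ 0) :
    stationaryFactor (centredPhase H x₀) α = stationaryFactor H α := by
  have : tangentHessian (centredPhase H x₀) α = tangentHessian H α := by
    ext i j
    exact hH.iteratedFDeriv_two_centredPhase x₀ hα _
  simp only [stationaryFactor, this]

lemma IsPhase.centredPhase_odd (hH : IsPhase Ω H) (hΩ : IsOpenInSphere Ω) (x₀ : Euc n)
    (hα : α ∈ Ω) : (fun ξ => -centredPhase H x₀ (-ξ)) =ᶠ[𝓝 α] centredPhase H x₀ := by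
  filter_upwards [hH.eventually_odd hΩ hα] with ξ hξ
  simp only [centredPhase, inner_neg_right]
  linarith

/-- Euler's identity: a function homogeneous of degree one vanishes at its critical points. -/
lemma IsPhase.centredPhase_eq_zero (hH : IsPhase Ω H) {x₀ : Euc n} (hα : α ≠ 0)
    (hx : gradient H α = x₀) : centredPhase H x₀ α = 0 := by
  have hh := hH.isHomogSmooth_centredPhase x₀
  have h1 : HasDerivAt (fun t : ℝ => centredPhase H x₀ (t • α)) 0 1 := by
    have e1 : HasDerivAt (fun t : ℝ => t • α) α 1 := by
      simpa using (hasDerivAt_id (1 : ℝ)).smul_const α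
    have e2 : HasFDerivAt (centredPhase H x₀) (0 : Euc n →L[ℝ] ℝ) ((1 : ℝ) • α) := by
      rw [one_smul, ← (hH.fderiv_centredPhase_eq_zero_iff x₀ hα).mpr hx]
      exact (hh.differentiableAt hα).hasFDerivAt
    exact e2.comp_hasDerivAt 1 e1
  have h2 : HasDerivAt (fun t : ℝ => centredPhase H x₀ (t • α)) (centredPhase H x₀ α) 1 := by
    have e1 : HasDerivAt (fun t : ℝ => t * centredPhase H x₀ α) (centredPhase H x₀ α) 1 := by
      simpa using (hasDerivAt_id (1 : ℝ)).mul_const (centredPhase H x₀ α)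
    refine e1.congr_of_eventuallyEq ?_
    filter_upwards [lt_mem_nhds (show (0 : ℝ) < 1 from one_pos)] with t ht
    rw [hh.homog t ht α hα, Real.rpow_one, smul_eq_mul]
  exact h2.unique h1

/-- The critical set is conic, and over `Ω` the gradient of an odd function is even. Hence
uniqueness of the critical direction in `Ω` determines those in `-Ω` as well. -/
lemma IsPhase.critical_direction (hH : IsPhase Ω H) (hΩ : IsOpenInSphere Ω) {x₀ Θ : Euc n}
    (hsmall : ∀ α ∈ Ω, gradient H α = x₀ → α = Θ) {ξ : Euc n} (hξ : ξ ≠ 0)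
    (hcr : fderiv ℝ (centredPhase H x₀) ξ = 0) (hu : unitDir ξ ∈ Ω ∪ -Ω) :
    unitDir ξ = Θ ∨ unitDir ξ = -Θ := by
  have hu0 := unitDir_ne_zero hξ
  have h1 : fderiv ℝ (centredPhase H x₀) (unitDir ξ) = 0 := by
    rw [unitDir, (hH.isHomogSmooth_centredPhase x₀).fderiv_smul
      (inv_pos.mpr (norm_pos_iff.mpr hξ)) hξ, hcr, smul_zero]
  rcases hu with hu | hu
  · exact Or.inl (hsmall _ hu ((hH.fderiv_centredPhase_eq_zero_iff x₀ hu0).mp h1))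
  · right
    have h2 := fderiv_neg_of_eventually_odd (hH.centredPhase_odd hΩ x₀ hu)
    rw [neg_neg, h1] at h2
    rw [← hsmall _ hu ((hH.fderiv_centredPhase_eq_zero_iff x₀ (neg_ne_zero.mpr hu0)).mp h2.symm),
      neg_neg]

end Phase

/-! ### The Fourier slice theorem -/

section SliceTheorem

variable {n : ℕ} {α : Euc n}

lemma hyperplaneMeasure_eq_volume (α : Euc n) : hyperplaneMeasure α = volume :=
  (stdOrthonormalBasis ℝ ((ℝ ∙ α)ᗮ : Submodule ℝ (Euc n))).addHaar_eq_volume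

/-- The Fourier slice theorem. -/
lemma integral_exp_mul_radon (hα : ‖α‖ = 1) {f : Euc n → ℂ} (hf : Integrable f) (r : ℝ) :
    ∫ p : ℝ, Complex.exp (Complex.I * (r * p : ℝ)) * radon f α p =
      ∫ x, Complex.exp (Complex.I * (⟪r • α, x⟫ : ℝ)) * f x := by
  have hint : Integrable fun x => Complex.exp (Complex.I * (⟪r • α, x⟫ : ℝ)) * f x := by
    refine hf.norm.mono' ?_ (Eventually.of_forall fun x => ?_)
    · refine AEStronglyMeasurable.mul (Continuous.aestronglyMeasurable ?_) hf.aestronglyMeasurable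
      fun_prop
    · rw [norm_mul, norm_cexp_I_mul_real, one_mul]
  rw [integral_slice hα hint]
  refine integral_congr_ae (Eventually.of_forall fun p => ?_)
  simp only [radon, hyperplaneMeasure_eq_volume]
  rw [← integral_const_mul]
  refine integral_congr_ae (Eventually.of_forall fun y => ?_)
  simp only [real_inner_smul_left, inner_smul_add_orth hα p y]

lemma radon_ofReal (φ : Euc n → ℝ) (p : ℝ) :
    radon (fun x => (φ x : ℂ)) α p = ((radon φ α p : ℝ) : ℂ) := by
  simp only [radon]
  exact integral_ofReal

lemma integrable_testFunction {E : Type*} [NormedAddCommGroup E] [InnerProductSpace ℝ E]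
    [FiniteDimensional ℝ E] [MeasurableSpace E] [BorelSpace E] (φ : 𝓓((⊤ : Opens E), ℝ)) :
    Integrable fun x => (φ x : ℂ) :=
  (TestFunction.toSchwartz φ).integrable

lemma testFourier_radonTest (hα : ‖α‖ = 1) (φ : 𝓓((⊤ : Opens (Euc n)), ℝ)) (ρ : ℝ) :
    testFourier (radonTest hα φ) ρ = testFourier φ (ρ • α) := by
  have h := integral_exp_mul_radon hα (integrable_testFunction φ) (-ρ)
  rw [testFourier_apply, testFourier_apply]
  refine Eq.trans (integral_congr_ae (Eventually.of_forall fun p => ?_)) (h.trans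
    (integral_congr_ae (Eventually.of_forall fun x => ?_)))
  · simp only [radon_ofReal]
    congr 2
    rw [RCLike.inner_apply, conj_trivial]
    push_cast
    ring
  · simp only [neg_smul, inner_neg_left]
    push_cast
    ring_nf

end SliceTheorem

/-! ### From the weak identity to the pointwise Fourier transform -/

section Inversion

variable {E : Type*} [NormedAddCommGroup E] [InnerProductSpace ℝ E] [FiniteDimensional ℝ E]
  [MeasurableSpace E] [BorelSpace E]

/-- Fourier inversion at the origin; rescaling the frequency by `2π` produces the power of `2π`. -/
lemma integral_angularFourier (g : 𝓢(E, ℂ)) :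
    ∫ ξ, angularFourier E g ξ = (2 * Real.pi : ℂ) ^ Module.finrank ℝ E * g 0 := by
  have h1 : ∀ ξ, angularFourier E g ξ = 𝓕 (g : E → ℂ) ((2 * Real.pi)⁻¹ • ξ) := fun ξ => rfl
  simp_rw [h1]
  rw [Measure.integral_comp_smul_of_nonneg _ _ _ (hR := by positivity)]
  have h2 : 𝓕⁻ (𝓕 (g : E → ℂ)) 0 = g 0 := by
    have h3 : (𝓕⁻ (𝓕 g : 𝓢(E, ℂ)) : 𝓢(E, ℂ)) = g := FourierTransform.fourierInv_fourier_eq g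
    conv_rhs => rw [← h3]
    rw [fourierInv_coe, fourier_coe]
  rw [Real.fourierInv_eq'] at h2
  simp only [inner_zero_right, mul_zero, Complex.ofReal_zero, zero_mul, Complex.exp_zero,
    one_smul] at h2
  rw [h2, Complex.real_smul, inv_pow, inv_inv]
  push_cast
  rfl

lemma integral_testFourier (φ : 𝓓((⊤ : Opens E), ℝ)) :
    ∫ ξ, testFourier φ ξ = (2 * Real.pi : ℂ) ^ Module.finrank ℝ E * (φ 0 : ℂ) :=
  integral_angularFourier _

lemma exists_testFunction_eq_one : ∃ χ : 𝓓((⊤ : Opens E), ℝ), χ 0 = 1 := by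
  let b : ContDiffBump (0 : E) := ⟨1, 2, one_pos, one_lt_two⟩
  exact ⟨⟨b, b.contDiff, b.hasCompactSupport, fun _ _ => trivial⟩,
    b.one_of_mem_closedBall (by simp [b.rIn_pos.le])⟩

/-- The test function `χ(ε x) m(x)`. -/
def cutoffTest (χ : 𝓓((⊤ : Opens E), ℝ)) {ε : ℝ} (hε : 0 < ε) {m : E → ℝ} (hm : ContDiff ℝ ∞ m) :
    𝓓((⊤ : Opens E), ℝ) where
  toFun x := χ (ε • x) * m x
  contDiff' := by
    have := χ.contDiff
    fun_prop
  hasCompactSupport' := by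
    have : HasCompactSupport fun x : E => χ (ε • x) :=
      χ.hasCompactSupport.comp_homeomorph (Homeomorph.smulOfNeZero ε hε.ne')
    exact this.mul_right
  tsupport_subset' := fun _ _ => trivial

lemma cutoffTest_apply (χ : 𝓓((⊤ : Opens E), ℝ)) {ε : ℝ} (hε : 0 < ε) {m : E → ℝ}
    (hm : ContDiff ℝ ∞ m) (x : E) : cutoffTest χ hε hm x = χ (ε • x) * m x := rfl

/-- Test functions are real-valued, so the modulated cutoff `χ(εx) e^{iξ₀·x}` enters through its
cosine and sine parts. Their transforms combine to a multiple of a bump concentrating at `ξ₀`. -/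
lemma testFourier_cutoffTest (χ : 𝓓((⊤ : Opens E), ℝ)) {ε : ℝ} (hε : 0 < ε) (ξ₀ ξ : E)
    (hc : ContDiff ℝ ∞ fun x : E => Real.cos ⟪ξ₀, x⟫)
    (hs : ContDiff ℝ ∞ fun x : E => Real.sin ⟪ξ₀, x⟫) :
    testFourier (cutoffTest χ hε hc) ξ + Complex.I * testFourier (cutoffTest χ hε hs) ξ =
      ((ε⁻¹ ^ Module.finrank ℝ E : ℝ) : ℂ) * testFourier χ (ε⁻¹ • (ξ - ξ₀)) := by
  have hint : ∀ φ : 𝓓((⊤ : Opens E), ℝ),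
      Integrable fun x => Complex.exp (-(Complex.I * (⟪ξ, x⟫ : ℝ))) * (φ x : ℂ) := fun φ => by
    refine (integrable_testFunction φ).norm.mono' ?_ (Eventually.of_forall fun x => ?_)
    · refine AEStronglyMeasurable.mul (Continuous.aestronglyMeasurable ?_)
        (integrable_testFunction φ).aestronglyMeasurable
      fun_prop
    · have := norm_cexp_I_mul_real (-⟪ξ, x⟫)
      rw [Complex.ofReal_neg, mul_neg] at this
      rw [norm_mul, this, one_mul]
  rw [testFourier_apply, testFourier_apply, testFourier_apply, ← integral_const_mul,
    ← integral_add (hint _) ((hint _).const_mul _)]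
  have h1 := Measure.integral_comp_smul_of_nonneg (volume : Measure E)
    (fun y : E => Complex.exp (-(Complex.I * (⟪ε⁻¹ • (ξ - ξ₀), y⟫ : ℝ))) * (χ y : ℂ)) ε
    (hR := hε.le)
  rw [Complex.real_smul, ← inv_pow] at h1
  rw [← h1]
  refine integral_congr_ae (Eventually.of_forall fun x => ?_)
  have h2 : Complex.exp (-(Complex.I * (⟪ε⁻¹ • (ξ - ξ₀), ε • x⟫ : ℝ))) =
      Complex.exp (-(Complex.I * (⟪ξ, x⟫ : ℝ))) *
        (Complex.cos (⟪ξ₀, x⟫ : ℝ) + Complex.sin (⟪ξ₀, x⟫ : ℝ) * Complex.I) := by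
    rw [← Complex.exp_mul_I, ← Complex.exp_add, real_inner_smul_left, real_inner_smul_right,
      ← mul_assoc, inv_mul_cancel₀ hε.ne', one_mul, inner_sub_left]
    congr 1
    push_cast
    ring
  simp only [cutoffTest_apply]
  rw [h2]
  push_cast
  ring

/-- A continuous multiplier of an integrable function is its Fourier transform. -/
lemma integral_exp_mul_eq_of_weak {f : E → ℂ} (hf : Integrable f) {M : E → ℂ} {C : ℝ}
    (hMC : ∀ ξ, ‖M ξ‖ ≤ C) (hMm : AEStronglyMeasurable M)
    (hM : ∀ φ : 𝓓((⊤ : Opens E), ℝ), ∫ x, f x * (φ x : ℂ) =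
      (1 / (2 * Real.pi : ℂ) ^ Module.finrank ℝ E) * ∫ ξ, M ξ * testFourier φ ξ)
    {ξ₀ : E} (hcont : ContinuousAt M ξ₀) :
    ∫ x, Complex.exp (Complex.I * (⟪ξ₀, x⟫ : ℝ)) * f x = M ξ₀ := by
  have hpi : (2 * Real.pi : ℂ) ^ Module.finrank ℝ E ≠ 0 := by
    exact pow_ne_zero _ (by simp [Real.pi_ne_zero])
  obtain ⟨χ, hχ⟩ := exists_testFunction_eq_one (E := E)
  have hc : ContDiff ℝ ∞ fun x : E => Real.cos ⟪ξ₀, x⟫ :=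
    Real.contDiff_cos.comp (contDiff_const.inner ℝ contDiff_id)
  have hs : ContDiff ℝ ∞ fun x : E => Real.sin ⟪ξ₀, x⟫ :=
    Real.contDiff_sin.comp (contDiff_const.inner ℝ contDiff_id)
  have hχb : ∃ B, ∀ x, ‖(χ x : ℂ)‖ ≤ B := by
    obtain ⟨B, hB⟩ := χ.hasCompactSupport.exists_bound_of_continuous χ.contDiff.continuous
    exact ⟨B, fun x => by simpa using hB x⟩
  obtain ⟨B, hB⟩ := hχb
  have hχc : Continuous fun x => (χ x : ℂ) := Complex.continuous_ofReal.comp χ.contDiff.continuous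
  have hMg : ∀ g : 𝓢(E, ℂ), Integrable fun ξ => M ξ * g ξ := fun g =>
    g.integrable.bdd_mul hMm (Eventually.of_forall hMC)
  have hfφ : ∀ φ : 𝓓((⊤ : Opens E), ℝ), Integrable fun x => f x * (φ x : ℂ) := fun φ => by
    obtain ⟨B', hB'⟩ := φ.hasCompactSupport.exists_bound_of_continuous φ.contDiff.continuous
    refine hf.mul_bdd (c := B')
      (Complex.continuous_ofReal.comp φ.contDiff.continuous).aestronglyMeasurable
      (Eventually.of_forall fun x => by simpa using hB' x)
  -- The weak identity tested with `χ(εx) e^{iξ₀·x}`, after the substitution `ξ = ξ₀ + εη`.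
  have key : ∀ ε : ℝ, 0 < ε →
      ∫ x, (Complex.exp (Complex.I * (⟪ξ₀, x⟫ : ℝ)) * f x) * (χ (ε • x) : ℂ) =
        (1 / (2 * Real.pi : ℂ) ^ Module.finrank ℝ E) *
          ∫ η, M (ξ₀ + ε • η) * testFourier χ η := by
    intro ε hε
    have e1 := hM (cutoffTest χ hε hc)
    have e2 := hM (cutoffTest χ hε hs)
    have e3 : ∫ x, (Complex.exp (Complex.I * (⟪ξ₀, x⟫ : ℝ)) * f x) * (χ (ε • x) : ℂ) =
        (∫ x, f x * (cutoffTest χ hε hc x : ℂ)) +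
          Complex.I * ∫ x, f x * (cutoffTest χ hε hs x : ℂ) := by
      rw [← integral_const_mul, ← integral_add (hfφ _) ((hfφ _).const_mul _)]
      refine integral_congr_ae (Eventually.of_forall fun x => ?_)
      simp only [cutoffTest_apply]
      rw [mul_comm Complex.I, Complex.exp_mul_I]
      push_cast
      ring
    rw [e3, e1, e2, mul_left_comm, ← mul_add, ← integral_const_mul,
      ← integral_add (hMg _) ((hMg _).const_mul _)]
    congr 1
    have e4 := Measure.integral_comp_smul_of_nonneg (volume : Measure E)
      (fun ζ => M ζ * testFourier χ (ε⁻¹ • (ζ - ξ₀)))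
    rw [← integral_add_left_eq_self (μ := (volume : Measure E)) _ ξ₀]
    have e5 := Measure.integral_comp_smul_of_nonneg (volume : Measure E)
      (fun ζ => M (ξ₀ + ζ) * testFourier χ (ε⁻¹ • ζ)) ε (hR := hε.le)
    simp only [inv_smul_smul₀ hε.ne'] at e5
    rw [e5, Complex.real_smul, ← inv_pow, ← integral_const_mul]
    refine integral_congr_ae (Eventually.of_forall fun ζ => ?_)
    have e6 := testFourier_cutoffTest χ hε ξ₀ (ξ₀ + ζ) hc hs
    rw [add_sub_cancel_left] at e6
    linear_combination M (ξ₀ + ζ) * e6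
  have hL : Tendsto (fun ε : ℝ =>
      ∫ x, (Complex.exp (Complex.I * (⟪ξ₀, x⟫ : ℝ)) * f x) * (χ (ε • x) : ℂ)) (𝓝[>] 0)
      (𝓝 (∫ x, Complex.exp (Complex.I * (⟪ξ₀, x⟫ : ℝ)) * f x)) := by
    have hem : AEStronglyMeasurable
        (fun x => Complex.exp (Complex.I * (⟪ξ₀, x⟫ : ℝ)) * f x) volume := by
      refine AEStronglyMeasurable.mul (Continuous.aestronglyMeasurable ?_) hf.aestronglyMeasurable
      fun_prop
    refine tendsto_integral_filter_of_dominated_convergence (fun x => ‖f x‖ * B) ?_ ?_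
      (hf.norm.mul_const B) ?_
    · refine Eventually.of_forall fun ε => hem.mul (Continuous.aestronglyMeasurable ?_)
      exact hχc.comp (continuous_const_smul ε)
    · refine Eventually.of_forall fun ε => Eventually.of_forall fun x => ?_
      rw [norm_mul, norm_mul, norm_cexp_I_mul_real, one_mul]
      gcongr
      exact hB _
    · refine Eventually.of_forall fun x => ?_
      have h1 : Continuous fun ε : ℝ =>
          (Complex.exp (Complex.I * (⟪ξ₀, x⟫ : ℝ)) * f x) * (χ (ε • x) : ℂ) :=
        continuous_const.mul (hχc.comp (continuous_id.smul continuous_const))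
      have h2 := h1.tendsto 0
      simp only [zero_smul, hχ, Complex.ofReal_one, mul_one] at h2
      exact h2.mono_left nhdsWithin_le_nhds
  -- Continuity of `M` at `ξ₀` freezes the multiplier in the limit, and `∫ χ̂ = (2π)^dim χ(0)` with
  -- `χ(0) = 1` cancels the prefactor.
  have hR : Tendsto (fun ε : ℝ => (1 / (2 * Real.pi : ℂ) ^ Module.finrank ℝ E) *
      ∫ η, M (ξ₀ + ε • η) * testFourier χ η) (𝓝[>] 0) (𝓝 (M ξ₀)) := by
    have h1 : Tendsto (fun ε : ℝ => ∫ η, M (ξ₀ + ε • η) * testFourier χ η) (𝓝[>] 0)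
        (𝓝 (∫ η, M ξ₀ * testFourier χ η)) := by
      refine tendsto_integral_filter_of_dominated_convergence (fun η => C * ‖testFourier χ η‖) ?_ ?_
        ((testFourier χ).integrable.norm.const_mul C) ?_
      · filter_upwards [self_mem_nhdsWithin] with ε hε
        refine AEStronglyMeasurable.mul ?_ (testFourier χ).continuous.aestronglyMeasurable
        refine hMm.comp_quasiMeasurePreserving ?_
        have hq1 : Measure.QuasiMeasurePreserving (fun η : E => ε • η) := by
          refine ⟨measurable_const_smul ε, ?_⟩
          rw [Measure.map_addHaar_smul _ (ne_of_gt hε)]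
          exact Measure.smul_absolutelyContinuous
        exact (measurePreserving_add_left volume ξ₀).quasiMeasurePreserving.comp hq1
      · refine Eventually.of_forall fun ε => Eventually.of_forall fun η => ?_
        rw [norm_mul]
        gcongr
        exact hMC _
      · refine Eventually.of_forall fun η => Tendsto.mul_const _ ?_
        have h2 : Tendsto (fun ε : ℝ => ξ₀ + ε • η) (𝓝 0) (𝓝 ξ₀) := by
          have : Continuous fun ε : ℝ => ξ₀ + ε • η := by fun_prop
          have h3 := this.tendsto 0
          simpa using h3
        exact (hcont.tendsto.comp h2).mono_left nhdsWithin_le_nhds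
    have h2 := h1.const_mul (1 / (2 * Real.pi : ℂ) ^ Module.finrank ℝ E)
    rw [integral_const_mul, integral_testFourier, hχ, Complex.ofReal_one, mul_one] at h2
    convert h2 using 2
    field_simp
  refine tendsto_nhds_unique (hL.congr' ?_) hR
  filter_upwards [self_mem_nhdsWithin] with ε hε
  exact key ε hε

end Inversion

/-! ### Polar coordinates -/

section Polar

variable {n : ℕ}

/-- Integration in polar coordinates. -/
lemma integral_polar [Nontrivial (Euc n)] {g : Euc n → ℂ} (hg : Integrable g) :
    ∫ ξ, g ξ = ∫ α : Metric.sphere (0 : Euc n) 1, (∫ r in Ioi (0 : ℝ),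
      ((r ^ (n - 1) : ℝ) : ℂ) * g (r • (α : Euc n))) ∂(volume : Measure (Euc n)).toSphere := by
  set μ : Measure (Euc n) := volume
  have hmp := μ.measurePreserving_homeomorphUnitSphereProd
  have hme := (homeomorphUnitSphereProd (Euc n)).measurableEmbedding
  let k : Metric.sphere (0 : Euc n) 1 × Ioi (0 : ℝ) → ℂ := fun p => g ((p.2 : ℝ) • (p.1 : Euc n))
  have hk : ∀ x : ({0}ᶜ : Set (Euc n)), k (homeomorphUnitSphereProd (Euc n) x) = g x := by
    intro x
    have hx : ‖(x : Euc n)‖ ≠ 0 := norm_ne_zero_iff.mpr x.2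
    simp only [k, homeomorphUnitSphereProd_apply_snd_coe, homeomorphUnitSphereProd_apply_fst_coe]
    rw [smul_smul, mul_inv_cancel₀ hx, one_smul]
  have hint : Integrable k (μ.toSphere.prod (.volumeIoiPow (Module.finrank ℝ (Euc n) - 1))) := by
    rw [← hmp.integrable_comp_emb hme]
    have h1 : Integrable (fun x : ({0}ᶜ : Set (Euc n)) => g x) (μ.comap (↑)) :=
      (integrableOn_iff_comap_subtypeVal (measurableSet_singleton _).compl).mp hg.integrableOn
    exact h1.congr (Eventually.of_forall fun x => (hk x).symm)
  calc ∫ ξ, g ξ = ∫ x : ({0}ᶜ : Set (Euc n)), g x ∂(μ.comap (↑)) := by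
        rw [integral_subtype_comap (measurableSet_singleton _).compl fun x ↦ g x,
          restrict_compl_singleton]
    _ = ∫ p, k p ∂(μ.toSphere.prod (.volumeIoiPow (Module.finrank ℝ (Euc n) - 1))) := by
        rw [← hmp.integral_comp hme]
        exact integral_congr_ae (Eventually.of_forall fun x => (hk x).symm)
    _ = _ := by
        rw [integral_prod _ hint]
        refine integral_congr_ae (Eventually.of_forall fun α => ?_)
        simp only [Measure.volumeIoiPow, ENNReal.ofReal, finrank_euclideanSpace_fin]
        rw [integral_withDensity_eq_integral_smul]
        · rw [integral_subtype_comap measurableSet_Ioi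
            fun a ↦ Real.toNNReal (a ^ (n - 1)) • g (a • (α : Euc n))]
          refine setIntegral_congr_fun measurableSet_Ioi fun x hx ↦ ?_
          simp only [NNReal.smul_def, Real.coe_toNNReal _ (pow_nonneg hx.out.le _),
            Complex.real_smul]
        · exact (measurable_subtype_coe.pow_const _).real_toNNReal

/-- The Jacobian `r ^ (n - 1)` cancels the singularity at the origin, and two powers beyond the
growth `L` give convergence at infinity. -/
lemma integrable_of_norm_le_radial [Nontrivial (Euc n)] {M : Euc n → ℂ}
    (hm : AEStronglyMeasurable M) {C : ℝ} {L : ℕ}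
    (hb : ∀ ξ, ξ ≠ 0 → ‖M ξ‖ ≤ C * ((‖ξ‖ ^ (n - 1))⁻¹ * (1 + ‖ξ‖) ^ L)) :
    Integrable fun ξ => M ξ * (((1 + ‖ξ‖) ^ (L + 2))⁻¹ : ℝ) := by
  have h1 : Integrable fun ξ : Euc n => (‖ξ‖ ^ (n - 1))⁻¹ * ((1 + ‖ξ‖) ^ 2)⁻¹ := by
    rw [integrable_fun_norm_addHaar (volume : Measure (Euc n))
      (f := fun y : ℝ => (y ^ (n - 1))⁻¹ * ((1 + y) ^ 2)⁻¹)]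
    have h2 : IntegrableOn (fun y : ℝ => (1 + y ^ 2)⁻¹) (Ioi 0) :=
      integrable_inv_one_add_sq.integrableOn
    refine h2.mono' (Measurable.aestronglyMeasurable (by fun_prop)) ?_
    filter_upwards [ae_restrict_mem measurableSet_Ioi] with y hy
    have hy' : 0 < y := hy
    rw [finrank_euclideanSpace_fin, smul_eq_mul, mul_inv_cancel_left₀ (by positivity),
      Real.norm_of_nonneg (by positivity)]
    gcongr
    nlinarith
  refine (h1.const_mul C).mono' (hm.mul (Continuous.aestronglyMeasurable ?_)) ?_
  · refine Complex.continuous_ofReal.comp (Continuous.inv₀ (by fun_prop) fun ξ => ?_)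
    positivity
  · have h0 : ∀ᵐ ξ : Euc n, ξ ≠ 0 := by
      rw [ae_iff]
      simp
    filter_upwards [h0] with ξ hξ
    have hn : 0 < ‖ξ‖ := norm_pos_iff.mpr hξ
    rw [norm_mul, Complex.norm_real, Real.norm_of_nonneg (by positivity)]
    calc ‖M ξ‖ * ((1 + ‖ξ‖) ^ (L + 2))⁻¹
        ≤ C * ((‖ξ‖ ^ (n - 1))⁻¹ * (1 + ‖ξ‖) ^ L) * ((1 + ‖ξ‖) ^ (L + 2))⁻¹ := by
          gcongr
          exact hb ξ hξ
      _ = C * ((‖ξ‖ ^ (n - 1))⁻¹ * ((1 + ‖ξ‖) ^ 2)⁻¹) := by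
          rw [pow_add]
          field_simp

end Polar

/-! ### Filtered backprojection as a Fourier multiplier -/

section Symbols

variable {n : ℕ}

lemma mixedDerivNorm_zero (D : Euc n → ℝ → ℂ) {α : Euc n} (hα : ‖α‖ = 1) (r : ℝ) :
    mixedDerivNorm D 0 0 α r = ‖D α r‖ := by
  rw [mixedDerivNorm, norm_iteratedFDeriv_zero]
  simp only [iteratedDeriv_zero, unitDir_of_norm_eq_one hα]

lemma SmoothOnSphere.exists_bound {F : Type*} [NormedAddCommGroup F] [NormedSpace ℝ F]
    {a : Euc n → F} (ha : SmoothOnSphere a) : ∃ C, 0 ≤ C ∧ ∀ α : Euc n, ‖α‖ = 1 → ‖a α‖ ≤ C := by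
  have h1 : ContinuousOn (fun ξ => a (unitDir ξ)) (Metric.sphere 0 1) :=
    ha.continuousOn.mono fun ξ hξ h => by
      rw [mem_singleton_iff.mp h] at hξ
      simp at hξ
  obtain ⟨C, hC⟩ := (isCompact_sphere (0 : Euc n) 1).exists_bound_of_continuousOn h1
  refine ⟨max C 0, le_max_right _ _, fun α hα => ?_⟩
  have := hC α (by simpa using hα)
  rw [unitDir_of_norm_eq_one hα] at this
  exact this.trans (le_max_left _ _)

variable {B : Euc n → ℝ → ℂ} {β : ℕ → ℝ} {Bj : ℕ → Euc n → ℂ}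

lemma IsFilterSymbol.exists_remainder_bound (hB : IsFilterSymbol B β Bj) (J : ℕ) :
    ∃ C, 0 ≤ C ∧ ∀ α : Euc n, ‖α‖ = 1 → ∀ r : ℝ, 1 ≤ r →
      ‖B α r - ∑ j ∈ Finset.range J, ((r ^ (β j) : ℝ) : ℂ) * Bj j α‖ ≤ C * r ^ (β J) := by
  obtain ⟨C, hC⟩ := hB.expansion J 0 0
  refine ⟨max C 0, le_max_right _ _, fun α hα r hr => ?_⟩
  have := hC α hα r hr
  rw [mixedDerivNorm_zero _ hα, Nat.cast_zero, sub_zero] at this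
  refine this.trans ?_
  gcongr
  exact le_max_left _ _

lemma IsFilterSymbol.continuousOn (hB : IsFilterSymbol B β Bj) :
    ContinuousOn (fun q : Euc n × ℝ => B (unitDir q.1) q.2) ({0}ᶜ ×ˢ univ) := hB.smooth.continuousOn

lemma IsFilterSymbol.exists_bound_unit (hB : IsFilterSymbol B β Bj) :
    ∃ C, 0 ≤ C ∧ ∀ α : Euc n, ‖α‖ = 1 → ∀ r : ℝ, 0 ≤ r → r ≤ 1 → ‖B α r‖ ≤ C := by
  have h1 : ContinuousOn (fun q : Euc n × ℝ => B (unitDir q.1) q.2)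
      (Metric.sphere 0 1 ×ˢ Icc 0 1) := hB.continuousOn.mono fun q hq => by
    refine ⟨fun h => ?_, mem_univ _⟩
    have := hq.1
    rw [mem_singleton_iff.mp h] at this
    simp at this
  obtain ⟨C, hC⟩ := ((isCompact_sphere (0 : Euc n) 1).prod
    (isCompact_Icc (a := (0 : ℝ)) (b := 1))).exists_bound_of_continuousOn h1
  refine ⟨max C 0, le_max_right _ _, fun α hα r hr hr1 => ?_⟩
  have := hC (α, r) ⟨by simpa using hα, hr, hr1⟩
  simp only [unitDir_of_norm_eq_one hα] at this
  exact this.trans (le_max_left _ _)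

/-- For `r ≥ 1` this is the expansion truncated at `J = 0`, for `0 ≤ r ≤ 1` compactness, and for
negative `r` the evenness of `B`. -/
lemma IsFilterSymbol.exists_growth (hB : IsFilterSymbol B β Bj) :
    ∃ (C : ℝ) (L : ℕ), 0 ≤ C ∧ ∀ α : Euc n, ‖α‖ = 1 → ∀ r : ℝ, ‖B α r‖ ≤ C * (1 + |r|) ^ L := by
  obtain ⟨C₁, h₁, H₁⟩ := hB.exists_bound_unit
  obtain ⟨C₂, h₂, H₂⟩ := hB.exists_remainder_bound 0
  have key : ∀ α : Euc n, ‖α‖ = 1 → ∀ r : ℝ, 0 ≤ r →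
      ‖B α r‖ ≤ (C₁ + C₂) * (1 + |r|) ^ ⌈β 0⌉₊ := by
    intro α hα r hr
    rw [abs_of_nonneg hr]
    have hone : 1 ≤ (1 + r) ^ ⌈β 0⌉₊ := one_le_pow₀ (by linarith)
    rcases le_total r 1 with h | h
    · calc ‖B α r‖ ≤ C₁ := H₁ α hα r hr h
        _ ≤ (C₁ + C₂) * 1 := by linarith
        _ ≤ _ := by gcongr
    · have := H₂ α hα r h
      rw [Finset.sum_range_zero, sub_zero] at this
      calc ‖B α r‖ ≤ C₂ * r ^ (β 0) := this
        _ ≤ C₂ * (1 + r) ^ ⌈β 0⌉₊ := by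
            gcongr
            rw [← Real.rpow_natCast]
            calc r ^ (β 0) ≤ r ^ ((⌈β 0⌉₊ : ℕ) : ℝ) :=
                  Real.rpow_le_rpow_of_exponent_le h (Nat.le_ceil _)
              _ ≤ (1 + r) ^ ((⌈β 0⌉₊ : ℕ) : ℝ) := by gcongr; linarith
        _ ≤ _ := by gcongr; linarith
  refine ⟨C₁ + C₂, ⌈β 0⌉₊, by positivity, fun α hα r => ?_⟩
  rcases le_total 0 r with hr | hr
  · exact key α hα r hr
  · have := key (-α) (by rwa [norm_neg]) (-r) (by linarith)
    rwa [hB.even α hα r, abs_neg] at this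

/-- The Fourier multiplier of the filtered backprojection of the Radon transform of a function
with Fourier transform `F`. -/
def backprojectionMultiplier (B : Euc n → ℝ → ℂ) (F : Euc n → ℂ) (ξ : Euc n) : ℂ :=
  (1 / Real.pi : ℂ) * (((‖ξ‖ ^ (n - 1))⁻¹ : ℝ) : ℂ) * B (unitDir ξ) ‖ξ‖ * F ξ

lemma IsFilterSymbol.continuousOn_multiplier (hB : IsFilterSymbol B β Bj) {F : Euc n → ℂ}
    (hF : ContinuousOn F {0}ᶜ) : ContinuousOn (backprojectionMultiplier B F) {0}ᶜ := by
  have h1 : ContinuousOn (fun ξ : Euc n => B (unitDir ξ) ‖ξ‖) {0}ᶜ :=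
    hB.continuousOn.comp (f := fun ξ : Euc n => (ξ, ‖ξ‖)) (by fun_prop) fun ξ hξ => ⟨hξ, mem_univ _⟩
  have h2 : ContinuousOn (fun ξ : Euc n => (((‖ξ‖ ^ (n - 1))⁻¹ : ℝ) : ℂ)) {0}ᶜ := by
    refine Complex.continuous_ofReal.comp_continuousOn (ContinuousOn.inv₀ (by fun_prop) ?_)
    intro ξ hξ
    exact pow_ne_zero _ (norm_ne_zero_iff.mpr hξ)
  exact ((continuousOn_const.mul h2).mul h1).mul hF

lemma IsFilterSymbol.exists_integrable_multiplier [Nontrivial (Euc n)]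
    (hB : IsFilterSymbol B β Bj) {F : Euc n → ℂ}
    (hF : ContinuousOn F {0}ᶜ) {CF : ℝ} (hFb : ∀ ξ, ‖F ξ‖ ≤ CF) :
    ∃ N : ℕ, Integrable fun ξ => backprojectionMultiplier B F ξ * (((1 + ‖ξ‖) ^ N)⁻¹ : ℝ) := by
  obtain ⟨C, L, hC0, hC⟩ := hB.exists_growth
  refine ⟨L + 2, integrable_of_norm_le_radial (C := 1 / Real.pi * C * CF)
    (aestronglyMeasurable_of_continuousOn_compl_zero (hB.continuousOn_multiplier hF))
    fun ξ hξ => ?_⟩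
  have hCF : 0 ≤ CF := (norm_nonneg _).trans (hFb 0)
  have h1 := hC (unitDir ξ) (norm_unitDir hξ) ‖ξ‖
  rw [abs_of_nonneg (norm_nonneg ξ)] at h1
  have h2 : ‖(1 / Real.pi : ℂ)‖ = 1 / Real.pi := by
    rw [norm_div, norm_one, Complex.norm_real, Real.norm_of_nonneg Real.pi_pos.le]
  rw [backprojectionMultiplier, norm_mul, norm_mul, norm_mul, h2, Complex.norm_real,
    Real.norm_of_nonneg (by positivity)]
  calc 1 / Real.pi * (‖ξ‖ ^ (n - 1))⁻¹ * ‖B (unitDir ξ) ‖ξ‖‖ * ‖F ξ‖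
      ≤ 1 / Real.pi * (‖ξ‖ ^ (n - 1))⁻¹ * (C * (1 + ‖ξ‖) ^ L) * CF := by
        have := Real.pi_pos
        gcongr
        exact hFb ξ
    _ = _ := by ring

lemma exists_schwartz_decay {E : Type*} [NormedAddCommGroup E] [InnerProductSpace ℝ E]
    [FiniteDimensional ℝ E] [MeasurableSpace E] [BorelSpace E] (g : 𝓢(E, ℂ)) (N : ℕ) :
    ∃ C, 0 ≤ C ∧ ∀ ξ, ‖g ξ‖ ≤ C * ((1 + ‖ξ‖) ^ N)⁻¹ := by
  refine ⟨2 ^ N * (Finset.Iic (N, 0)).sup (schwartzSeminormFamily ℝ E ℂ) g, by positivity,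
    fun ξ => ?_⟩
  have := norm_mul_schwartz_le (fun _ => 1) N g ξ
  rw [one_mul, one_mul, Complex.norm_real, Real.norm_of_nonneg (by positivity)] at this
  linarith

lemma integral_real_eq_Ioi_add {G : ℝ → ℂ} (hG : Integrable G) :
    ∫ r, G r = (∫ r in Ioi (0 : ℝ), G r) + ∫ r in Ioi (0 : ℝ), G (-r) := by
  have h1 := intervalIntegral.integral_Iic_add_Ioi (b := (0 : ℝ)) hG.integrableOn hG.integrableOn
  have h2 := integral_comp_neg_Ioi 0 G
  rw [neg_zero] at h2
  rw [← h1, h2, add_comm]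

/-- Filtered backprojection of a Radon transform is a Fourier multiplier. -/
lemma IsFilterSymbol.filteredBackprojection_eq [Nontrivial (Euc n)] (hB : IsFilterSymbol B β Bj)
    {f : Euc n → ℂ} (hf : Integrable f) {F : Euc n → ℂ}
    (hF : ContinuousOn F {0}ᶜ) {CF : ℝ} (hFb : ∀ ξ, ‖F ξ‖ ≤ CF)
    (hFf : ∀ ξ, ξ ≠ 0 → ∫ x, Complex.exp (Complex.I * (⟪ξ, x⟫ : ℝ)) * f x = F ξ)
    (φ : 𝓓((⊤ : Opens (Euc n)), ℝ)) : filteredBackprojection B (radon f) φ =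
      ∫ ξ, backprojectionMultiplier B F ξ * testFourier φ ξ := by
  have hCF : 0 ≤ CF := (norm_nonneg _).trans (hFb 0)
  set M := backprojectionMultiplier B F with hMdef
  obtain ⟨N, hN⟩ := hB.exists_integrable_multiplier hF hFb
  have hint := integrable_mul_schwartz hN (testFourier φ)
  let G : Euc n → ℝ → ℂ := fun α r => B α r * (F (r • α) * testFourier φ (r • α))
  have hGint : ∀ α : Euc n, ‖α‖ = 1 → Integrable (G α) := by
    intro α hα
    have hα0 : α ≠ 0 := fun h => by simp [h] at hα
    obtain ⟨C, L, hC0, hC⟩ := hB.exists_growth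
    obtain ⟨C', hC'0, hC'⟩ := exists_schwartz_decay (testFourier φ) (L + 2)
    refine (integrable_inv_one_add_sq.const_mul (C * (CF * C'))).mono' ?_ ?_
    · refine aestronglyMeasurable_of_continuousOn_compl_zero ?_
      have h1 : ContinuousOn (fun r : ℝ => B α r) {0}ᶜ := by
        have := hB.continuousOn.comp (f := fun r : ℝ => (α, r)) (s := {0}ᶜ) (by fun_prop)
          fun r _ => ⟨hα0, mem_univ _⟩
        simpa only [Function.comp_def, unitDir_of_norm_eq_one hα] using this
      have h2 : ContinuousOn (fun r : ℝ => F (r • α)) {0}ᶜ :=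
        hF.comp (by fun_prop) fun r hr => smul_ne_zero hr hα0
      have h3 : Continuous fun r : ℝ => testFourier φ (r • α) :=
        (testFourier φ).continuous.comp (by fun_prop)
      exact h1.mul (h2.mul h3.continuousOn)
    · refine Eventually.of_forall fun r => ?_
      have e1 := hC' (r • α)
      rw [norm_smul, hα, mul_one, Real.norm_eq_abs] at e1
      simp only [G]
      rw [norm_mul, norm_mul]
      calc ‖B α r‖ * (‖F (r • α)‖ * ‖testFourier φ (r • α)‖)
          ≤ C * (1 + |r|) ^ L * (CF * (C' * ((1 + |r|) ^ (L + 2))⁻¹)) := by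
            gcongr
            · exact hC α hα r
            · exact hFb _
        _ = C * (CF * C') * ((1 + |r|) ^ 2)⁻¹ := by
            rw [pow_add]
            field_simp
        _ ≤ C * (CF * C') * (1 + r ^ 2)⁻¹ := by
            gcongr
            rw [← sq_abs r]
            nlinarith [abs_nonneg r]
  -- The integral over `p` is the Fourier transform of `f` at `r • α` by the slice theorem; the
  -- integral over `x` is that of `φ`.
  have hinner : ∀ α : Euc n, ‖α‖ = 1 → ∀ r : ℝ, r ≠ 0 →
      (∫ x : Euc n, ∫ p : ℝ,
        Complex.exp (-(Complex.I * r * ((⟪α, x⟫ - p : ℝ) : ℂ))) * radon f α p * (φ x : ℂ)) =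
      F (r • α) * testFourier φ (r • α) := by
    intro α hα r hr
    have hα0 : α ≠ 0 := fun h => by simp [h] at hα
    rw [← hFf _ (smul_ne_zero hr hα0), ← integral_exp_mul_radon hα hf r, testFourier_apply,
      ← integral_const_mul]
    refine integral_congr_ae (Eventually.of_forall fun x => ?_)
    simp only []
    rw [← integral_mul_const]
    refine integral_congr_ae (Eventually.of_forall fun p => ?_)
    simp only [real_inner_smul_left]
    have : Complex.exp (-(Complex.I * r * ((⟪α, x⟫ - p : ℝ) : ℂ))) =
        Complex.exp (Complex.I * (r * p : ℝ)) * Complex.exp (-(Complex.I * (r * ⟪α, x⟫ : ℝ))) := by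
      rw [← Complex.exp_add]
      congr 1
      push_cast
      ring
    rw [this]
    ring
  have hneg : Integrable fun ξ => M (-ξ) * testFourier φ (-ξ) := hint.comp_neg
  -- Polar coordinates use only `r > 0`, whereas the operator integrates over all real `r`.
  -- Symmetrising the integrand under `ξ ↦ -ξ` makes the two agree direction by direction.
  have hpol := integral_polar ((hint.add hneg).const_mul (1 / 2 : ℂ))
  have hM : ∀ α : Euc n, ‖α‖ = 1 → ∀ r : ℝ, 0 < r →
      ((r ^ (n - 1) : ℝ) : ℂ) * (M (r • α) * testFourier φ (r • α)) = (1 / Real.pi : ℂ) * G α r := by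
    intro α hα r hr
    have h1 : ‖r • α‖ = r := by rw [norm_smul, hα, mul_one, Real.norm_of_nonneg hr.le]
    have h2 : ((r ^ (n - 1) : ℝ) : ℂ) ≠ 0 := by exact_mod_cast (pow_pos hr _).ne'
    simp only [hMdef, backprojectionMultiplier, G]
    rw [h1, unitDir_smul hr, unitDir_of_norm_eq_one hα, Complex.ofReal_inv]
    field_simp
  have htot : ∫ ξ, (1 / 2 : ℂ) * (M ξ * testFourier φ ξ + M (-ξ) * testFourier φ (-ξ)) =
      ∫ ξ, M ξ * testFourier φ ξ := by
    rw [integral_const_mul, integral_add hint hneg,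
      integral_neg_eq_self (fun ξ => M ξ * testFourier φ ξ)]
    ring
  rw [← htot]
  refine Eq.trans ?_ hpol.symm
  refine integral_congr_ae (Eventually.of_forall fun α => ?_)
  have hα : ‖(α : Euc n)‖ = 1 := by simp
  have hα' : ‖-(α : Euc n)‖ = 1 := by rwa [norm_neg]
  have e1 : (∫ r : ℝ, B α r * ∫ x : Euc n, ∫ p : ℝ,
        Complex.exp (-(Complex.I * r * ((⟪(α : Euc n), x⟫ - p : ℝ) : ℂ))) * radon f α p *
          (φ x : ℂ)) = ∫ r, G α r := by
    have h0 : ∀ᵐ r : ℝ, r ≠ 0 := by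
      rw [ae_iff]
      simp
    refine integral_congr_ae ?_
    filter_upwards [h0] with r hr
    simp only [G, hinner α hα r hr]
  -- Evenness of `B` moves negative `r` to the antipodal direction.
  have e2 : ∀ r : ℝ, G α (-r) = G (-(α : Euc n)) r := by
    intro r
    simp only [G, neg_smul, smul_neg]
    congr 1
    have := hB.even (-(α : Euc n)) hα' r
    rwa [neg_neg] at this
  simp only []
  rw [e1, integral_real_eq_Ioi_add (hGint α hα)]
  simp only [e2]
  rw [← integral_add (hGint _ hα).integrableOn (hGint _ hα').integrableOn, ← integral_const_mul]
  refine setIntegral_congr_fun measurableSet_Ioi fun r hr => ?_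
  have f1 := hM α hα r hr
  have f2 := hM (-α) hα' r hr
  simp only [Pi.add_apply]
  rw [smul_neg] at f2
  have hpi : (Real.pi : ℂ) ≠ 0 := by exact_mod_cast Real.pi_ne_zero
  have f3 : (1 / (2 * Real.pi : ℂ)) = (1 / 2) * (1 / Real.pi) := by field_simp
  rw [f3]
  linear_combination (-1 / 2 : ℂ) * f1 - (1 / 2 : ℂ) * f2

end Symbols

/-! ### Fourier transforms of differentiated and rescaled test functions -/

section TestFourier

variable {E : Type*} [NormedAddCommGroup E] [InnerProductSpace ℝ E] [FiniteDimensional ℝ E]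
  [MeasurableSpace E] [BorelSpace E]

variable (E) in
/-- The Fourier transform of test functions as a continuous linear map. -/
def testFourierCLM : 𝓓((⊤ : Opens E), ℝ) →L[ℝ] 𝓢(E, ℂ) :=
  (angularFourier E).comp (testToSchwartzCLM E)

lemma testFourierCLM_apply (φ : 𝓓((⊤ : Opens E), ℝ)) : testFourierCLM E φ = testFourier φ := rfl

lemma lineDeriv_testFunction_apply (e x : E) (φ : 𝓓((⊤ : Opens E), ℝ)) :
    (∂_{e} φ : 𝓓((⊤ : Opens E), ℝ)) x = fderiv ℝ φ x e := by
  have h := TestFunction.lineDerivCLM_apply_of_le (𝕜 := ℝ) (f := φ) (v := e) (x := x)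
    (k := ⊤) (n := ⊤) le_top
  rw [← (φ.contDiff.differentiable (by simp)).differentiableAt.lineDeriv_eq_fderiv]
  exact h

lemma toSchwartz_lineDeriv (e : E) (φ : 𝓓((⊤ : Opens E), ℝ)) :
    TestFunction.toSchwartz (∂_{e} φ) = ∂_{e} (TestFunction.toSchwartz φ) := by
  ext x
  rw [TestFunction.toSchwartz_apply, lineDeriv_testFunction_apply, lineDerivOp_apply_eq_fderiv]
  have h1 : HasFDerivAt φ (fderiv ℝ φ x) x :=
    (φ.contDiff.differentiable (by simp)).differentiableAt.hasFDerivAt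
  have h2 := Complex.ofRealCLM.hasFDerivAt.comp x h1
  exact (congrArg (fun L : E →L[ℝ] ℂ => L e) h2.fderiv).symm

lemma testFourier_lineDeriv (e : E) (φ : 𝓓((⊤ : Opens E), ℝ)) (ξ : E) :
    testFourier (∂_{e} φ) ξ = Complex.I * (⟪e, ξ⟫ : ℝ) * testFourier φ ξ := by
  have h1 : ∀ g : 𝓢(E, ℂ), angularFourier E g ξ = (𝓕 g : 𝓢(E, ℂ)) ((2 * Real.pi)⁻¹ • ξ) :=
    fun g => rfl
  have ht : (fun x : E => ⟪x, e⟫).HasTemperateGrowth := ((innerSL ℝ).flip e).hasTemperateGrowth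
  rw [testFourier, testFourier, toSchwartz_lineDeriv, h1, h1, fourier_lineDerivOp_eq]
  rw [smul_apply, smulLeftCLM_apply_apply ht, real_inner_smul_left, real_inner_comm]
  have hpi : (Real.pi : ℂ) ≠ 0 := by exact_mod_cast Real.pi_ne_zero
  simp only [smul_eq_mul, Complex.real_smul]
  push_cast
  field_simp

lemma testFourier_iterate_lineDeriv (e : E) (k : ℕ) (φ : 𝓓((⊤ : Opens E), ℝ))
    (ξ : E) : testFourier ((fun χ : 𝓓((⊤ : Opens E), ℝ) => ∂_{e} χ)^[k] φ) ξ =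
      (Complex.I * (⟪e, ξ⟫ : ℝ)) ^ k * testFourier φ ξ := by
  induction k with
  | zero => simp
  | succ k ih =>
    rw [Function.iterate_succ_apply', testFourier_lineDeriv, ih, pow_succ]
    ring

lemma rescale_apply (x₀ : E) {ε : ℝ} (hε : 0 < ε) (w : 𝓓((⊤ : Opens E), ℝ)) (x : E) :
    rescale x₀ ε w x = (ε ^ Module.finrank ℝ E)⁻¹ * w (ε⁻¹ • (x - x₀)) := by
  rw [rescale, dif_pos hε]
  rfl

lemma integral_mul_rescale (x₀ : E) {ε : ℝ} (hε : 0 < ε) (w : 𝓓((⊤ : Opens E), ℝ)) (k : E → ℂ) :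
    ∫ x, k x * (rescale x₀ ε w x : ℂ) = ∫ y, k (x₀ + ε • y) * (w y : ℂ) := by
  rw [← integral_add_left_eq_self (μ := (volume : Measure E)) _ x₀]
  have h := Measure.integral_comp_smul_of_nonneg (volume : Measure E)
    (fun y => k (x₀ + y) * (w (ε⁻¹ • y) : ℂ)) ε (hR := hε.le)
  simp only [inv_smul_smul₀ hε.ne'] at h
  rw [h, Complex.real_smul, ← integral_const_mul]
  refine integral_congr_ae (Eventually.of_forall fun y => ?_)
  simp only [rescale_apply x₀ hε, add_sub_cancel_left]
  push_cast
  ring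

lemma testFourier_rescale (x₀ : E) {ε : ℝ} (hε : 0 < ε) (w : 𝓓((⊤ : Opens E), ℝ)) (ξ : E) :
    testFourier (rescale x₀ ε w) ξ =
      Complex.exp (-(Complex.I * (⟪ξ, x₀⟫ : ℝ))) * testFourier w (ε • ξ) := by
  rw [testFourier_apply, testFourier_apply, integral_mul_rescale x₀ hε, ← integral_const_mul]
  refine integral_congr_ae (Eventually.of_forall fun y => ?_)
  simp only []
  rw [← mul_assoc, ← Complex.exp_add, inner_add_right, real_inner_smul_right, real_inner_smul_left]
  congr 2
  push_cast
  ring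

end TestFourier

/-! ### Fourier transforms of `P(∂) w` -/

section PolyDeriv

variable {n : ℕ}

lemma testFourier_multiDeriv (ν : Fin n →₀ ℕ) (φ : 𝓓((⊤ : Opens (Euc n)), ℝ)) (ξ : Euc n) :
    testFourier (multiDeriv ν φ) ξ = (∏ i, (Complex.I * (ξ i : ℂ)) ^ ν i) * testFourier φ ξ := by
  have key : ∀ l : List (Fin n), testFourier (l.foldr
      (fun i φ => (fun χ : 𝓓((⊤ : Opens (Euc n)), ℝ) =>
        ∂_{EuclideanSpace.single i (1 : ℝ)} χ)^[ν i] φ) φ) ξ =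
      (l.map fun i => (Complex.I * (ξ i : ℂ)) ^ ν i).prod * testFourier φ ξ := by
    intro l
    induction l with
    | nil => simp
    | cons i l ih =>
      rw [List.foldr_cons, testFourier_iterate_lineDeriv, ih, List.map_cons, List.prod_cons,
        EuclideanSpace.inner_single_left]
      simp only [map_one, one_mul]
      ring
  rw [multiDeriv, key, ← List.ofFn_eq_map, List.prod_ofFn]

lemma sum_exponents_of_isHomogeneous {P : MvPolynomial (Fin n) ℝ} {m : ℕ}
    (hP : P.IsHomogeneous m) {ν : Fin n →₀ ℕ} (hν : ν ∈ P.support) : ∑ i, ν i = m := by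
  have := hP (MvPolynomial.mem_support_iff.mp hν)
  simpa [Finsupp.weight_apply, Finsupp.sum_fintype] using this

/-- The Fourier transform of `P(∂) φ`, for `P` homogeneous of degree `m`. -/
lemma testFourier_polyDeriv {P : MvPolynomial (Fin n) ℝ} {m : ℕ} (hP : P.IsHomogeneous m)
    (φ : 𝓓((⊤ : Opens (Euc n)), ℝ)) (ξ : Euc n) :
    testFourier (polyDeriv P φ) ξ =
      Complex.I ^ m * (MvPolynomial.eval (fun i => ξ i) P : ℝ) * testFourier φ ξ := by
  rw [polyDeriv, ← testFourierCLM_apply, map_sum]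
  simp only [map_smul, testFourierCLM_apply, sum_apply, smul_apply, testFourier_multiDeriv]
  rw [MvPolynomial.eval_eq', Complex.ofReal_sum, Finset.mul_sum, Finset.sum_mul]
  refine Finset.sum_congr rfl fun ν hν => ?_
  have hdeg := sum_exponents_of_isHomogeneous hP hν
  simp only [mul_pow]
  rw [Finset.prod_mul_distrib, Finset.prod_pow_eq_pow_sum, hdeg]
  push_cast
  rw [Complex.real_smul]
  ring

lemma eval_smul_of_isHomogeneous {P : MvPolynomial (Fin n) ℝ} {m : ℕ} (hP : P.IsHomogeneous m)
    (r : ℝ) (ξ : Euc n) : MvPolynomial.eval (fun i => (r • ξ) i) P =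
      r ^ m * MvPolynomial.eval (fun i => ξ i) P := by
  rw [MvPolynomial.eval_eq', MvPolynomial.eval_eq', Finset.mul_sum]
  refine Finset.sum_congr rfl fun ν hν => ?_
  have hdeg := sum_exponents_of_isHomogeneous hP hν
  simp only [PiLp.smul_apply, smul_eq_mul, mul_pow]
  rw [Finset.prod_mul_distrib, Finset.prod_pow_eq_pow_sum, hdeg]
  ring

lemma contDiff_eval (P : MvPolynomial (Fin n) ℝ) :
    ContDiff ℝ ∞ fun ξ : Euc n => MvPolynomial.eval (fun i => ξ i) P := by
  simp only [MvPolynomial.eval_eq']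
  fun_prop

lemma exists_abs_eval_le {P : MvPolynomial (Fin n) ℝ} {m : ℕ} (hP : P.IsHomogeneous m) :
    ∃ C, 0 ≤ C ∧ ∀ ξ : Euc n, |MvPolynomial.eval (fun i => ξ i) P| ≤ C * ‖ξ‖ ^ m := by
  obtain ⟨C, hC⟩ := (isCompact_closedBall (0 : Euc n) 1).exists_bound_of_continuousOn
    (contDiff_eval P).continuous.continuousOn
  refine ⟨max C 0, le_max_right _ _, fun ξ => ?_⟩
  have h0 : ‖unitDir ξ‖ ≤ 1 := by
    by_cases hξ : ξ = 0
    · simp [hξ, unitDir]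
    · exact (norm_unitDir hξ).le
  have h1 := hC (unitDir ξ) (by simpa using h0)
  have h2 := eval_smul_of_isHomogeneous hP ‖ξ‖ (unitDir ξ)
  rw [norm_smul_unitDir] at h2
  rw [h2, abs_mul, abs_of_nonneg (by positivity), mul_comm]
  gcongr
  exact h1.trans (le_max_left _ _)

end PolyDeriv

/-! ### Bounds on the amplitude and the Fourier transform of `f` -/

section Amplitude

variable {n : ℕ} {Ω : Set (Euc n)} {H : Euc n → ℝ} {v : Euc n → ℂ} {s : ℕ → ℝ}
  {vj : ℕ → Euc n → ℂ}

lemma IsAmplitude.exists_remainder_bound (hv : IsAmplitude Ω H v s vj) (J : ℕ) :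
    ∃ C, 0 ≤ C ∧ ∀ α : Euc n, ‖α‖ = 1 → ∀ r : ℝ, 1 ≤ r →
      ‖v (r • α) - omegaFactor H α * ∑ j ∈ Finset.range J, ((r ^ (-s j) : ℝ) : ℂ) * vj j α‖ ≤
        C * r ^ (-s J) := by
  obtain ⟨a, ha, haC⟩ := hv.expansion J 0 0
  obtain ⟨C, hC0, hC⟩ := ha.1.exists_bound
  refine ⟨C, hC0, fun α hα r hr => ?_⟩
  have := haC α hα r hr
  rw [mixedDerivNorm_zero _ hα, Nat.cast_zero, add_zero] at this
  refine this.trans ?_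
  gcongr
  exact (le_abs_self _).trans (hC α hα)

lemma IsAmplitude.exists_bound_one_le (hv : IsAmplitude Ω H v s vj) :
    ∃ C, 0 ≤ C ∧ ∀ ξ : Euc n, 1 ≤ ‖ξ‖ → ‖v ξ‖ ≤ C * ‖ξ‖ ^ (-s 0) := by
  obtain ⟨C, hC0, hC⟩ := hv.exists_remainder_bound 0
  refine ⟨C, hC0, fun ξ hξ => ?_⟩
  have hξ0 : ξ ≠ 0 := fun h => by simp [h] at hξ; linarith
  have := hC (unitDir ξ) (norm_unitDir hξ0) ‖ξ‖ hξ
  rwa [norm_smul_unitDir, Finset.sum_range_zero, mul_zero, sub_zero] at this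

lemma IsAmplitude.exists_bound (hv : IsAmplitude Ω H v s vj) : ∃ C, ∀ ξ, ‖v ξ‖ ≤ C := by
  obtain ⟨C, hC0, hC⟩ := hv.exists_bound_one_le
  obtain ⟨C', hC'⟩ := (isCompact_closedBall (0 : Euc n) 1).exists_bound_of_continuousOn
    hv.smooth.continuous.continuousOn
  refine ⟨max C C', fun ξ => ?_⟩
  have hs : 0 ≤ s 0 := by
    have := hv.exponents_ge
    have h2 : (0 : ℝ) ≤ n := n.cast_nonneg
    linarith
  rcases le_total ‖ξ‖ 1 with h | h
  · exact (hC' ξ (by simpa using h)).trans (le_max_right _ _)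
  · refine (hC ξ h).trans (le_trans ?_ (le_max_left _ _))
    exact mul_le_of_le_one_right hC0 (Real.rpow_le_one_of_one_le_of_nonpos h (by linarith))

lemma continuousOn_amplitude_mul_exp (hH : IsPhase Ω H) (hv : IsAmplitude Ω H v s vj) :
    ContinuousOn (fun ξ => v ξ * Complex.exp (Complex.I * (H ξ : ℂ))) {0}ᶜ := by
  have h1 := hH.smooth.continuousOn
  have h2 := hv.smooth.continuous.continuousOn (s := {0}ᶜ)
  fun_prop

/-- The Fourier transform of a conormal function is its amplitude times the oscillating factor. -/
lemma IsOscillatoryIntegral.fourier_eq [Nontrivial (Euc n)] (hH : IsPhase Ω H)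
    (hv : IsAmplitude Ω H v s vj) {f : Euc n → ℂ} (hf : Integrable f)
    (hfv : IsOscillatoryIntegral f v H) {ξ : Euc n} (hξ : ξ ≠ 0) :
    ∫ x, Complex.exp (Complex.I * (⟪ξ, x⟫ : ℝ)) * f x =
      v ξ * Complex.exp (Complex.I * (H ξ : ℂ)) := by
  have hc := continuousOn_amplitude_mul_exp hH hv
  obtain ⟨C, hC⟩ := hv.exists_bound
  refine integral_exp_mul_eq_of_weak (M := fun ξ => v ξ * Complex.exp (Complex.I * (H ξ : ℂ)))
    (C := C) hf (fun ξ => ?_) (aestronglyMeasurable_of_continuousOn_compl_zero hc) (fun φ => ?_)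
    (hc.continuousAt (isOpen_compl_singleton.mem_nhds hξ))
  · rw [norm_mul, norm_cexp_I_mul_real, mul_one]
    exact hC ξ
  · rw [finrank_euclideanSpace_fin, hfv φ]
    simp only [testFourier_apply]

end Amplitude

/-! ### Homogeneous extension of functions on the sphere -/

section HomogExtension

variable {n : ℕ}

/-- The extension of a function on the sphere that is homogeneous of degree `d`. -/
def homogExt (d : ℝ) (q : Euc n → ℂ) (ξ : Euc n) : ℂ := ((‖ξ‖ ^ d : ℝ) : ℂ) * q (unitDir ξ)

lemma homogExt_zero {d : ℝ} (hd : 0 < d) (q : Euc n → ℂ) : homogExt d q 0 = 0 := by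
  simp [homogExt, Real.zero_rpow hd.ne']

lemma homogExt_of_norm_eq_one (d : ℝ) (q : Euc n → ℂ) {α : Euc n} (hα : ‖α‖ = 1) :
    homogExt d q α = q α := by
  simp [homogExt, hα, unitDir_of_norm_eq_one hα]

lemma isHomogSmooth_homogExt (d : ℝ) {q : Euc n → ℂ} (hq : SmoothOnSphere q) :
    IsHomogSmooth d (homogExt d q) := by
  refine IsHomogSmooth.of_contDiffAt (fun ξ hξ => ?_) fun r hr ξ hξ => ?_
  · have h1 : ContDiffAt ℝ ∞ (fun ζ : Euc n => ‖ζ‖ ^ d) ξ :=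
      (contDiffAt_norm ℝ hξ).rpow_const_of_ne (norm_ne_zero_iff.mpr hξ)
    exact (Complex.ofRealCLM.contDiff.contDiffAt.comp ξ h1).mul
      (ContDiffOn.contDiffAt hq (isOpen_compl_singleton.mem_nhds hξ))
  · rw [homogExt, homogExt, unitDir_smul hr, norm_smul, Real.norm_of_nonneg hr.le,
      Real.mul_rpow hr.le (norm_nonneg _), Complex.real_smul]
    push_cast
    ring

lemma IsTestOnSphere.eventually_eq_zero {W : Set (Euc n)} {q : Euc n → ℂ}
    (hq : IsTestOnSphere W q) {ξ : Euc n} (hξ : ξ ≠ 0) (hW : unitDir ξ ∉ W) :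
    ∀ᶠ ζ in 𝓝 ξ, ζ ≠ 0 ∧ q (unitDir ζ) = 0 := by
  obtain ⟨K, hK, hKW, hz⟩ := hq.2
  have h1 := (contDiffAt_unitDir hξ).continuousAt.eventually
    (hK.isClosed.isOpen_compl.mem_nhds fun h => hW (hKW h))
  filter_upwards [h1, isOpen_compl_singleton.mem_nhds hξ] with ζ h2 h3
  exact ⟨h3, hz _ (norm_unitDir h3) h2⟩

/-- Products of a test function on the sphere with functions that are smooth on its domain. -/
lemma IsTestOnSphere.mul_of_contDiffAt {W : Set (Euc n)} {q p : Euc n → ℂ}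
    (hq : IsTestOnSphere W q)
    (hp : ∀ ξ : Euc n, ξ ≠ 0 → unitDir ξ ∈ W → ContDiffAt ℝ ∞ (fun ζ => p (unitDir ζ)) ξ) :
    IsTestOnSphere W fun α => p α * q α := by
  obtain ⟨K, hK, hKW, hz⟩ := hq.2
  refine ⟨fun ξ hξ => ContDiffAt.contDiffWithinAt ?_, K, hK, hKW, fun α hα hαK => ?_⟩
  · have hξ0 : ξ ≠ 0 := hξ
    by_cases hW : unitDir ξ ∈ W
    · exact (hp ξ hξ0 hW).mul (ContDiffOn.contDiffAt hq.1 (isOpen_compl_singleton.mem_nhds hξ0))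
    · refine (contDiffAt_const (c := (0 : ℂ))).congr_of_eventuallyEq ?_
      filter_upwards [hq.eventually_eq_zero hξ0 hW] with ζ hζ
      rw [hζ.2, mul_zero]
  · change p α * q α = 0
    rw [hz α hα hαK, mul_zero]

end HomogExtension

/-! ### Scaling limits of remainders and of homogeneous terms -/

section Scaling

variable {n : ℕ}

/-- A remainder that decays faster than the symbol does not contribute to the leading term. -/
lemma tendsto_rpow_mul_integral_remainder {R : Euc n → ℂ} (hR : AEStronglyMeasurable R) {C a : ℝ}
    {m : ℕ} (hm : 1 ≤ m) (ha : (m : ℝ) ≤ a)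
    (hb : ∀ ξ, ‖R ξ‖ ≤ C * ((1 + ‖ξ‖) ^ m * (1 + ‖ξ‖) ^ (-((n : ℝ) + 1)))) (g : 𝓢(Euc n, ℂ)) :
    Tendsto (fun ε : ℝ => ((ε ^ a : ℝ) : ℂ) * ∫ ξ, R ξ * g (ε • ξ)) (𝓝[>] 0) (𝓝 0) := by
  obtain ⟨Cg, hCg0, hCg⟩ := exists_schwartz_decay g m
  have hm1 : (1 : ℝ) ≤ m := by exact_mod_cast hm
  have hgc := g.continuous
  have key : Tendsto (fun ε : ℝ => ∫ ξ, ((ε ^ a : ℝ) : ℂ) * (R ξ * g (ε • ξ))) (𝓝[>] 0)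
      (𝓝 (∫ _ : Euc n, (0 : ℂ))) := by
    refine tendsto_integral_filter_of_dominated_convergence
      (fun ξ => C * Cg * (1 + ‖ξ‖) ^ (-((n : ℝ) + 1))) ?_ ?_ ?_ ?_
    · refine Eventually.of_forall fun ε => ?_
      refine (hR.mul (Continuous.aestronglyMeasurable ?_)).const_mul _
      fun_prop
    · filter_upwards [Ioo_mem_nhdsGT (show (0 : ℝ) < 1 from one_pos)] with ε hε
      refine Eventually.of_forall fun ξ => ?_
      have h1 := hCg (ε • ξ)
      rw [norm_smul, Real.norm_of_nonneg hε.1.le] at h1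
      have h2 : ε ^ a ≤ ε ^ m := by
        rw [← Real.rpow_natCast]
        exact Real.rpow_le_rpow_of_exponent_ge hε.1 hε.2.le ha
      have h3 : ε * (1 + ‖ξ‖) ≤ 1 + ε * ‖ξ‖ := by nlinarith [hε.2]
      -- For `ε ≤ 1` one has `ε (1 + ‖ξ‖) ≤ 1 + ε ‖ξ‖`. Together with `ε ^ m`, the decay of `g (ε •
      -- ξ)` thus absorbs the growth `(1 + ‖ξ‖) ^ m` uniformly in `ε`.
      have h4 : (ε * (1 + ‖ξ‖)) ^ m * ((1 + ε * ‖ξ‖) ^ m)⁻¹ ≤ 1 := by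
        have := hε.1
        rw [← div_eq_mul_inv, div_le_one (by positivity)]
        gcongr
      have hC : 0 ≤ C * ((1 + ‖ξ‖) ^ m * (1 + ‖ξ‖) ^ (-((n : ℝ) + 1))) :=
        (norm_nonneg _).trans (hb ξ)
      have hC' : 0 ≤ C := by
        by_contra hneg
        have : 0 < (1 + ‖ξ‖) ^ m * (1 + ‖ξ‖) ^ (-((n : ℝ) + 1)) := by positivity
        nlinarith
      rw [norm_mul, norm_mul, Complex.norm_real, Real.norm_of_nonneg (Real.rpow_nonneg hε.1.le _)]
      have hε0 := hε.1
      calc ε ^ a * (‖R ξ‖ * ‖g (ε • ξ)‖)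
          ≤ ε ^ m * (C * ((1 + ‖ξ‖) ^ m * (1 + ‖ξ‖) ^ (-((n : ℝ) + 1))) *
              (Cg * ((1 + ε * ‖ξ‖) ^ m)⁻¹)) := by
            gcongr
            exact hb ξ
        _ = C * Cg * (1 + ‖ξ‖) ^ (-((n : ℝ) + 1)) *
              ((ε * (1 + ‖ξ‖)) ^ m * ((1 + ε * ‖ξ‖) ^ m)⁻¹) := by
            rw [mul_pow]
            ring
        _ ≤ C * Cg * (1 + ‖ξ‖) ^ (-((n : ℝ) + 1)) * 1 := by gcongr
        _ = _ := mul_one _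
    · refine (integrable_one_add_norm ?_).const_mul _
      rw [finrank_euclideanSpace_fin]
      linarith
    · refine Eventually.of_forall fun ξ => ?_
      -- The integrand tends to zero pointwise because `a ≥ m ≥ 1` is positive.
      have h1 : Continuous fun ε : ℝ => ε ^ a :=
        continuous_id.rpow_const fun _ => Or.inr (by linarith)
      have h2 : Continuous fun ε : ℝ => ((ε ^ a : ℝ) : ℂ) * (R ξ * g (ε • ξ)) := by fun_prop
      have h3 := h2.tendsto 0
      rw [Real.zero_rpow (by linarith), Complex.ofReal_zero, zero_mul] at h3
      exact h3.mono_left nhdsWithin_le_nhds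
  rw [integral_zero] at key
  refine key.congr fun ε => ?_
  rw [integral_const_mul]

/-- Substitution `η = ε ξ`: amplitude and volume element give the power `d + n`, and the phase, of
degree one, acquires the large parameter `ε⁻¹`. -/
lemma integral_homog_scaling {d : ℝ} {c : Euc n → ℂ} (hc : IsHomogSmooth d c) (h0 : c 0 = 0)
    {h : Euc n → ℝ} (hh : IsHomogSmooth 1 h) (g : 𝓢(Euc n, ℂ)) {ε : ℝ}
    (hε : 0 < ε) : ∫ ξ, c ξ * oscFactor h 1 ξ * g (ε • ξ) =
      ((ε⁻¹ ^ (d + n) : ℝ) : ℂ) * ∫ ξ, c ξ * g ξ * oscFactor h ε⁻¹ ξ := by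
  have hε' : 0 < ε⁻¹ := inv_pos.mpr hε
  have h1 := Measure.integral_comp_smul_of_nonneg (volume : Measure (Euc n))
    (fun η => c η * g η * oscFactor h ε⁻¹ η) ε (hR := hε.le)
  have h2 : ∀ ξ : Euc n, c (ε • ξ) * g (ε • ξ) * oscFactor h ε⁻¹ (ε • ξ) =
      ((ε ^ d : ℝ) : ℂ) * (c ξ * oscFactor h 1 ξ * g (ε • ξ)) := by
    intro ξ
    by_cases hξ : ξ = 0
    · simp [hξ, h0]
    · rw [hc.homog ε hε ξ hξ, oscFactor, oscFactor, hh.homog ε hε ξ hξ, Real.rpow_one, smul_eq_mul,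
        inv_mul_cancel_left₀ hε.ne', one_mul, Complex.real_smul]
      ring
  simp_rw [h2] at h1
  rw [integral_const_mul, finrank_euclideanSpace_fin, Complex.real_smul] at h1
  have h3 : ((ε⁻¹ ^ (d + n) : ℝ) : ℂ) = ((ε ^ d : ℝ) : ℂ)⁻¹ * (((ε ^ n)⁻¹ : ℝ) : ℂ) := by
    rw [Real.rpow_add hε', Real.rpow_natCast, Real.inv_rpow hε.le, inv_pow]
    push_cast
    ring
  have h4 : ((ε ^ d : ℝ) : ℂ) ≠ 0 := by exact_mod_cast (Real.rpow_pos_of_pos hε d).ne'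
  rw [h3, mul_assoc, ← h1, inv_mul_cancel_left₀ h4]

/-- The contribution of a homogeneous term of the symbol. -/
lemma tendsto_rpow_mul_integral_homog {Θ : Euc n} (hΘ : ‖Θ‖ = 1) {h : Euc n → ℝ}
    (hh : IsHomogSmooth 1 h) (hv : h Θ = 0) (hcrit : fderiv ℝ h Θ = 0)
    (hneg : ∀ v : Euc n, ⟪Θ, v⟫ = 0 → v ≠ 0 → iteratedFDeriv ℝ 2 h Θ ![v, v] < 0)
    (hodd : (fun ξ => -h (-ξ)) =ᶠ[𝓝 Θ] h) {d : ℝ} {c : Euc n → ℂ} (hd : (n : ℝ) < d)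
    (hc : IsHomogSmooth d c) (h0 : c 0 = 0)
    (hsupp : ∀ ξ, ξ ≠ 0 → fderiv ℝ h ξ = 0 → c =ᶠ[𝓝 ξ] 0 ∨ unitDir ξ = Θ ∨ unitDir ξ = -Θ)
    (g : 𝓢(Euc n, ℂ)) :
    Tendsto (fun ε : ℝ => ((ε ^ (d + ((n : ℝ) + 1) / 2) : ℝ) : ℂ) *
        ∫ ξ, c ξ * oscFactor h 1 ξ * g (ε • ξ)) (𝓝[>] 0)
      (𝓝 (c Θ * (stationaryFactor h Θ * ∫ r in Ioi (0 : ℝ),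
          ((r ^ (d + ((n : ℝ) - 1) / 2) : ℝ) : ℂ) * g (r • Θ)) +
        c (-Θ) * (starRingEnd ℂ (stationaryFactor h Θ) * ∫ r in Ioi (0 : ℝ),
          ((r ^ (d + ((n : ℝ) - 1) / 2) : ℝ) : ℂ) * g (-(r • Θ))))) := by
  have hn := finrank_orthogonal_span_singleton_eq hΘ
  have hm : (Module.finrank ℝ ((ℝ ∙ Θ)ᗮ : Submodule ℝ (Euc n)) : ℝ) = (n : ℝ) - 1 := by
    rw [eq_sub_iff_add_eq]
    exact_mod_cast hn
  have hd' : ((Module.finrank ℝ ((ℝ ∙ Θ)ᗮ : Submodule ℝ (Euc n)) + 1 : ℕ) : ℝ) < d := by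
    rw [hn]
    exact hd
  have key := tendsto_integral_homog_osc hΘ hh hv hcrit hneg hodd hd' hc h0 hsupp g
  rw [hm] at key
  -- With `lam = ε⁻¹` the exponents combine as `(d + n) - (n - 1)/2 = d + (n + 1)/2`.
  refine (key.comp tendsto_inv_nhdsGT_zero).congr' ?_
  filter_upwards [self_mem_nhdsWithin] with ε hε
  have hε' : 0 < ε := hε
  rw [Function.comp_apply, integral_homog_scaling hc h0 hh g hε', ← mul_assoc, ← Complex.ofReal_mul]
  congr 3
  rw [Real.inv_rpow hε'.le, Real.inv_rpow hε'.le, ← Real.rpow_neg hε'.le, ← Real.rpow_neg hε'.le,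
    ← Real.rpow_add hε']
  congr 1
  ring

/-- A surplus positive power of `ε` kills the finite limit of the preceding lemma; this disposes of
the lower order terms of the symbol. -/
lemma tendsto_rpow_mul_integral_homog_zero {Θ : Euc n} (hΘ : ‖Θ‖ = 1) {h : Euc n → ℝ}
    (hh : IsHomogSmooth 1 h) (hv : h Θ = 0) (hcrit : fderiv ℝ h Θ = 0)
    (hneg : ∀ v : Euc n, ⟪Θ, v⟫ = 0 → v ≠ 0 → iteratedFDeriv ℝ 2 h Θ ![v, v] < 0)
    (hodd : (fun ξ => -h (-ξ)) =ᶠ[𝓝 Θ] h) {d : ℝ} {c : Euc n → ℂ} (hd : (n : ℝ) < d)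
    (hc : IsHomogSmooth d c) (h0 : c 0 = 0)
    (hsupp : ∀ ξ, ξ ≠ 0 → fderiv ℝ h ξ = 0 → c =ᶠ[𝓝 ξ] 0 ∨ unitDir ξ = Θ ∨ unitDir ξ = -Θ)
    (g : 𝓢(Euc n, ℂ)) {a : ℝ} (ha : d + ((n : ℝ) + 1) / 2 < a) :
    Tendsto (fun ε : ℝ => ((ε ^ a : ℝ) : ℂ) *
        ∫ ξ, c ξ * oscFactor h 1 ξ * g (ε • ξ)) (𝓝[>] 0) (𝓝 0) := by
  have h1 := tendsto_rpow_mul_integral_homog hΘ hh hv hcrit hneg hodd hd hc h0 hsupp g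
  have h2 : Tendsto (fun ε : ℝ => ((ε ^ (a - (d + ((n : ℝ) + 1) / 2)) : ℝ) : ℂ)) (𝓝[>] 0) (𝓝 0) := by
    have hpos : 0 < a - (d + ((n : ℝ) + 1) / 2) := by linarith
    have h3 : Continuous fun ε : ℝ => ((ε ^ (a - (d + ((n : ℝ) + 1) / 2)) : ℝ) : ℂ) :=
      Complex.continuous_ofReal.comp (continuous_id.rpow_const fun _ => Or.inr hpos.le)
    have h4 := h3.tendsto 0
    rw [Real.zero_rpow hpos.ne', Complex.ofReal_zero] at h4
    exact h4.mono_left nhdsWithin_le_nhds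
  have h5 := h2.mul h1
  rw [zero_mul] at h5
  refine h5.congr' ?_
  filter_upwards [self_mem_nhdsWithin] with ε hε
  rw [← mul_assoc, ← Complex.ofReal_mul, ← Real.rpow_add hε, sub_add_cancel]

end Scaling

/-! ### Homogeneous expansion of the full symbol -/

section Decomposition

variable {n : ℕ} {Ω : Set (Euc n)} {H : Euc n → ℝ} {v : Euc n → ℂ} {s : ℕ → ℝ}
  {vj : ℕ → Euc n → ℂ} {B : Euc n → ℝ → ℂ} {β : ℕ → ℝ} {Bj : ℕ → Euc n → ℂ}

/-- The difference telescopes into (remainder of `B`) times `v` plus (partial sum of `B`) times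
(remainder of `v`). The first is of order `β J - s 0` and the second of order `β 0 - s J`; the two
conditions on `J` make both at most `-2`. -/
lemma norm_symbol_sub_le (hv : IsAmplitude Ω H v s vj) (hB : IsFilterSymbol B β Bj) {J : ℕ}
    (h1 : β J ≤ s 0 - 2) (h2 : β 0 + 2 ≤ s J) :
    ∃ C, 0 ≤ C ∧ ∀ α : Euc n, ‖α‖ = 1 → ∀ r : ℝ, 1 ≤ r →
      ‖B α r * v (r • α) - omegaFactor H α *
        ((∑ j ∈ Finset.range J, ((r ^ (β j) : ℝ) : ℂ) * Bj j α) *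
          ∑ k ∈ Finset.range J, ((r ^ (-s k) : ℝ) : ℂ) * vj k α)‖ ≤ C * (r ^ 2)⁻¹ := by
  obtain ⟨C₁, hC₁, H₁⟩ := hB.exists_remainder_bound J
  obtain ⟨C₂, hC₂, H₂⟩ := hv.exists_bound_one_le
  obtain ⟨C₃, hC₃, H₃⟩ := hB.exists_remainder_bound 0
  obtain ⟨C₄, hC₄, H₄⟩ := hv.exists_remainder_bound J
  refine ⟨C₁ * C₂ + (C₃ + C₁) * C₄, by positivity, fun α hα r hr => ?_⟩
  have hr0 : 0 < r := by linarith
  set S := ∑ j ∈ Finset.range J, ((r ^ (β j) : ℝ) : ℂ) * Bj j α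
  set V := ∑ k ∈ Finset.range J, ((r ^ (-s k) : ℝ) : ℂ) * vj k α
  have e1 := H₁ α hα r hr
  have e2 := H₂ (r • α) (by rwa [norm_smul, hα, mul_one, Real.norm_of_nonneg hr0.le])
  rw [norm_smul, hα, mul_one, Real.norm_of_nonneg hr0.le] at e2
  have e3 := H₃ α hα r hr
  rw [Finset.sum_range_zero, sub_zero] at e3
  have e4 := H₄ α hα r hr
  have hβ : β J ≤ β 0 := hB.exponents_anti.antitone (Nat.zero_le J)
  have e5 : ‖S‖ ≤ (C₃ + C₁) * r ^ (β 0) := by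
    have f1 : S = B α r - (B α r - S) := by ring
    rw [f1, add_mul]
    refine (norm_sub_le _ _).trans (add_le_add e3 (e1.trans ?_))
    gcongr
  have hpow : ∀ {a : ℝ}, a ≤ -2 → r ^ a ≤ (r ^ 2)⁻¹ := fun {a} ha => by
    rw [← Real.rpow_natCast, ← Real.rpow_neg hr0.le]
    exact Real.rpow_le_rpow_of_exponent_le hr (by push_cast; exact ha)
  have e6 : B α r * v (r • α) - omegaFactor H α * (S * V) =
      (B α r - S) * v (r • α) + S * (v (r • α) - omegaFactor H α * V) := by ring
  rw [e6, add_mul]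
  refine (norm_add_le _ _).trans (add_le_add ?_ ?_)
  · rw [norm_mul]
    calc ‖B α r - S‖ * ‖v (r • α)‖ ≤ (C₁ * r ^ (β J)) * (C₂ * r ^ (-s 0)) := by gcongr
      _ = C₁ * C₂ * r ^ (β J + -s 0) := by rw [Real.rpow_add hr0]; ring
      _ ≤ C₁ * C₂ * (r ^ 2)⁻¹ := by
        gcongr
        exact hpow (by linarith)
  · rw [norm_mul]
    calc ‖S‖ * ‖v (r • α) - omegaFactor H α * V‖
        ≤ ((C₃ + C₁) * r ^ (β 0)) * (C₄ * r ^ (-s J)) := by gcongr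
      _ = (C₃ + C₁) * C₄ * r ^ (β 0 + -s J) := by rw [Real.rpow_add hr0]; ring
      _ ≤ (C₃ + C₁) * C₄ * (r ^ 2)⁻¹ := by
        gcongr
        exact hpow (by linarith)

/-- The angular part of a homogeneous term of the symbol of the backprojection. -/
def angularTerm (H : Euc n → ℝ) (Bj vj : ℕ → Euc n → ℂ) (P : MvPolynomial (Fin n) ℝ) (p : ℕ × ℕ)
    (α : Euc n) : ℂ :=
  ((1 / Real.pi : ℂ) * omegaFactor H α * Bj p.1 α *
    (MvPolynomial.eval (fun i => α i) P : ℝ)) * vj p.2 α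

/-- The factor `ω` is known to be smooth only over `Ω ∪ -Ω`; the compact support of `vj` in that set
makes the product smooth on the whole sphere. -/
lemma isTestOnSphere_angularTerm (hH : IsPhase Ω H) (hΩ : IsOpenInSphere Ω)
    (hv : IsAmplitude Ω H v s vj) (hB : IsFilterSymbol B β Bj) (P : MvPolynomial (Fin n) ℝ)
    (p : ℕ × ℕ) : IsTestOnSphere (Ω ∪ -Ω) (angularTerm H Bj vj P p) := by
  refine (hv.coeff_test p.2).mul_of_contDiffAt (p := fun α => (1 / Real.pi : ℂ) *
    omegaFactor H α * Bj p.1 α * (MvPolynomial.eval (fun i => α i) P : ℝ)) fun ξ hξ hW => ?_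
  have h1 := hH.contDiffAt_omegaFactor hΩ hξ hW
  have h2 : ContDiffAt ℝ ∞ (fun ζ => Bj p.1 (unitDir ζ)) ξ :=
    ContDiffOn.contDiffAt (hB.coeff_smooth p.1) (isOpen_compl_singleton.mem_nhds hξ)
  have h3 : ContDiffAt ℝ ∞ (fun ζ : Euc n =>
      ((MvPolynomial.eval (fun i => unitDir ζ i) P : ℝ) : ℂ)) ξ :=
    Complex.ofRealCLM.contDiff.contDiffAt.comp ξ
      ((contDiff_eval P).contDiffAt.comp ξ (contDiffAt_unitDir hξ))
  exact ((contDiffAt_const.mul h1).mul h2).mul h3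

/-- For `‖ξ‖ ≥ 1` the symbol error `O(r ^ (-2))` is multiplied by `r ^ m * r ^ (1 - n)`, which gives
`r ^ (m - n - 1)`. In the unit ball every term is bounded: `m ≥ n` absorbs the singularity `‖ξ‖ ^ (1
- n)`, and the degrees `D p` are positive. -/
lemma norm_decomposition_le [Nontrivial (Euc n)] (hH : IsPhase Ω H) (hΩ : IsOpenInSphere Ω)
    (hv : IsAmplitude Ω H v s vj) (hB : IsFilterSymbol B β Bj) {J : ℕ}
    (h1 : β J ≤ s 0 - 2) (h2 : β 0 + 2 ≤ s J) {P : MvPolynomial (Fin n) ℝ} {m : ℕ}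
    (hP : P.IsHomogeneous m) (hm : n ≤ m) (D : ℕ × ℕ → ℝ)
    (hDef : ∀ p, D p = m + 1 - n + β p.1 - s p.2)
    (hD : ∀ p ∈ Finset.range J ×ˢ Finset.range J, 0 < D p) :
    ∃ C, ∀ ξ : Euc n, ‖backprojectionMultiplier B v ξ *
        (MvPolynomial.eval (fun i => ξ i) P : ℝ) -
        ∑ p ∈ Finset.range J ×ˢ Finset.range J, homogExt (D p) (angularTerm H Bj vj P p) ξ‖ ≤
      C * ((1 + ‖ξ‖) ^ m * (1 + ‖ξ‖) ^ (-((n : ℝ) + 1))) := by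
  obtain ⟨C₁, hC₁, H₁⟩ := norm_symbol_sub_le hv hB h1 h2
  obtain ⟨CP, hCP, HP⟩ := exists_abs_eval_le hP
  obtain ⟨CB, hCB, HB⟩ := hB.exists_bound_unit
  obtain ⟨Cv, HV⟩ := hv.exists_bound
  have hCv : 0 ≤ Cv := (norm_nonneg _).trans (HV 0)
  choose Cq hCq HQ using fun p => (isTestOnSphere_angularTerm hH hΩ hv hB P p).1.exists_bound
  have hn : 1 ≤ n := by
    have := Module.finrank_pos (R := ℝ) (M := Euc n)
    rw [finrank_euclideanSpace_fin] at this
    exact this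
  have hpi : ‖(1 / Real.pi : ℂ)‖ = 1 / Real.pi := by
    rw [norm_div, norm_one, Complex.norm_real, Real.norm_of_nonneg Real.pi_pos.le]
  have hpi0 := Real.pi_pos
  set K₁ : ℝ := 1 / Real.pi * CB * Cv * CP + ∑ p ∈ Finset.range J ×ˢ Finset.range J, Cq p with hK₁
  set K₂ : ℝ := 1 / Real.pi * CP * C₁ with hK₂
  have hK₁0 : 0 ≤ K₁ := add_nonneg (by positivity) (Finset.sum_nonneg fun p _ => hCq p)
  have hK₂0 : 0 ≤ K₂ := by positivity
  -- The power of `2` comes from comparing `1 + r` with `2` for `r ≤ 1` and with `2 r` for `r ≥ 1`.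
  refine ⟨(K₁ + K₂) * 2 ^ ((n : ℝ) + 1), fun ξ => ?_⟩
  have hr0 : 0 ≤ ‖ξ‖ := norm_nonneg ξ
  have hsmall : ∀ r : ℝ, 0 ≤ r → r ≤ 1 → 1 ≤ 2 ^ ((n : ℝ) + 1) * (1 + r) ^ (-((n : ℝ) + 1)) := by
    intro r h0 h1
    rw [Real.rpow_neg (by positivity), ← div_eq_mul_inv, one_le_div (by positivity)]
    gcongr
    linarith
  have hlarge : ∀ r : ℝ, 1 ≤ r →
      r ^ (-((n : ℝ) + 1)) ≤ 2 ^ ((n : ℝ) + 1) * (1 + r) ^ (-((n : ℝ) + 1)) := by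
    intro r h1
    have h0 : 0 < r := by linarith
    rw [Real.rpow_neg (by positivity), Real.rpow_neg (by positivity), ← div_eq_mul_inv,
      inv_le_iff_one_le_mul₀ (by positivity), div_mul_eq_mul_div, one_le_div (by positivity),
      ← Real.mul_rpow (by positivity) h0.le]
    gcongr
    linarith
  rcases le_total ‖ξ‖ 1 with hle | hge
  · have hmain : ‖backprojectionMultiplier B v ξ * (MvPolynomial.eval (fun i => ξ i) P : ℝ) -
        ∑ p ∈ Finset.range J ×ˢ Finset.range J,
          homogExt (D p) (angularTerm H Bj vj P p) ξ‖ ≤ K₁ := by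
      by_cases hξ : ξ = 0
      · have e1 : MvPolynomial.eval (fun i => ξ i) P = 0 := by
          have := HP ξ
          rw [hξ, norm_zero, zero_pow (by omega), mul_zero] at this
          rw [hξ]
          exact abs_eq_zero.mp (le_antisymm this (abs_nonneg _))
        have e2 : ∑ p ∈ Finset.range J ×ˢ Finset.range J,
            homogExt (D p) (angularTerm H Bj vj P p) ξ = 0 :=
          Finset.sum_eq_zero fun p hp => by rw [hξ, homogExt_zero (hD p hp)]
        rw [e1, e2, Complex.ofReal_zero, mul_zero, sub_zero, norm_zero]
        exact hK₁0
      · have hpos : 0 < ‖ξ‖ := norm_pos_iff.mpr hξ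
        have hu := norm_unitDir hξ
        refine (norm_sub_le _ _).trans (add_le_add ?_ ((norm_sum_le _ _).trans
          (Finset.sum_le_sum fun p hp => ?_)))
        · rw [backprojectionMultiplier, norm_mul, norm_mul, norm_mul, norm_mul, hpi,
            Complex.norm_real, Real.norm_of_nonneg (by positivity), Complex.norm_real,
            Real.norm_eq_abs]
          calc 1 / Real.pi * (‖ξ‖ ^ (n - 1))⁻¹ * ‖B (unitDir ξ) ‖ξ‖‖ * ‖v ξ‖ *
                |MvPolynomial.eval (fun i => ξ i) P|
              ≤ 1 / Real.pi * (‖ξ‖ ^ (n - 1))⁻¹ * CB * Cv * (CP * ‖ξ‖ ^ m) := by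
                gcongr
                · exact HB _ hu _ hr0 hle
                · exact HV ξ
                · exact HP ξ
            _ = 1 / Real.pi * CB * Cv * CP * (‖ξ‖ ^ m * (‖ξ‖ ^ (n - 1))⁻¹) := by ring
            _ ≤ 1 / Real.pi * CB * Cv * CP * 1 := by
                gcongr
                rw [← div_eq_mul_inv, div_le_one (by positivity)]
                exact pow_le_pow_of_le_one hr0 hle (by omega)
            _ = _ := mul_one _
        · rw [homogExt, norm_mul, Complex.norm_real,
            Real.norm_of_nonneg (Real.rpow_nonneg hr0 _)]
          exact (mul_le_of_le_one_left (norm_nonneg _)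
            (Real.rpow_le_one hr0 hle (hD p hp).le)).trans (HQ p _ hu)
    have hone : 1 ≤ (1 + ‖ξ‖) ^ m := one_le_pow₀ (by linarith)
    have hs := hsmall _ hr0 hle
    calc _ ≤ K₁ := hmain
      _ ≤ (K₁ + K₂) * 1 * 1 := by linarith
      _ ≤ (K₁ + K₂) * (2 ^ ((n : ℝ) + 1) * (1 + ‖ξ‖) ^ (-((n : ℝ) + 1))) * (1 + ‖ξ‖) ^ m := by
        gcongr
      _ = _ := by ring
  · have hξ : ξ ≠ 0 := fun h => by simp [h] at hge; linarith
    have hpos : 0 < ‖ξ‖ := norm_pos_iff.mpr hξ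
    have hu := norm_unitDir hξ
    set r := ‖ξ‖ with hr
    set α := unitDir ξ with hα
    have hrα : r • α = ξ := norm_smul_unitDir ξ
    have hPr : MvPolynomial.eval (fun i => ξ i) P = r ^ m * MvPolynomial.eval (fun i => α i) P := by
      rw [← eval_smul_of_isHomogeneous hP, hrα]
    have hrD : ∀ p : ℕ × ℕ, r ^ (D p) = r ^ m * (r ^ (n - 1))⁻¹ * r ^ (β p.1) * r ^ (-s p.2) := by
      intro p
      rw [hDef, ← Real.rpow_natCast, ← Real.rpow_natCast, ← Real.rpow_neg hr0, ← Real.rpow_add hpos,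
        ← Real.rpow_add hpos, ← Real.rpow_add hpos]
      congr 1
      push_cast [hn]
      ring
    have hsum : ∑ p ∈ Finset.range J ×ˢ Finset.range J,
        homogExt (D p) (angularTerm H Bj vj P p) ξ =
        (1 / Real.pi : ℂ) * ((r ^ m * (r ^ (n - 1))⁻¹ : ℝ) : ℂ) *
          (MvPolynomial.eval (fun i => α i) P : ℝ) * (omegaFactor H α *
        ((∑ j ∈ Finset.range J, ((r ^ (β j) : ℝ) : ℂ) * Bj j α) *
          ∑ k ∈ Finset.range J, ((r ^ (-s k) : ℝ) : ℂ) * vj k α)) := by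
      rw [Finset.sum_mul_sum, ← Finset.sum_product', Finset.mul_sum, Finset.mul_sum]
      refine Finset.sum_congr rfl fun p _ => ?_
      rw [homogExt, ← hr, ← hα, hrD, angularTerm]
      push_cast
      ring
    have hfirst : backprojectionMultiplier B v ξ * (MvPolynomial.eval (fun i => ξ i) P : ℝ) =
        (1 / Real.pi : ℂ) * ((r ^ m * (r ^ (n - 1))⁻¹ : ℝ) : ℂ) *
          (MvPolynomial.eval (fun i => α i) P : ℝ) * (B α r * v (r • α)) := by
      rw [backprojectionMultiplier, ← hr, ← hα, hrα, hPr]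
      push_cast
      ring
    rw [hfirst, hsum, ← mul_sub, norm_mul, norm_mul, norm_mul, hpi, Complex.norm_real,
      Complex.norm_real, Real.norm_of_nonneg (by positivity), Real.norm_eq_abs]
    have f1 := HP α
    rw [hu, one_pow, mul_one] at f1
    calc 1 / Real.pi * (r ^ m * (r ^ (n - 1))⁻¹) * |MvPolynomial.eval (fun i => α i) P| * _
        ≤ 1 / Real.pi * (r ^ m * (r ^ (n - 1))⁻¹) * CP * (C₁ * (r ^ 2)⁻¹) := by
          gcongr
          exact H₁ α hu r hge
      _ = K₂ * (r ^ m * r ^ (-((n : ℝ) + 1))) := by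
          have : r ^ (-((n : ℝ) + 1)) = (r ^ (n - 1))⁻¹ * (r ^ 2)⁻¹ := by
            rw [← mul_inv, ← pow_add, Real.rpow_neg hr0, ← Real.rpow_natCast]
            congr 2
            push_cast [hn]
            ring
          rw [this, hK₂]
          ring
      _ ≤ (K₁ + K₂) * ((1 + r) ^ m * (2 ^ ((n : ℝ) + 1) * (1 + r) ^ (-((n : ℝ) + 1)))) := by
          gcongr
          · linarith
          · linarith
          · exact hlarge r hge
      _ = _ := by ring

end Decomposition

/-! ### The leading term of the backprojection at `x₀` -/

section LeadingTerm

variable {n : ℕ} {Ω : Set (Euc n)} {H : Euc n → ℝ} {v : Euc n → ℂ} {s : ℕ → ℝ}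
  {vj : ℕ → Euc n → ℂ} {B : Euc n → ℝ → ℂ} {β : ℕ → ℝ} {Bj : ℕ → Euc n → ℂ}

lemma integrable_homog_mul_osc_mul_schwartz_smul [Nontrivial (Euc n)] {d : ℝ} {h : Euc n → ℝ}
    {c : Euc n → ℂ} (hh : IsHomogSmooth 1 h) (hc : IsHomogSmooth d c) (h0 : c 0 = 0) (hd : 0 < d)
    (g : 𝓢(Euc n, ℂ)) {ε : ℝ} (hε : ε ≠ 0) :
    Integrable fun ξ => c ξ * oscFactor h 1 ξ * g (ε • ξ) := by
  have h1 := integrable_homog_mul_schwartz_mul_osc hh hc h0 hd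
    (compCLMOfContinuousLinearEquiv ℝ
      (ContinuousLinearEquiv.smulLeft (R₁ := ℝ) (M₁ := Euc n) (Units.mk0 ε hε)) g) 1
  refine h1.congr (Eventually.of_forall fun ξ => ?_)
  exact mul_right_comm _ _ _

/-- Centring the test function at `x₀` contributes `e^{-i x₀·ξ}`, which turns the phase `H` into the
centred phase. -/
lemma backprojectionMultiplier_mul_testFourier {P : MvPolynomial (Fin n) ℝ} {m : ℕ}
    (hP : P.IsHomogeneous m) (x₀ : Euc n) {ε : ℝ} (hε : 0 < ε) (w : 𝓓((⊤ : Opens (Euc n)), ℝ))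
    (ξ : Euc n) :
    backprojectionMultiplier B (fun ξ => v ξ * Complex.exp (Complex.I * (H ξ : ℂ))) ξ *
        testFourier (polyDeriv P (rescale x₀ ε w)) ξ =
      Complex.I ^ m * (backprojectionMultiplier B v ξ * (MvPolynomial.eval (fun i => ξ i) P : ℝ) *
        oscFactor (centredPhase H x₀) 1 ξ * testFourier w (ε • ξ)) := by
  have h1 : oscFactor (centredPhase H x₀) 1 ξ = Complex.exp (Complex.I * (H ξ : ℂ)) *
      Complex.exp (-(Complex.I * (⟪ξ, x₀⟫ : ℝ))) := by
    rw [oscFactor, centredPhase, ← Complex.exp_add, real_inner_comm]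
    congr 1
    push_cast
    ring
  rw [testFourier_polyDeriv hP, testFourier_rescale x₀ hε, h1, backprojectionMultiplier,
    backprojectionMultiplier]
  ring

/-- The leading term of the filtered backprojection near a point of the singular support. -/
theorem tendsto_rpow_mul_integral_multiplier [Nontrivial (Euc n)] (hΩ : IsOpenInSphere Ω)
    (hH : IsPhase Ω H) {Θ x₀ : Euc n} (hΘ : Θ ∈ Ω) (hgrad : gradient H Θ = x₀)
    (hsmall : ∀ α ∈ Ω, gradient H α = x₀ → α = Θ) (hv : IsAmplitude Ω H v s vj)
    (hB : IsFilterSymbol B β Bj) {κ : ℝ} (hκ : κ = β 0 - s 0 - ((n : ℝ) - 3) / 2) (hκ0 : 0 ≤ κ) :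
    ∃ m₀ : ℕ, 1 ≤ m₀ ∧ ∀ m : ℕ, m₀ ≤ m → ∀ P : MvPolynomial (Fin n) ℝ, P.IsHomogeneous m →
      ∀ w : 𝓓((⊤ : Opens (Euc n)), ℝ),
      Tendsto (fun ε : ℝ => ((ε ^ ((m : ℝ) + κ) : ℝ) : ℂ) * ∫ ξ,
          backprojectionMultiplier B (fun ξ => v ξ * Complex.exp (Complex.I * (H ξ : ℂ))) ξ *
            testFourier (polyDeriv P (rescale x₀ ε w)) ξ) (𝓝[>] 0)
        (𝓝 (Complex.I ^ m * ((1 / Real.pi : ℂ) *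
          (Bj 0 Θ * vj 0 Θ * ((MvPolynomial.eval (fun i => Θ i) P : ℝ) : ℂ) *
            (∫ r in Ioi (0 : ℝ), ((r ^ ((m : ℝ) + κ - 1) : ℝ) : ℂ) * testFourier w (r • Θ)) +
          Bj 0 (-Θ) * vj 0 (-Θ) * ((MvPolynomial.eval (fun i => (-Θ) i) P : ℝ) : ℂ) *
            ∫ r in Ioi (0 : ℝ), ((r ^ ((m : ℝ) + κ - 1) : ℝ) : ℂ) *
              testFourier w (-(r • Θ)))))) := by
  have hΘ1 : ‖Θ‖ = 1 := hΩ.norm_eq_one hΘ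
  have hΘ0 : Θ ≠ 0 := fun h => by simp [h] at hΘ1
  set h := centredPhase H x₀ with hhdef
  have hh : IsHomogSmooth 1 h := hH.isHomogSmooth_centredPhase x₀
  have hval : h Θ = 0 := hH.centredPhase_eq_zero hΘ0 hgrad
  have hcrit : fderiv ℝ h Θ = 0 := (hH.fderiv_centredPhase_eq_zero_iff x₀ hΘ0).mpr hgrad
  have hneg : ∀ v : Euc n, ⟪Θ, v⟫ = 0 → v ≠ 0 → iteratedFDeriv ℝ 2 h Θ ![v, v] < 0 := by
    intro v hv hv0
    rw [hhdef, hH.iteratedFDeriv_two_centredPhase x₀ hΘ0]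
    exact hH.hessian_neg Θ hΘ v hv hv0
  have hodd := hH.centredPhase_odd hΩ x₀ hΘ
  have hst : stationaryFactor h Θ = stationaryFactor H Θ := hH.stationaryFactor_centredPhase x₀ hΘ0
  obtain ⟨J, hJ1, hJ2, hJ0⟩ : ∃ J, β J ≤ s 0 - 2 ∧ β 0 + 2 ≤ s J ∧ 1 ≤ J :=
    ((hB.exponents_tendsto.eventually_le_atBot _).and
      ((hv.exponents_tendsto.eventually_ge_atTop _).and (eventually_ge_atTop 1))).exists
  -- This makes every degree `D p` with indices below `J` exceed `n`, as stationary phase requires: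
  -- `D p ≥ m + 1 - n + β J - s J > n`.
  obtain ⟨m₁, hm₁⟩ := exists_nat_gt (2 * (n : ℝ) + s J - β J)
  refine ⟨max 1 (max n m₁), le_max_left _ _, fun m hm P hP w => ?_⟩
  have hm1 : 1 ≤ m := (le_max_left _ _).trans hm
  have hmn : n ≤ m := (le_max_left _ _).trans ((le_max_right _ _).trans hm)
  have hmm : (m₁ : ℝ) ≤ m := by exact_mod_cast (le_max_right _ _).trans ((le_max_right _ _).trans hm)
  set D : ℕ × ℕ → ℝ := fun p => m + 1 - n + β p.1 - s p.2 with hDdef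
  have hDn : ∀ p ∈ Finset.range J ×ˢ Finset.range J, (n : ℝ) < D p := by
    intro p hp
    rw [Finset.mem_product, Finset.mem_range, Finset.mem_range] at hp
    have h1 : β J ≤ β p.1 := hB.exponents_anti.antitone hp.1.le
    have h2 : s p.2 ≤ s J := hv.exponents_mono.monotone hp.2.le
    simp only [hDdef]
    linarith
  have hn0 : (0 : ℝ) ≤ n := n.cast_nonneg
  have hD0 : ∀ p ∈ Finset.range J ×ˢ Finset.range J, 0 < D p := fun p hp =>
    hn0.trans_lt (hDn p hp)
  set c : ℕ × ℕ → Euc n → ℂ := fun p => homogExt (D p) (angularTerm H Bj vj P p) with hcdef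
  have hc : ∀ p, IsHomogSmooth (D p) (c p) := fun p =>
    isHomogSmooth_homogExt _ (isTestOnSphere_angularTerm hH hΩ hv hB P p).1
  have hc0 : ∀ p ∈ Finset.range J ×ˢ Finset.range J, c p 0 = 0 := fun p hp =>
    homogExt_zero (hD0 p hp) _
  have hsupp : ∀ p, ∀ ξ, ξ ≠ 0 → fderiv ℝ h ξ = 0 →
      c p =ᶠ[𝓝 ξ] 0 ∨ unitDir ξ = Θ ∨ unitDir ξ = -Θ := by
    intro p ξ hξ hcr
    by_cases hu : unitDir ξ ∈ Ω ∪ -Ω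
    · exact Or.inr (hH.critical_direction hΩ hsmall hξ hcr hu)
    · left
      filter_upwards [(isTestOnSphere_angularTerm hH hΩ hv hB P p).eventually_eq_zero hξ hu]
        with ζ hζ
      simp only [hcdef, homogExt, hζ.2, mul_zero, Pi.zero_apply]
  obtain ⟨C, hC⟩ := norm_decomposition_le hH hΩ hv hB hJ1 hJ2 hP hmn D (fun _ => rfl) hD0
  set A : Euc n → ℂ := fun ξ =>
    backprojectionMultiplier B v ξ * (MvPolynomial.eval (fun i => ξ i) P : ℝ) with hAdef
  set R : Euc n → ℂ := fun ξ =>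
    (A ξ - ∑ p ∈ Finset.range J ×ˢ Finset.range J, c p ξ) * oscFactor h 1 ξ with hRdef
  have hRm : AEStronglyMeasurable R := by
    refine aestronglyMeasurable_of_continuousOn_compl_zero ?_
    refine ContinuousOn.mul (ContinuousOn.sub ?_ ?_) (continuousOn_oscFactor hh 1)
    · exact (hB.continuousOn_multiplier hv.smooth.continuous.continuousOn).mul
        (Complex.continuous_ofReal.comp (contDiff_eval P).continuous).continuousOn
    · exact continuousOn_finsetSum _ fun p _ => (hc p).smooth.continuousOn
  have hRb : ∀ ξ, ‖R ξ‖ ≤ C * ((1 + ‖ξ‖) ^ m * (1 + ‖ξ‖) ^ (-((n : ℝ) + 1))) := fun ξ => by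
    rw [hRdef, norm_mul, norm_oscFactor, mul_one]
    exact hC ξ
  have t1 := tendsto_rpow_mul_integral_remainder hRm hm1 (a := (m : ℝ) + κ) (by linarith) hRb
    (testFourier w)
  set L : ℂ := (1 / Real.pi : ℂ) *
          (Bj 0 Θ * vj 0 Θ * ((MvPolynomial.eval (fun i => Θ i) P : ℝ) : ℂ) *
            (∫ r in Ioi (0 : ℝ), ((r ^ ((m : ℝ) + κ - 1) : ℝ) : ℂ) * testFourier w (r • Θ)) +
          Bj 0 (-Θ) * vj 0 (-Θ) * ((MvPolynomial.eval (fun i => (-Θ) i) P : ℝ) : ℂ) *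
            ∫ r in Ioi (0 : ℝ), ((r ^ ((m : ℝ) + κ - 1) : ℝ) : ℂ) *
              testFourier w (-(r • Θ))) with hL
  have t2 : ∀ p ∈ Finset.range J ×ˢ Finset.range J,
      Tendsto (fun ε : ℝ => ((ε ^ ((m : ℝ) + κ) : ℝ) : ℂ) *
        ∫ ξ, c p ξ * oscFactor h 1 ξ * testFourier w (ε • ξ)) (𝓝[>] 0)
        (𝓝 (if p = (0, 0) then L else 0)) := by
    intro p hp
    split_ifs with hp0
    · have := tendsto_rpow_mul_integral_homog hΘ1 hh hval hcrit hneg hodd (hDn p hp) (hc p)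
        (hc0 p hp) (hsupp p) (testFourier w)
      -- The critical power of `ε` for the top term; this is where the value of `κ` comes from.
      have e1 : D p + ((n : ℝ) + 1) / 2 = m + κ := by
        simp only [hDdef, hp0, hκ]
        ring
      have e2 : D p + ((n : ℝ) - 1) / 2 = m + κ - 1 := by
        simp only [hDdef, hp0, hκ]
        ring
      rw [e1, e2, hst] at this
      refine this.trans (le_of_eq (congrArg 𝓝 ?_))
      have e3 := hH.stationaryFactor_mul_omegaFactor hΩ hΘ
      have e4 := hH.conj_stationaryFactor_mul_omegaFactor hΩ hΘ
      rw [hL, hcdef]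
      simp only [homogExt_of_norm_eq_one _ _ hΘ1,
        homogExt_of_norm_eq_one _ _ ((norm_neg Θ).trans hΘ1), angularTerm, hp0]
      generalize (∫ r in Ioi (0 : ℝ), ((r ^ ((m : ℝ) + κ - 1) : ℝ) : ℂ) *
        testFourier w (r • Θ)) = I₁
      generalize (∫ r in Ioi (0 : ℝ), ((r ^ ((m : ℝ) + κ - 1) : ℝ) : ℂ) *
        testFourier w (-(r • Θ))) = I₂
      linear_combination (1 / Real.pi * Bj 0 Θ *
        ((MvPolynomial.eval (fun i => Θ i) P : ℝ) : ℂ) * vj 0 Θ * I₁) * e3 +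
        (1 / Real.pi * Bj 0 (-Θ) *
        ((MvPolynomial.eval (fun i => (-Θ) i) P : ℝ) : ℂ) * vj 0 (-Θ) * I₂) * e4
    · refine tendsto_rpow_mul_integral_homog_zero hΘ1 hh hval hcrit hneg hodd (hDn p hp) (hc p)
        (hc0 p hp) (hsupp p) (testFourier w) ?_
      have h1 : β p.1 ≤ β 0 := hB.exponents_anti.antitone (Nat.zero_le _)
      have h2 : s 0 ≤ s p.2 := hv.exponents_mono.monotone (Nat.zero_le _)
      -- Every pair other than `(0, 0)` has a strictly smaller degree, by strict monotonicity of the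
      -- exponents, and is therefore negligible.
      have h3 : β p.1 - s p.2 < β 0 - s 0 := by
        rcases Nat.eq_zero_or_pos p.1 with h4 | h4
        · rcases Nat.eq_zero_or_pos p.2 with h5 | h5
          · exact absurd (Prod.ext h4 h5) hp0
          · linarith [hv.exponents_mono h5]
        · linarith [hB.exponents_anti h4]
      simp only [hDdef, hκ]
      linarith
  have hmem : ((0, 0) : ℕ × ℕ) ∈ Finset.range J ×ˢ Finset.range J := by
    simp only [Finset.mem_product, Finset.mem_range]
    omega
  have t3 := ((tendsto_finsetSum _ t2).add t1).const_mul (Complex.I ^ m)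
  rw [Finset.sum_ite_eq', if_pos hmem, add_zero] at t3
  refine t3.congr' ?_
  filter_upwards [self_mem_nhdsWithin] with ε hε
  have hε0 : (0 : ℝ) < ε := hε
  obtain ⟨N, hN⟩ := hB.exists_integrable_multiplier (continuousOn_amplitude_mul_exp hH hv)
    (CF := hv.exists_bound.choose) fun ξ => by
      rw [norm_mul, norm_cexp_I_mul_real, mul_one]
      exact hv.exists_bound.choose_spec ξ
  have i1 := integrable_mul_schwartz hN (testFourier (polyDeriv P (rescale x₀ ε w)))
  -- For fixed `ε` the integral is rewritten as the finite sum of homogeneous terms plus the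
  -- remainder, the limits of which are already known.
  simp only [backprojectionMultiplier_mul_testFourier hP x₀ hε0] at i1 ⊢
  have i2 : Integrable fun ξ => A ξ * oscFactor h 1 ξ * testFourier w (ε • ξ) :=
    (integrable_const_mul_iff (isUnit_iff_ne_zero.mpr (pow_ne_zero m Complex.I_ne_zero)) _).mp i1
  have i3 : ∀ p ∈ Finset.range J ×ˢ Finset.range J,
      Integrable fun ξ => c p ξ * oscFactor h 1 ξ * testFourier w (ε • ξ) := fun p hp =>
    integrable_homog_mul_osc_mul_schwartz_smul hh (hc p) (hc0 p hp) (hD0 p hp) _ hε0.ne'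
  have i4 : ∫ ξ, R ξ * testFourier w (ε • ξ) =
      (∫ ξ, A ξ * oscFactor h 1 ξ * testFourier w (ε • ξ)) -
        ∑ p ∈ Finset.range J ×ˢ Finset.range J,
          ∫ ξ, c p ξ * oscFactor h 1 ξ * testFourier w (ε • ξ) := by
    rw [← integral_finsetSum _ i3, ← integral_sub i2 (integrable_finsetSum _ i3)]
    refine integral_congr_ae (Eventually.of_forall fun ξ => ?_)
    simp only [hRdef, sub_mul, Finset.sum_mul]
  rw [integral_const_mul, i4, ← Finset.mul_sum]
  ring

end LeadingTerm

/-! ### The Gamma integral with a complex parameter -/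

section ComplexGammaIntegral

lemma integrableOn_rpow_mul_exp_neg_mul {κ : ℝ} (hκ : 0 < κ) {b : ℝ} (hb : 0 < b) :
    IntegrableOn (fun ρ : ℝ => ρ ^ (κ - 1) * Real.exp (-(b * ρ))) (Ioi 0) := by
  have h := integrableOn_rpow_mul_exp_neg_mul_rpow (s := κ - 1) (by linarith) one_pos hb
  simpa only [Real.rpow_one, neg_mul] using h

/-- The measure `ρ^{κ-1} dρ` on the positive half-line. -/
def rpowMeasure (κ : ℝ) : Measure ℝ :=
  (volume.restrict (Ioi 0)).withDensity fun ρ => ENNReal.ofReal (ρ ^ (κ - 1))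

lemma integral_rpowMeasure (κ : ℝ) (g : ℝ → ℂ) :
    ∫ ρ, g ρ ∂(rpowMeasure κ) = ∫ ρ in Ioi (0 : ℝ), ((ρ ^ (κ - 1) : ℝ) : ℂ) * g ρ := by
  rw [rpowMeasure, integral_withDensity_eq_integral_toReal_smul (by fun_prop)
    (Eventually.of_forall fun _ => ENNReal.ofReal_lt_top)]
  refine setIntegral_congr_fun measurableSet_Ioi fun ρ hρ => ?_
  have hρ' : (0 : ℝ) < ρ := hρ
  simp only [ENNReal.toReal_ofReal (Real.rpow_nonneg hρ'.le _), Complex.real_smul]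

/-- The Gamma integral is the complex moment generating function of `ρ^{κ-1} dρ`, which is
holomorphic over the interior of the set where the exponential moments exist. -/
lemma Iio_subset_interior_integrableExpSet_rpowMeasure {κ : ℝ} (hκ : 0 < κ) :
    Iio 0 ⊆ interior (integrableExpSet id (rpowMeasure κ)) := by
  refine interior_maximal (fun t ht => ?_) isOpen_Iio
  have ht' : 0 < -t := neg_pos.mpr ht
  rw [integrableExpSet, mem_ofPred_eq, rpowMeasure,
    integrable_withDensity_iff (by fun_prop) (Eventually.of_forall fun _ => ENNReal.ofReal_lt_top)]
  refine (integrableOn_rpow_mul_exp_neg_mul hκ ht').congr_fun (fun ρ hρ => ?_) measurableSet_Ioi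
  have hρ' : (0 : ℝ) < ρ := hρ
  simp only [ENNReal.toReal_ofReal (Real.rpow_nonneg hρ'.le _), id]
  rw [neg_mul, neg_neg, mul_comm]

/-- The Gamma integral with a complex parameter in the exponential. -/
lemma integral_rpow_mul_cexp_neg_mul_Ioi {κ : ℝ} (hκ : 0 < κ) {z : ℂ} (hz : 0 < z.re) :
    ∫ ρ in Ioi (0 : ℝ), ((ρ ^ (κ - 1) : ℝ) : ℂ) * Complex.exp (-(z * ρ)) =
      (Real.Gamma κ : ℂ) * z ^ (-(κ : ℂ)) := by
  have hU : IsOpen {w : ℂ | w.re < 0} := isOpen_lt Complex.continuous_re continuous_const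
  have h1 : DifferentiableOn ℂ (complexMGF id (rpowMeasure κ)) {w : ℂ | w.re < 0} :=
    (differentiableOn_complexMGF (X := id) (μ := rpowMeasure κ)).mono fun w hw =>
      Iio_subset_interior_integrableExpSet_rpowMeasure hκ hw
  have h2 : DifferentiableOn ℂ (fun w : ℂ => (Real.Gamma κ : ℂ) * (-w) ^ (-(κ : ℂ)))
      {w : ℂ | w.re < 0} := by
    intro w hw
    have hw' : -w ∈ Complex.slitPlane := Or.inl (by simpa using hw)
    exact (((differentiableAt_id.neg).cpow_const hw').const_mul _).differentiableWithinAt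
  have hev : ∀ t : ℝ, t < 0 → complexMGF id (rpowMeasure κ) (t : ℂ) =
      (Real.Gamma κ : ℂ) * (-(t : ℂ)) ^ (-(κ : ℂ)) := by
    intro t ht
    have ht' : 0 < -t := neg_pos.mpr ht
    have h3 := Real.integral_rpow_mul_exp_neg_mul_Ioi hκ ht'
    rw [complexMGF, integral_rpowMeasure]
    have h4 : ∫ ρ in Ioi (0 : ℝ), ((ρ ^ (κ - 1) : ℝ) : ℂ) * Complex.exp ((t : ℂ) * (id ρ : ℝ)) =
        ((∫ ρ in Ioi (0 : ℝ), ρ ^ (κ - 1) * Real.exp (-(-t * ρ)) : ℝ) : ℂ) := by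
      refine Eq.trans ?_ integral_ofReal
      refine integral_congr_ae (Eventually.of_forall fun ρ => ?_)
      simp only [id, Complex.coe_algebraMap]
      push_cast
      ring_nf
    rw [h4, h3, one_div, Real.inv_rpow ht'.le, ← Real.rpow_neg ht'.le, mul_comm]
    push_cast
    rw [Complex.ofReal_cpow ht'.le]
    push_cast
    rfl
  -- Both sides, as functions of `w = -z`, are holomorphic in the left half-plane and agree on the
  -- negative real axis, which accumulates at `-1`; the identity theorem then applies.
  have hfreq : ∃ᶠ w in 𝓝[≠] ((-1 : ℝ) : ℂ), complexMGF id (rpowMeasure κ) w =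
      (Real.Gamma κ : ℂ) * (-w) ^ (-(κ : ℂ)) := by
    have ht : Tendsto (fun t : ℝ => (t : ℂ)) (𝓝[≠] (-1)) (𝓝[≠] ((-1 : ℝ) : ℂ)) := by
      refine Complex.continuous_ofReal.continuousAt.continuousWithinAt.tendsto_nhdsWithin
        fun t ht => ?_
      exact fun h => ht (Complex.ofReal_injective h)
    refine ht.frequently (Eventually.frequently ?_)
    filter_upwards [mem_nhdsWithin_of_mem_nhds (Iio_mem_nhds (show (-1 : ℝ) < 0 by norm_num))]
      with t ht
    exact hev t ht
  have hmem : ((-1 : ℝ) : ℂ) ∈ {w : ℂ | w.re < 0} := by simp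
  have key := (h1.analyticOnNhd hU).eqOn_of_preconnected_of_frequently_eq (h2.analyticOnNhd hU)
    (convex_halfSpace_re_lt 0).isPreconnected hmem hfreq
  have h5 := key (show -z ∈ {w : ℂ | w.re < 0} by simpa using hz)
  simp only [neg_neg] at h5
  rw [← h5, complexMGF, integral_rpowMeasure]
  simp only [id, neg_mul]

end ComplexGammaIntegral

/-! ### The transition profile on the line, of positive order -/

section Profile

/-- The Fourier multiplier `|ρ|^{κ-1}`, with coefficient `a` on the positive and `b` on the
negative half-line. -/
def profileMultiplier (κ : ℝ) (a b : ℂ) (ρ : ℝ) : ℂ :=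
  ((|ρ| ^ (κ - 1) : ℝ) : ℂ) * if 0 < ρ then a else b

variable {κ : ℝ}

/-- Integrability at the origin is `κ > 0`; at infinity it holds because `⌊κ⌋ + 1 > κ`. -/
lemma integrable_abs_rpow_mul_inv_pow (hκ : 0 < κ) :
    Integrable fun ρ : ℝ => |ρ| ^ (κ - 1) * ((1 + |ρ|) ^ (⌊κ⌋₊ + 1))⁻¹ := by
  have h := integrable_fun_norm_addHaar (volume : Measure ℝ)
    (f := fun y : ℝ => y ^ (κ - 1) * ((1 + y) ^ (⌊κ⌋₊ + 1))⁻¹)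
  simp only [Real.norm_eq_abs, Module.finrank_self, tsub_self, pow_zero, one_smul] at h
  rw [h, ← Ioc_union_Ioi_eq_Ioi (zero_le_one (α := ℝ))]
  refine IntegrableOn.union ?_ ?_
  · have h1 : IntegrableOn (fun y : ℝ => y ^ (κ - 1)) (Ioc 0 1) :=
      (intervalIntegrable_iff_integrableOn_Ioc_of_le zero_le_one).mp
        (intervalIntegral.intervalIntegrable_rpow' (by linarith))
    refine h1.mono' (Measurable.aestronglyMeasurable (by fun_prop)) ?_
    filter_upwards [ae_restrict_mem measurableSet_Ioc] with y hy
    have hy0 : 0 < y := hy.1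
    rw [Real.norm_of_nonneg (by positivity)]
    exact mul_le_of_le_one_right (by positivity)
      (inv_le_one_of_one_le₀ (one_le_pow₀ (by linarith)))
  · have hN : κ < ((⌊κ⌋₊ + 1 : ℕ) : ℝ) := by
      push_cast
      exact Nat.lt_floor_add_one κ
    refine (integrableOn_Ioi_rpow_of_lt (a := κ - 1 - ((⌊κ⌋₊ + 1 : ℕ) : ℝ)) (by linarith)
      one_pos).mono' (Measurable.aestronglyMeasurable (by fun_prop)) ?_
    filter_upwards [ae_restrict_mem measurableSet_Ioi] with y hy
    have hy0 : 0 < y := one_pos.trans hy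
    rw [Real.norm_of_nonneg (by positivity), Real.rpow_sub hy0 (κ - 1), Real.rpow_natCast, div_eq_mul_inv]
    gcongr
    linarith

lemma measurable_profileMultiplier (a b : ℂ) : Measurable (profileMultiplier κ a b) := by
  unfold profileMultiplier
  exact (by fun_prop : Measurable fun ρ : ℝ => ((|ρ| ^ (κ - 1) : ℝ) : ℂ)).mul
    (Measurable.ite measurableSet_Ioi measurable_const measurable_const)

lemma integrable_profileMultiplier (hκ : 0 < κ) (a b : ℂ) : Integrable fun ρ : ℝ =>
    profileMultiplier κ a b ρ * (((1 + ‖ρ‖) ^ (⌊κ⌋₊ + 1))⁻¹ : ℝ) := by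
  refine ((integrable_abs_rpow_mul_inv_pow hκ).const_mul (‖a‖ + ‖b‖)).mono'
    ((measurable_profileMultiplier a b).aestronglyMeasurable.mul
      (Measurable.aestronglyMeasurable (by fun_prop))) (Eventually.of_forall fun ρ => ?_)
  have h1 : ‖if 0 < ρ then a else b‖ ≤ ‖a‖ + ‖b‖ := by
    split_ifs
    · linarith [norm_nonneg b]
    · linarith [norm_nonneg a]
  rw [profileMultiplier, norm_mul, norm_mul, Complex.norm_real, Complex.norm_real,
    Real.norm_of_nonneg (by positivity), Real.norm_of_nonneg (by positivity), Real.norm_eq_abs,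
    mul_comm (|ρ| ^ (κ - 1)), mul_assoc]
  gcongr

lemma integrable_profileMultiplier_mul (hκ : 0 < κ) (a b : ℂ) (g : 𝓢(ℝ, ℂ)) :
    Integrable fun ρ => profileMultiplier κ a b ρ * g ρ :=
  integrable_mul_schwartz (integrable_profileMultiplier hκ a b) g

lemma integral_profileMultiplier_mul (hκ : 0 < κ) (a b : ℂ) (g : 𝓢(ℝ, ℂ)) :
    ∫ ρ, profileMultiplier κ a b ρ * g ρ =
      a * (∫ ρ in Ioi (0 : ℝ), ((ρ ^ (κ - 1) : ℝ) : ℂ) * g ρ) +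
        b * ∫ ρ in Ioi (0 : ℝ), ((ρ ^ (κ - 1) : ℝ) : ℂ) * g (-ρ) := by
  rw [integral_real_eq_Ioi_add (integrable_profileMultiplier_mul hκ a b g),
    ← integral_const_mul, ← integral_const_mul]
  congr 1
  · refine setIntegral_congr_fun measurableSet_Ioi fun ρ hρ => ?_
    have hρ' : (0 : ℝ) < ρ := hρ
    simp only [profileMultiplier, if_pos hρ', abs_of_pos hρ']
    ring
  · refine setIntegral_congr_fun measurableSet_Ioi fun ρ hρ => ?_
    have hρ' : (0 : ℝ) < ρ := hρ
    simp only [profileMultiplier, abs_neg, if_neg (show ¬ 0 < -ρ by linarith), abs_of_pos hρ']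
    ring

lemma integrableOn_rpow_mul_schwartz (hκ : 0 < κ) (g : 𝓢(ℝ, ℂ)) :
    IntegrableOn (fun ρ : ℝ => ((ρ ^ (κ - 1) : ℝ) : ℂ) * g ρ) (Ioi 0) ∧
      IntegrableOn (fun ρ : ℝ => ((ρ ^ (κ - 1) : ℝ) : ℂ) * g (-ρ)) (Ioi 0) := by
  have h := integrable_profileMultiplier_mul hκ 1 1 g
  constructor
  · refine h.integrableOn.congr_fun (fun ρ hρ => ?_) measurableSet_Ioi
    have hρ' : (0 : ℝ) < ρ := hρ
    simp [profileMultiplier, abs_of_pos hρ']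
  · refine h.comp_neg.integrableOn.congr_fun (fun ρ hρ => ?_) measurableSet_Ioi
    have hρ' : (0 : ℝ) < ρ := hρ
    simp [profileMultiplier, abs_of_pos hρ']

lemma profileMultiplier_scaling (a b : ℂ) (g : 𝓢(ℝ, ℂ)) {ε : ℝ} (hε : 0 < ε) :
    ∫ ρ, profileMultiplier κ a b ρ * g (ε * ρ) =
      ((ε ^ (-κ) : ℝ) : ℂ) * ∫ ρ, profileMultiplier κ a b ρ * g ρ := by
  have h1 := Measure.integral_comp_smul_of_nonneg (volume : Measure ℝ)
    (fun ρ => profileMultiplier κ a b ρ * g ρ) ε (hR := hε.le)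
  have h2 : ∀ ρ : ℝ, profileMultiplier κ a b (ε • ρ) =
      ((ε ^ (κ - 1) : ℝ) : ℂ) * profileMultiplier κ a b ρ := by
    intro ρ
    simp only [profileMultiplier, smul_eq_mul, abs_mul, abs_of_pos hε, mul_pos_iff_of_pos_left hε]
    rw [Real.mul_rpow hε.le (abs_nonneg _)]
    push_cast
    ring
  simp only [h2, mul_assoc] at h1
  rw [integral_const_mul, Module.finrank_self, pow_one, Complex.real_smul] at h1
  have h3 : ((ε ^ (κ - 1) : ℝ) : ℂ) ≠ 0 := by
    exact_mod_cast (Real.rpow_pos_of_pos hε _).ne'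
  have h4 : ((ε ^ (-κ) : ℝ) : ℂ) * ((ε ^ (κ - 1) : ℝ) : ℂ) = ((ε⁻¹ : ℝ) : ℂ) := by
    rw [← Complex.ofReal_mul, ← Real.rpow_add hε, ← Real.rpow_neg_one]
    congr 2
    ring
  refine mul_left_cancel₀ h3 (Eq.trans h1 ?_)
  rw [← h4]
  ring

/-- The Gamma integral with `z = δ + iτt` represents the power; Fubini is justified by `e^{-δρ}`,
and the integral over `t` is the Fourier transform of `φ` at `τρ`. -/
lemma integral_cpow_mul_testFunction (hκ : 0 < κ) {δ : ℝ} (hδ : 0 < δ) (τ : ℝ)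
    (φ : 𝓓((⊤ : Opens ℝ), ℝ)) :
    (Real.Gamma κ : ℂ) * ∫ t : ℝ, ((δ : ℂ) + Complex.I * (τ * t)) ^ (-(κ : ℂ)) * (φ t : ℂ) =
      ∫ ρ in Ioi (0 : ℝ), ((ρ ^ (κ - 1) * Real.exp (-(δ * ρ)) : ℝ) : ℂ) *
        testFourier φ (τ * ρ) := by
  have hint : Integrable (Function.uncurry fun (ρ t : ℝ) =>
      ((ρ ^ (κ - 1) * Real.exp (-(δ * ρ)) : ℝ) : ℂ) *
        (Complex.exp (-(Complex.I * (⟪τ * ρ, t⟫ : ℝ))) * (φ t : ℂ)))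
      ((volume.restrict (Ioi 0)).prod volume) := by
    have h1 : Integrable (fun p : ℝ × ℝ =>
        ((p.1 ^ (κ - 1) * Real.exp (-(δ * p.1)) : ℝ) : ℂ) * (φ p.2 : ℂ))
        ((volume.restrict (Ioi 0)).prod volume) :=
      Integrable.mul_prod (integrableOn_rpow_mul_exp_neg_mul hκ hδ).ofReal (integrable_testFunction φ)
    have hφ : Continuous φ := φ.contDiff.continuous
    refine h1.norm.mono' (Measurable.aestronglyMeasurable ?_) (Eventually.of_forall fun p => ?_)
    · have h2 : Measurable φ := hφ.measurable
      simp only [RCLike.inner_apply, conj_trivial, Function.uncurry_def]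
      fun_prop
    · simp only [Function.uncurry]
      have h3 := norm_cexp_I_mul_real (-⟪τ * p.1, p.2⟫)
      rw [Complex.ofReal_neg, mul_neg] at h3
      rw [norm_mul, norm_mul, norm_mul, h3, one_mul]
  have hswap := integral_integral_swap hint
  simp only [testFourier_apply, ← integral_const_mul]
  rw [hswap]
  refine integral_congr_ae (Eventually.of_forall fun t => ?_)
  have hz : 0 < ((δ : ℂ) + Complex.I * (τ * t)).re := by simpa using hδ
  simp only []
  rw [← mul_assoc, ← integral_rpow_mul_cexp_neg_mul_Ioi hκ hz, ← integral_mul_const]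
  refine setIntegral_congr_fun measurableSet_Ioi fun ρ _ => ?_
  simp only [RCLike.inner_apply, conj_trivial]
  push_cast
  rw [mul_assoc, mul_assoc, ← mul_assoc (Complex.exp _) (Complex.exp _), ← Complex.exp_add]
  ring_nf

lemma tendsto_integral_cpow_mul_testFunction (hκ : 0 < κ) {τ : ℝ} (hτ : τ = 1 ∨ τ = -1)
    (φ : 𝓓((⊤ : Opens ℝ), ℝ)) :
    Tendsto (fun δ : ℝ => (Real.Gamma κ : ℂ) *
        ∫ t : ℝ, ((δ : ℂ) + Complex.I * (τ * t)) ^ (-(κ : ℂ)) * (φ t : ℂ)) (𝓝[>] 0)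
      (𝓝 (∫ ρ in Ioi (0 : ℝ), ((ρ ^ (κ - 1) : ℝ) : ℂ) * testFourier φ (τ * ρ))) := by
  have hint : IntegrableOn (fun ρ : ℝ => ((ρ ^ (κ - 1) : ℝ) : ℂ) * testFourier φ (τ * ρ))
      (Ioi 0) := by
    rcases hτ with rfl | rfl
    · simpa using (integrableOn_rpow_mul_schwartz hκ (testFourier φ)).1
    · simpa using (integrableOn_rpow_mul_schwartz hκ (testFourier φ)).2
  have hcont := (testFourier φ).continuous
  have key : Tendsto (fun δ : ℝ => ∫ ρ in Ioi (0 : ℝ),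
      ((ρ ^ (κ - 1) * Real.exp (-(δ * ρ)) : ℝ) : ℂ) * testFourier φ (τ * ρ)) (𝓝[>] 0)
      (𝓝 (∫ ρ in Ioi (0 : ℝ), ((ρ ^ (κ - 1) : ℝ) : ℂ) * testFourier φ (τ * ρ))) := by
    refine tendsto_integral_filter_of_dominated_convergence _ (Eventually.of_forall fun δ => ?_) ?_
      hint.norm ?_
    · refine Measurable.aestronglyMeasurable ?_
      have := hcont.measurable
      fun_prop
    · filter_upwards [self_mem_nhdsWithin] with δ hδ
      filter_upwards [ae_restrict_mem measurableSet_Ioi] with ρ hρ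
      have hδ' : (0 : ℝ) < δ := hδ
      have hρ' : (0 : ℝ) < ρ := hρ
      rw [norm_mul, norm_mul, Complex.norm_real, Complex.norm_real, norm_mul]
      gcongr
      refine mul_le_of_le_one_right (norm_nonneg _) ?_
      rw [Real.norm_of_nonneg (Real.exp_nonneg _), Real.exp_le_one_iff]
      have := mul_pos hδ' hρ'
      linarith
    · refine Eventually.of_forall fun ρ => ?_
      have h1 : Continuous fun δ : ℝ =>
          ((ρ ^ (κ - 1) * Real.exp (-(δ * ρ)) : ℝ) : ℂ) * testFourier φ (τ * ρ) := by fun_prop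
      have h2 := h1.tendsto 0
      rw [zero_mul, neg_zero, Real.exp_zero, mul_one] at h2
      exact h2.mono_left nhdsWithin_le_nhds
  refine key.congr' ?_
  filter_upwards [self_mem_nhdsWithin] with δ hδ
  exact (integral_cpow_mul_testFunction hκ hδ τ φ).symm

/-- `(t + iσδ)^{-κ}` is a rotation of `(δ - iσt)^{-κ}`. -/
lemma add_I_mul_cpow {σ : ℝ} (hσ : σ = 1 ∨ σ = -1) {δ : ℝ} (hδ : 0 < δ) (κ t : ℝ) :
    ((t : ℂ) + Complex.I * σ * δ) ^ ((-κ : ℝ) : ℂ) =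
      Complex.exp (-(Complex.I * (σ * κ) * (Real.pi / 2))) *
        ((δ : ℂ) + Complex.I * ((-σ : ℝ) * t)) ^ (-(κ : ℂ)) := by
  set z : ℂ := (δ : ℂ) + Complex.I * ((-σ : ℝ) * t) with hz
  have hre : 0 < z.re := by simpa [hz] using hδ
  have hz0 : z ≠ 0 := fun h => by simp [h] at hre
  have harg := Complex.abs_arg_lt_pi_div_two_iff.mpr (Or.inl hre)
  rw [abs_lt] at harg
  have hσ2 : (σ : ℂ) * σ = 1 := by
    rcases hσ with rfl | rfl <;> simp
  have hσ0 : (σ : ℂ) ≠ 0 := fun h => by simp [h] at hσ2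
  have hw : (t : ℂ) + Complex.I * σ * δ = (σ * Complex.I) * z := by
    rw [hz]
    push_cast
    linear_combination (-(t : ℂ)) * hσ2 + (σ : ℂ) * σ * t * Complex.I_sq
  have hlogI : Complex.log (σ * Complex.I) = σ * (Real.pi / 2) * Complex.I := by
    rcases hσ with rfl | rfl
    · simp [Complex.log_I]
    · simp [Complex.log_neg_I]
  have hargI : Complex.arg (σ * Complex.I) = σ * (Real.pi / 2) := by
    rcases hσ with rfl | rfl
    · simp
    · simp [Complex.arg_neg_I]
  have hσI : (σ * Complex.I : ℂ) ≠ 0 := mul_ne_zero hσ0 Complex.I_ne_zero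
  -- The argument of `z` lies in `(-π/2, π/2)` and that of `σ i` is `±π/2`, so their sum stays in
  -- the principal range and the logarithm is additive.
  have hlog : Complex.log ((σ * Complex.I) * z) = Complex.log (σ * Complex.I) + Complex.log z := by
    refine Complex.log_mul hσI hz0 ?_
    rw [hargI]
    rcases hσ with rfl | rfl <;> constructor <;> linarith [Real.pi_pos]
  rw [hw, Complex.cpow_def_of_ne_zero (mul_ne_zero hσI hz0), Complex.cpow_def_of_ne_zero hz0,
    hlog, hlogI, ← Complex.exp_add]
  congr 1
  push_cast
  ring

/-- The Fourier transforms of the distributions `(t ± i0)^{-κ}`. -/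
lemma isPowI0_of_eq {σ : ℝ} (hσ : σ = 1 ∨ σ = -1) (hκ : 0 < κ) {T : 𝓓'((⊤ : Opens ℝ), ℂ)}
    (hT : ∀ φ, T φ = Complex.exp (-(Complex.I * (σ * κ) * (Real.pi / 2))) / Real.Gamma κ *
      ∫ ρ in Ioi (0 : ℝ), ((ρ ^ (κ - 1) : ℝ) : ℂ) * testFourier φ (-σ * ρ)) :
    IsPowI0 σ (-κ) T := by
  intro φ
  have hτ : -σ = 1 ∨ -σ = -1 := by
    rcases hσ with rfl | rfl <;> simp
  have h := (tendsto_integral_cpow_mul_testFunction hκ hτ φ).const_mul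
    (Complex.exp (-(Complex.I * (σ * κ) * (Real.pi / 2))) / Real.Gamma κ)
  have hΓ : (Real.Gamma κ : ℂ) ≠ 0 := by exact_mod_cast (Real.Gamma_pos_of_pos hκ).ne'
  rw [hT φ]
  refine h.congr' ?_
  filter_upwards [self_mem_nhdsWithin] with δ hδ
  simp only [add_I_mul_cpow hσ hδ, mul_assoc (Complex.exp _)]
  rw [integral_const_mul, ← mul_assoc, div_mul_cancel₀ _ hΓ]

/-- The transition profile of positive order. -/
def powerProfile (hκ : 0 < κ) (μp μm : ℂ) : 𝓓'((⊤ : Opens ℝ), ℂ) :=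
  fourierDistribution (profileMultiplier κ (μp / (2 * Real.pi)) (μm / (2 * Real.pi))) (⌊κ⌋₊ + 1)
    (integrable_profileMultiplier hκ _ _)

lemma powerProfile_apply (hκ : 0 < κ) (μp μm : ℂ) (φ : 𝓓((⊤ : Opens ℝ), ℝ)) :
    powerProfile hκ μp μm φ =
      μp / (2 * Real.pi) * (∫ ρ in Ioi (0 : ℝ), ((ρ ^ (κ - 1) : ℝ) : ℂ) * testFourier φ ρ) +
        μm / (2 * Real.pi) * ∫ ρ in Ioi (0 : ℝ), ((ρ ^ (κ - 1) : ℝ) : ℂ) * testFourier φ (-ρ) :=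
  integral_profileMultiplier_mul hκ _ _ _

/-- The distributions `(t ∓ i0)^{-κ}` have Fourier representations on opposite half-lines with
constants `q^{∓1} / Γ(κ)`. The factors `Γ(κ)` and `q^{±1}` in the profile cancel these, leaving `μ_±
/ 2π` as coefficients of `|ρ|^{κ-1}`. -/
lemma isTransitionProfile_powerProfile (hκ : 0 < κ) (μp μm : ℂ) :
    IsTransitionProfile κ μp μm (powerProfile hκ μp μm) := by
  refine ⟨fun _ => ?_, fun h => absurd h hκ.ne'⟩
  have hΓ : (Real.Gamma κ : ℂ) ≠ 0 := by exact_mod_cast (Real.Gamma_pos_of_pos hκ).ne'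
  set q := Complex.exp (-(Complex.I * κ * (Real.pi / 2))) with hq
  have hq0 : q ≠ 0 := Complex.exp_ne_zero _
  have h1 : Complex.exp (-(Complex.I * (((-1 : ℝ) : ℂ) * κ) * (Real.pi / 2))) = q⁻¹ := by
    rw [hq, ← Complex.exp_neg]
    congr 1
    push_cast
    ring
  have h2 : Complex.exp (-(Complex.I * (((1 : ℝ) : ℂ) * κ) * (Real.pi / 2))) = q := by
    rw [Complex.ofReal_one, one_mul]
  have hTm := fun φ : 𝓓((⊤ : Opens ℝ), ℝ) => integral_profileMultiplier_mul hκ (q⁻¹ / Real.Gamma κ)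
    0 (testFourier φ)
  have hTp := fun φ : 𝓓((⊤ : Opens ℝ), ℝ) => integral_profileMultiplier_mul hκ 0
    (q / Real.Gamma κ) (testFourier φ)
  simp only [zero_mul, add_zero, zero_add] at hTm hTp
  refine ⟨fourierDistribution (profileMultiplier κ (q⁻¹ / Real.Gamma κ) 0) (⌊κ⌋₊ + 1)
      (integrable_profileMultiplier hκ _ _),
    fourierDistribution (profileMultiplier κ 0 (q / Real.Gamma κ)) (⌊κ⌋₊ + 1)
      (integrable_profileMultiplier hκ _ _),
    isPowI0_of_eq (Or.inr rfl) hκ fun φ => ?_, isPowI0_of_eq (Or.inl rfl) hκ fun φ => ?_,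
    fun φ => ?_⟩
  · rw [fourierDistribution_apply, hTm φ, h1]
    simp only [neg_neg, one_mul]
  · rw [fourierDistribution_apply, hTp φ, h2]
    simp only [neg_mul, one_mul]
  · rw [powerProfile_apply, fourierDistribution_apply, fourierDistribution_apply, hTm φ, hTp φ]
    field_simp

lemma powerProfile_rescale (hκ : 0 < κ) (μp μm : ℂ) {ε : ℝ} (hε : 0 < ε)
    (φ : 𝓓((⊤ : Opens ℝ), ℝ)) :
    ((ε ^ (-κ) : ℝ) : ℂ) * powerProfile hκ μp μm φ = powerProfile hκ μp μm (rescale 0 ε φ) := by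
  rw [powerProfile, fourierDistribution_apply, fourierDistribution_apply,
    ← profileMultiplier_scaling _ _ _ hε]
  refine integral_congr_ae (Eventually.of_forall fun ρ => ?_)
  simp only [testFourier_rescale (0 : ℝ) hε, inner_zero_right, Complex.ofReal_zero, mul_zero,
    neg_zero, Complex.exp_zero, one_mul, smul_eq_mul]

end Profile

/-! ### Plane waves `μ(x · Θ)` and the case of order zero -/

section PlaneWaves

variable {n : ℕ} {Θ : Euc n}

/-- Restriction of Schwartz functions to the line through the origin in the direction `Θ`. -/
def lineRestriction (hΘ : ‖Θ‖ = 1) : 𝓢(Euc n, ℂ) →L[ℝ] 𝓢(ℝ, ℂ) :=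
  compCLM ℝ (g := fun ρ : ℝ => ρ • Θ)
    ((ContinuousLinearMap.toSpanSingleton ℝ Θ).hasTemperateGrowth) ⟨1, 1, fun ρ => by
      rw [norm_smul, hΘ]
      linarith⟩

/-- The plane wave `μ(x · Θ)` for the transition profile `μ` of positive order. -/
def powerPlaneWave (hΘ : ‖Θ‖ = 1) {κ : ℝ} (hκ : 0 < κ) (μp μm : ℂ) :
    𝓓'((⊤ : Opens (Euc n)), ℂ) :=
  ((schwartzPairing (profileMultiplier κ (μp / (2 * Real.pi)) (μm / (2 * Real.pi))) (⌊κ⌋₊ + 1)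
    (integrable_profileMultiplier hκ _ _)).comp
      ((lineRestriction hΘ).comp (testFourierCLM (Euc n))) :
    𝓓((⊤ : Opens (Euc n)), ℝ) →L[ℝ] ℂ)

lemma powerPlaneWave_apply (hΘ : ‖Θ‖ = 1) {κ : ℝ} (hκ : 0 < κ) (μp μm : ℂ)
    (φ : 𝓓((⊤ : Opens (Euc n)), ℝ)) :
    powerPlaneWave hΘ hκ μp μm φ = powerProfile hκ μp μm (radonTest hΘ φ) := by
  rw [powerProfile, fourierDistribution_apply]
  simp only [testFourier_radonTest]
  rfl

/-- By the slice theorem only the values on the line through `Θ` enter, where `P(∂)` contributes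
`i^m r^m P(±Θ)`. -/
lemma powerPlaneWave_polyDeriv (hΘ : ‖Θ‖ = 1) {κ : ℝ} (hκ : 0 < κ) (μp μm : ℂ)
    {P : MvPolynomial (Fin n) ℝ} {m : ℕ} (hP : P.IsHomogeneous m)
    (w : 𝓓((⊤ : Opens (Euc n)), ℝ)) :
    powerPlaneWave hΘ hκ μp μm (polyDeriv P w) = Complex.I ^ m *
      (μp / (2 * Real.pi) * ((MvPolynomial.eval (fun i => Θ i) P : ℝ) : ℂ) *
        (∫ r in Ioi (0 : ℝ), ((r ^ ((m : ℝ) + κ - 1) : ℝ) : ℂ) * testFourier w (r • Θ)) +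
      μm / (2 * Real.pi) * ((MvPolynomial.eval (fun i => (-Θ) i) P : ℝ) : ℂ) *
        ∫ r in Ioi (0 : ℝ), ((r ^ ((m : ℝ) + κ - 1) : ℝ) : ℂ) * testFourier w (-(r • Θ))) := by
  have hpow : ∀ r : ℝ, 0 < r → r ^ ((m : ℝ) + κ - 1) = r ^ (κ - 1) * r ^ m := fun r hr => by
    rw [← Real.rpow_natCast, ← Real.rpow_add hr]
    congr 1
    ring
  have h1 : ∫ r in Ioi (0 : ℝ), ((r ^ (κ - 1) : ℝ) : ℂ) * testFourier (polyDeriv P w) (r • Θ) =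
      Complex.I ^ m * ((MvPolynomial.eval (fun i => Θ i) P : ℝ) : ℂ) *
        ∫ r in Ioi (0 : ℝ), ((r ^ ((m : ℝ) + κ - 1) : ℝ) : ℂ) * testFourier w (r • Θ) := by
    rw [← integral_const_mul]
    refine setIntegral_congr_fun measurableSet_Ioi fun r hr => ?_
    simp only [testFourier_polyDeriv hP, eval_smul_of_isHomogeneous hP, hpow r hr]
    push_cast
    ring
  have h2 : ∫ r in Ioi (0 : ℝ), ((r ^ (κ - 1) : ℝ) : ℂ) *
      testFourier (polyDeriv P w) ((-r) • Θ) =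
      Complex.I ^ m * ((MvPolynomial.eval (fun i => (-Θ) i) P : ℝ) : ℂ) *
        ∫ r in Ioi (0 : ℝ), ((r ^ ((m : ℝ) + κ - 1) : ℝ) : ℂ) * testFourier w (-(r • Θ)) := by
    rw [← integral_const_mul]
    refine setIntegral_congr_fun measurableSet_Ioi fun r hr => ?_
    simp only [neg_smul, ← smul_neg, testFourier_polyDeriv hP, eval_smul_of_isHomogeneous hP,
      hpow r hr]
    push_cast
    ring
  rw [powerPlaneWave_apply, powerProfile_apply]
  simp only [testFourier_radonTest]
  rw [h1, h2]
  ring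

lemma integrable_of_norm_le_const {E : Type*} [NormedAddCommGroup E] [InnerProductSpace ℝ E]
    [FiniteDimensional ℝ E] [MeasurableSpace E] [BorelSpace E] {M : E → ℂ}
    (hM : AEStronglyMeasurable M) {C : ℝ} (hC : ∀ x, ‖M x‖ ≤ C) :
    Integrable fun x => M x * (((1 + ‖x‖) ^ (Module.finrank ℝ E + 1))⁻¹ : ℝ) := by
  have h := integrable_one_add_norm (E := E) (μ := volume)
    (r := ((Module.finrank ℝ E + 1 : ℕ) : ℝ)) (by push_cast; linarith)
  refine (h.const_mul C).mono' (hM.mul (Measurable.aestronglyMeasurable (by fun_prop)))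
    (Eventually.of_forall fun x => ?_)
  rw [norm_mul, Complex.norm_real, Real.norm_of_nonneg (by positivity),
    Real.rpow_neg (by positivity), Real.rpow_natCast]
  gcongr
  exact hC x

lemma measurable_real_sign : Measurable Real.sign :=
  Measurable.ite measurableSet_Iio measurable_const
    (Measurable.ite measurableSet_Ioi measurable_const measurable_const)

lemma norm_const_mul_sign_le (c : ℂ) (t : ℝ) : ‖c * (Real.sign t : ℂ)‖ ≤ ‖c‖ := by
  rw [norm_mul]
  refine mul_le_of_le_one_right (norm_nonneg _) ?_
  rcases Real.sign_apply_eq t with h | h | h <;> simp [h]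

/-- The distribution `c sgn t`. -/
def signProfile (c : ℂ) : 𝓓'((⊤ : Opens ℝ), ℂ) :=
  functionDistribution (fun t => c * (Real.sign t : ℂ)) _ (integrable_of_norm_le_const
    (Complex.measurable_ofReal.comp measurable_real_sign |>.const_mul c).aestronglyMeasurable
    (norm_const_mul_sign_le c))

lemma signProfile_apply (c : ℂ) (φ : 𝓓((⊤ : Opens ℝ), ℝ)) :
    signProfile c φ = ∫ t, c * (Real.sign t : ℂ) * (φ t : ℂ) := rfl

/-- The plane wave `c sgn(x · Θ)`. -/
def signPlaneWave (Θ : Euc n) (c : ℂ) : 𝓓'((⊤ : Opens (Euc n)), ℂ) :=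
  functionDistribution (fun x => c * (Real.sign ⟪Θ, x⟫ : ℂ)) _ (integrable_of_norm_le_const
    (Complex.measurable_ofReal.comp (measurable_real_sign.comp
      (Continuous.measurable (by fun_prop))) |>.const_mul c).aestronglyMeasurable
    fun _ => norm_const_mul_sign_le c _)

lemma signPlaneWave_apply (hΘ : ‖Θ‖ = 1) (c : ℂ) (φ : 𝓓((⊤ : Opens (Euc n)), ℝ)) :
    signPlaneWave Θ c φ = signProfile c (radonTest hΘ φ) := by
  have hint : Integrable fun x : Euc n => c * (Real.sign ⟪Θ, x⟫ : ℂ) * (φ x : ℂ) :=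
    (integrable_testFunction φ).bdd_mul (c := ‖c‖)
      (Complex.measurable_ofReal.comp (measurable_real_sign.comp
        (Continuous.measurable (by fun_prop))) |>.const_mul c).aestronglyMeasurable
      (Eventually.of_forall fun x => norm_const_mul_sign_le c _)
  rw [signPlaneWave, functionDistribution_apply, signProfile_apply, integral_slice hΘ hint]
  refine integral_congr_ae (Eventually.of_forall fun t => ?_)
  have h1 : ((radonTest hΘ φ t : ℝ) : ℂ) = radon (fun x => (φ x : ℂ)) Θ t :=
    (radon_ofReal φ t).symm
  simp only [inner_smul_add_orth hΘ]
  rw [integral_const_mul, h1, radon, hyperplaneMeasure_eq_volume]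

lemma testFourier_injective {E : Type*} [NormedAddCommGroup E] [InnerProductSpace ℝ E]
    [FiniteDimensional ℝ E] [MeasurableSpace E] [BorelSpace E] {φ ψ : 𝓓((⊤ : Opens E), ℝ)}
    (h : ∀ ξ, testFourier φ ξ = testFourier ψ ξ) : φ = ψ := by
  have h1 : 𝓕 (TestFunction.toSchwartz φ) = 𝓕 (TestFunction.toSchwartz ψ) := by
    ext ξ
    have h2 := h ((2 * Real.pi) • ξ)
    have h3 : ∀ χ : 𝓓((⊤ : Opens E), ℝ), testFourier χ ((2 * Real.pi) • ξ) =
        (𝓕 (TestFunction.toSchwartz χ) : 𝓢(E, ℂ)) ((2 * Real.pi)⁻¹ • ((2 * Real.pi) • ξ)) :=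
      fun _ => rfl
    rwa [h3, h3, inv_smul_smul₀ (by positivity)] at h2
  have h2 := (fourierEquiv ℂ 𝓢(E, ℂ)).injective h1
  ext x
  exact Complex.ofReal_injective (DFunLike.congr_fun h2 x)

/-- The weak form of `sgn' = 2δ`. -/
lemma integral_sign_mul_lineDeriv (χ : 𝓓((⊤ : Opens ℝ), ℝ)) :
    ∫ t, (Real.sign t : ℂ) * ((∂_{(1 : ℝ)} χ : 𝓓((⊤ : Opens ℝ), ℝ)) t : ℂ) = -2 * (χ 0 : ℂ) := by
  have hχ : ContDiff ℝ 1 χ := χ.contDiff.of_le (by simp)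
  have h1 := HasCompactSupport.integral_Iic_deriv_eq hχ χ.hasCompactSupport 0
  have h2 := HasCompactSupport.integral_Ioi_deriv_eq hχ χ.hasCompactSupport 0
  have hint : Integrable fun t : ℝ => Real.sign t * deriv χ t := by
    refine ((hχ.continuous_deriv le_rfl).integrable_of_hasCompactSupport
      χ.hasCompactSupport.deriv).bdd_mul (c := 1) measurable_real_sign.aestronglyMeasurable
      (Eventually.of_forall fun t => ?_)
    rcases Real.sign_apply_eq t with h | h | h <;> simp [h]
  have h3 := intervalIntegral.integral_Iic_add_Ioi (b := (0 : ℝ)) hint.integrableOn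
    hint.integrableOn
  have h4 : ∫ t in Iic (0 : ℝ), Real.sign t * deriv χ t = -∫ t in Iic (0 : ℝ), deriv χ t := by
    rw [integral_Iic_eq_integral_Iio, integral_Iic_eq_integral_Iio, ← integral_neg]
    refine setIntegral_congr_fun measurableSet_Iio fun t ht => ?_
    simp only [Real.sign_of_neg ht, neg_one_mul]
  have h5 : ∫ t in Ioi (0 : ℝ), Real.sign t * deriv χ t = ∫ t in Ioi (0 : ℝ), deriv χ t := by
    refine setIntegral_congr_fun measurableSet_Ioi fun t ht => ?_
    simp only [Real.sign_of_pos ht, one_mul]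
  rw [h4, h5, h1, h2] at h3
  have h6 : ∫ t, (Real.sign t : ℂ) * ((∂_{(1 : ℝ)} χ : 𝓓((⊤ : Opens ℝ), ℝ)) t : ℂ) =
      ((∫ t, Real.sign t * deriv χ t : ℝ) : ℂ) := by
    refine Eq.trans (integral_congr_ae (Eventually.of_forall fun t => ?_)) integral_ofReal
    simp only [lineDeriv_testFunction_apply, fderiv_apply_one_eq_deriv, Complex.coe_algebraMap,
      Complex.ofReal_mul]
  rw [h6, ← h3]
  push_cast
  ring

/-- For order zero the multiplier `1/ρ` is not integrable, but `P(∂)` with `m ≥ 1` supplies a factor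
`ρ`. The Radon transform of `P(∂) w` is a derivative `∂χ`; pairing it with the sign gives `-2 χ(0)`,
and Fourier inversion writes `χ(0)` as the sum of the two half-line integrals. -/
lemma signPlaneWave_polyDeriv (hΘ : ‖Θ‖ = 1) (c : ℂ) {P : MvPolynomial (Fin n) ℝ} {m : ℕ}
    (hm : 1 ≤ m) (hP : P.IsHomogeneous m) (w : 𝓓((⊤ : Opens (Euc n)), ℝ)) :
    signPlaneWave Θ (c * (-Complex.I / 2)) (polyDeriv P w) = Complex.I ^ m *
      (c / (2 * Real.pi) * ((MvPolynomial.eval (fun i => Θ i) P : ℝ) : ℂ) *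
        (∫ r in Ioi (0 : ℝ), ((r ^ ((m : ℝ) - 1) : ℝ) : ℂ) * testFourier w (r • Θ)) +
      -c / (2 * Real.pi) * ((MvPolynomial.eval (fun i => (-Θ) i) P : ℝ) : ℂ) *
        ∫ r in Ioi (0 : ℝ), ((r ^ ((m : ℝ) - 1) : ℝ) : ℂ) * testFourier w (-(r • Θ))) := by
  obtain ⟨k, rfl⟩ : ∃ k, m = k + 1 := ⟨m - 1, by omega⟩
  set p : ℝ := MvPolynomial.eval (fun i => Θ i) P with hp
  -- The parity of `P`, of degree `k + 1`, against the parity `(-1) ^ k` of the multiplier of `χ`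
  -- accounts for the opposite signs of the two coefficients.
  have hpn : MvPolynomial.eval (fun i => (-Θ) i) P = (-1) ^ (k + 1) * p := by
    rw [← eval_smul_of_isHomogeneous hP, neg_one_smul]
  -- In the direction `Θ`, `P(∂)` acts on the Radon transform as `P(Θ) ∂^m`; here one of the `m`
  -- derivatives is left out.
  set χ : 𝓓((⊤ : Opens ℝ), ℝ) := p • (fun η : 𝓓((⊤ : Opens ℝ), ℝ) => ∂_{(1 : ℝ)} η)^[k]
    (radonTest hΘ w) with hχ
  have hχF : ∀ ρ : ℝ, testFourier χ ρ = p * (Complex.I * ρ) ^ k * testFourier w (ρ • Θ) := by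
    intro ρ
    rw [hχ, ← testFourierCLM_apply, map_smul, testFourierCLM_apply, smul_apply,
      testFourier_iterate_lineDeriv, testFourier_radonTest, Complex.real_smul]
    simp only [RCLike.inner_apply, conj_trivial, mul_one, mul_assoc]
  have hψ : radonTest hΘ (polyDeriv P w) = ∂_{(1 : ℝ)} χ := by
    refine testFourier_injective fun ρ => ?_
    rw [testFourier_radonTest, testFourier_polyDeriv hP, eval_smul_of_isHomogeneous hP,
      testFourier_lineDeriv, hχF]
    simp only [RCLike.inner_apply, conj_trivial, mul_one]
    push_cast
    ring
  have h0 := integral_testFourier χ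
  rw [Module.finrank_self, pow_one, integral_real_eq_Ioi_add (testFourier χ).integrable] at h0
  have hpow : ∀ r : ℝ, r ^ (((k + 1 : ℕ) : ℝ) - 1) = r ^ k := fun r => by
    rw [← Real.rpow_natCast]
    congr 1
    push_cast
    ring
  have h1 : ∫ r in Ioi (0 : ℝ), testFourier χ r = p * Complex.I ^ k *
      ∫ r in Ioi (0 : ℝ), ((r ^ (((k + 1 : ℕ) : ℝ) - 1) : ℝ) : ℂ) * testFourier w (r • Θ) := by
    rw [← integral_const_mul]
    refine setIntegral_congr_fun measurableSet_Ioi fun r _ => ?_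
    simp only [hχF, hpow]
    push_cast
    ring
  have h2 : ∫ r in Ioi (0 : ℝ), testFourier χ (-r) = p * Complex.I ^ k * (-1) ^ k *
      ∫ r in Ioi (0 : ℝ), ((r ^ (((k + 1 : ℕ) : ℝ) - 1) : ℝ) : ℂ) *
        testFourier w (-(r • Θ)) := by
    rw [← integral_const_mul]
    refine setIntegral_congr_fun measurableSet_Ioi fun r _ => ?_
    simp only [hχF, hpow, neg_smul]
    push_cast
    rw [mul_neg, neg_pow (Complex.I * r), mul_pow]
    ring
  rw [h1, h2] at h0
  rw [signPlaneWave_apply hΘ, hψ, signProfile_apply]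
  simp only [mul_assoc (c * (-Complex.I / 2))]
  rw [integral_const_mul, integral_sign_mul_lineDeriv, hpn]
  have hpi : (Real.pi : ℂ) ≠ 0 := by exact_mod_cast Real.pi_ne_zero
  generalize (∫ r in Ioi (0 : ℝ), ((r ^ (((k + 1 : ℕ) : ℝ) - 1) : ℝ) : ℂ) *
    testFourier w (r • Θ)) = I₁ at h0 ⊢
  generalize (∫ r in Ioi (0 : ℝ), ((r ^ (((k + 1 : ℕ) : ℝ) - 1) : ℝ) : ℂ) *
    testFourier w (-(r • Θ))) = I₂ at h0 ⊢
  have h3 : (χ 0 : ℂ) = (p * Complex.I ^ k * I₁ + p * Complex.I ^ k * (-1) ^ k * I₂) /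
      (2 * Real.pi) := by
    rw [h0]
    field_simp
  rw [h3]
  push_cast
  field_simp
  ring

/-- The transition profile and the corresponding plane wave. -/
lemma exists_transitionProfile (hΘ : ‖Θ‖ = 1) {κ : ℝ} (hκ : 0 ≤ κ) {μp μm : ℂ}
    (h0 : κ = 0 → μm = -μp) :
    ∃ (u₀ : 𝓓'((⊤ : Opens (Euc n)), ℂ)) (μ : 𝓓'((⊤ : Opens ℝ), ℂ)),
      IsTransitionProfile κ μp μm μ ∧ (∀ φ, u₀ φ = μ (radonTest hΘ φ)) ∧
      (∀ ε : ℝ, 0 < ε → ∀ φ, ((ε ^ (-κ) : ℝ) : ℂ) * μ φ = μ (rescale 0 ε φ)) ∧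
      ∀ m : ℕ, 1 ≤ m → ∀ P : MvPolynomial (Fin n) ℝ, P.IsHomogeneous m →
        ∀ w : 𝓓((⊤ : Opens (Euc n)), ℝ), u₀ (polyDeriv P w) = Complex.I ^ m *
          (μp / (2 * Real.pi) * ((MvPolynomial.eval (fun i => Θ i) P : ℝ) : ℂ) *
            (∫ r in Ioi (0 : ℝ), ((r ^ ((m : ℝ) + κ - 1) : ℝ) : ℂ) * testFourier w (r • Θ)) +
          μm / (2 * Real.pi) * ((MvPolynomial.eval (fun i => (-Θ) i) P : ℝ) : ℂ) *
            ∫ r in Ioi (0 : ℝ), ((r ^ ((m : ℝ) + κ - 1) : ℝ) : ℂ) *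
              testFourier w (-(r • Θ))) := by
  rcases hκ.eq_or_lt with rfl | hκ'
  · refine ⟨signPlaneWave Θ (μp * (-Complex.I / 2)), signProfile (μp * (-Complex.I / 2)),
      ⟨fun h => absurd h (lt_irrefl 0), fun _ φ => rfl⟩, signPlaneWave_apply hΘ _,
      fun ε hε φ => ?_, fun m hm P hP w => ?_⟩
    · rw [neg_zero, Real.rpow_zero, Complex.ofReal_one, one_mul, signProfile_apply,
        signProfile_apply, integral_mul_rescale (0 : ℝ) hε]
      refine integral_congr_ae (Eventually.of_forall fun t => ?_)
      have : Real.sign (0 + ε • t) = Real.sign t := by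
        rw [zero_add, smul_eq_mul]
        rcases lt_trichotomy t 0 with h | h | h
        · rw [Real.sign_of_neg h, Real.sign_of_neg (mul_neg_of_pos_of_neg hε h)]
        · rw [h, mul_zero]
        · rw [Real.sign_of_pos h, Real.sign_of_pos (mul_pos hε h)]
      simp only [this]
    · rw [signPlaneWave_polyDeriv hΘ μp hm hP w, h0 rfl, add_zero]
  · exact ⟨powerPlaneWave hΘ hκ' μp μm, powerProfile hκ' μp μm,
      isTransitionProfile_powerProfile hκ' μp μm, powerPlaneWave_apply hΘ hκ' μp μm,
      fun ε hε φ => powerProfile_rescale hκ' μp μm hε φ,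
      fun m _ P hP w => powerPlaneWave_polyDeriv hΘ hκ' μp μm hP w⟩

end PlaneWaves

theorem mainTheorem5 {n : ℕ} (hn : 2 ≤ n)
    (ξ₀ Θ₀ x₀ : Euc n) (hξ₀ : ξ₀ ≠ 0) (hΘ₀ : Θ₀ = unitDir ξ₀)
    -- the neighborhood of the direction and the phase
    (Ω : Set (Euc n)) (hΩ : IsOpenInSphere Ω) (hΘ₀Ω : Θ₀ ∈ Ω)
    (H : Euc n → ℝ) (hH : IsPhase Ω H) (hx₀ : gradient H ξ₀ = x₀)
    (hΩ_small : ∀ α ∈ Ω, gradient H α = x₀ → α = Θ₀)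
    -- the function and its amplitude
    (v : Euc n → ℂ) (s : ℕ → ℝ) (vj : ℕ → Euc n → ℂ) (hv : IsAmplitude Ω H v s vj)
    (f : Euc n → ℂ) (hf_int : Integrable f) (hf : IsOscillatoryIntegral f v H)
    -- the operator
    (B : Euc n → ℝ → ℂ) (β : ℕ → ℝ) (Bj : ℕ → Euc n → ℂ) (hB : IsFilterSymbol B β Bj)
    -- the standing assumptions on the orders
    (κ₂ : ℝ) (hκ₂ : κ₂ = β 0 - s 0 - ((n : ℝ) - 3) / 2) (hκ₂_nonneg : 0 ≤ κ₂)
    (hzero : κ₂ = 0 → ∀ α ∈ Ω ∪ -Ω, vj 0 (-α) * Bj 0 (-α) = -(vj 0 α * Bj 0 α)) :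
    ∃ (u u₀ : 𝓓'((⊤ : Opens (Euc n)), ℂ)) (μ : 𝓓'((⊤ : Opens ℝ), ℂ)),
      -- `u = 𝓑 f̂`
      (∀ φ, u φ = filteredBackprojection B (radon f) φ) ∧
      -- `μ` is the explicit distribution on the line
      IsTransitionProfile κ₂ (2 * Bj 0 Θ₀ * vj 0 Θ₀) (2 * Bj 0 (-Θ₀) * vj 0 (-Θ₀)) μ ∧
      -- `u₀(x) = μ(x · Θ₀)`
      (∀ φ, u₀ φ = μ (radonTest (norm_eq_one_of_eq_unitDir hξ₀ hΘ₀) φ)) ∧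
      -- `u(x₀ + ε x) ∼ ε^{-κ₂} μ(x · Θ₀)`
      IsLeadingSingularity u x₀ (-κ₂) u₀ ∧
      -- `ε^{-κ₂} μ(t) = μ(ε t)`
      (∀ ε : ℝ, 0 < ε → ∀ φ, ((ε ^ (-κ₂) : ℝ) : ℂ) * μ φ = μ (rescale 0 ε φ)) := by
  have : Nontrivial (Euc n) := by
    have : Nontrivial (Fin n) := Fin.nontrivial_iff_two_le.mpr hn
    infer_instance
  have hΘ1 : ‖Θ₀‖ = 1 := norm_eq_one_of_eq_unitDir hξ₀ hΘ₀
  have hΘ0 : Θ₀ ≠ 0 := fun h => by simp [h] at hΘ1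
  -- The gradient of `H` is constant along rays, so the critical point `ξ₀` may be replaced by its
  -- direction.
  have hgrad : gradient H Θ₀ = x₀ := by
    have h1 := (hH.fderiv_centredPhase_eq_zero_iff x₀ hξ₀).mpr hx₀
    rw [← hH.fderiv_centredPhase_eq_zero_iff x₀ hΘ0, hΘ₀, unitDir,
      (hH.isHomogSmooth_centredPhase x₀).fderiv_smul (inv_pos.mpr (norm_pos_iff.mpr hξ₀)) hξ₀, h1,
      smul_zero]
  set F : Euc n → ℂ := fun ξ => v ξ * Complex.exp (Complex.I * (H ξ : ℂ)) with hF
  have hFc : ContinuousOn F {0}ᶜ := continuousOn_amplitude_mul_exp hH hv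
  obtain ⟨C, hC⟩ := hv.exists_bound
  have hFb : ∀ ξ, ‖F ξ‖ ≤ C := fun ξ => by
    rw [hF, norm_mul, norm_cexp_I_mul_real, mul_one]
    exact hC ξ
  obtain ⟨N, hN⟩ := hB.exists_integrable_multiplier hFc hFb
  obtain ⟨m₀, hm₀, hlim⟩ := tendsto_rpow_mul_integral_multiplier hΩ hH hΘ₀Ω hgrad hΩ_small hv hB
    hκ₂ hκ₂_nonneg
  obtain ⟨u₀, μ, hμ, hu₀, hscale, hpoly⟩ := exists_transitionProfile hΘ1 hκ₂_nonneg
    (μp := 2 * Bj 0 Θ₀ * vj 0 Θ₀) (μm := 2 * Bj 0 (-Θ₀) * vj 0 (-Θ₀)) fun h => by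
      linear_combination 2 * hzero h Θ₀ (Or.inl hΘ₀Ω)
  refine ⟨fourierDistribution _ N hN, u₀, μ, fun φ => ?_, hμ, hu₀, ⟨m₀, fun m hm P hP w => ?_⟩,
    hscale⟩
  · rw [fourierDistribution_apply, hB.filteredBackprojection_eq hf_int hFc hFb
      (fun ξ hξ => hf.fourier_eq hH hv hf_int hξ) φ]
  · simp only [fourierDistribution_apply, sub_neg_eq_add]
    rw [hpoly m (hm₀.trans hm) P hP w]
    -- The two limits agree because `π⁻¹ B₀ v₀ = μ_± / 2π` at `±Θ₀`, the factor `2` in `μ_±` being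
    -- the one lost in `1/π`.
    refine (hlim m hm P hP w).trans (le_of_eq (congrArg 𝓝 ?_))
    ring

end
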